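/- Consider $n$ bosonic modes with ladder operators $a_j,a_j^\dagger$ ($1\le j\le n$) on the Fock space with number states $|m\rangle$, $m\in\mathbb N^n$, and coherent states $|\alpha\rangle=e^{-|\alpha|^2/2}\sum_m\prod_j\frac{\alpha_j^{m_j}}{\sqrt{m_j!}}\,|m\rangle$, $\alpha\in\mathbb C^n$. For a density operator $\rho$ let $Q_\rho(\alpha)=\langle\alpha|\rho|\alpha\rangle$ be its $Q$ function and $$H_W(\rho)=-\frac1{\pi^n}\int_{\mathbb C^n}Q_\rho(\alpha)\log Q_\rho(\alpha)\,d^{2n}\alpha$$ its Wehrl entropy. With $D(\xi)=\exp\big(\sum_j(\xi_ja_j^\dagger-\xi_j^*a_j)\big)$, let $$W_\rho(\alpha)=\frac1{\pi^n}\int_{\mathbb C^n}\exp\Big(\sum_j(\alpha_j\xi_j^*-\alpha_j^*\xi_j)\Big)\,\mathrm{Tr}(\rho D(\xi))\,d^{2n}\xi$$ be the Wigner function. The state $\rho$ is called Gaussian if $W_\rho$ is Gaussian, that is, $W_\rho(\alpha)=c\,e^{-q(\alpha-\mu)}$ with $c>0$, $\mu\in\mathbb C^n$ and $q$ a positive definite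 real quadratic form on $\mathbb C^n=\mathbb R^{2n}$. First and second moments of a state are those of the probability density $\pi^{-n}Q_\rho$ on $\mathbb C^n$, i.e. the averages of $\alpha_j$, $\alpha_j\alpha_k$ and $\alpha_j\alpha_k^*$. Let $\rho$ be a density operator with finite second moments. Then there is exactly one Gaussian state $\rho_G$ with the same first and second moments as $\rho$; the integrals that define $H_W(\rho)$ and $H_W(\rho_G)$ converge absolutely; and $$\mathcal N(\rho)=H_W(\rho_G)-H_W(\rho)\ \ge\ 0,$$ with equality if and only if $\rho$ is Gaussian. -/

import Mathlib

open MeasureTheory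
open scoped ComplexConjugate

noncomputable section

namespace Bosonic

/-! ### The Hilbert space of `n` modes in its number representation -/

/-- The Hilbert space of `n` modes: `ℓ²` over the occupation numbers `m = (m₁, …, mₙ)`. -/
abbrev Fock (n : ℕ) : Type := lp (fun _ : Fin n → ℕ => ℂ) 2

/-- The number state `|m⟩`. -/
def numberState {n : ℕ} (m : Fin n → ℕ) : Fock n := lp.single 2 m (1 : ℂ)

/-- The number-basis amplitudes `e^{-|α|²/2} ∏ⱼ αⱼ^{mⱼ} / √(mⱼ!)` of the coherent state `|α⟩`. -/
def coherentCoeff {n : ℕ} (α : Fin n → ℂ) (m : Fin n → ℕ) : ℂ :=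
  (Real.exp (-(∑ j, ‖α j‖ ^ 2) / 2) : ℂ) *
    ∏ j, α j ^ m j / (Real.sqrt (Nat.factorial (m j)) : ℂ)

theorem summable_prod_of_nonneg {n : ℕ} (f : Fin n → ℕ → ℝ) (hf : ∀ j k, 0 ≤ f j k)
    (hs : ∀ j, Summable (f j)) : Summable fun m : Fin n → ℕ => ∏ j, f j (m j) := by
  classical
  refine summable_of_sum_le (c := ∏ j, ∑' k, f j k)
    (fun m => Finset.prod_nonneg fun j _ => hf j (m j)) fun s => ?_
  let t : Fin n → Finset ℕ := fun j => s.image fun m => m j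
  calc ∑ m ∈ s, ∏ j, f j (m j) ≤ ∑ m ∈ Fintype.piFinset t, ∏ j, f j (m j) := by
        refine Finset.sum_le_sum_of_subset_of_nonneg (fun m hm => ?_)
          fun m _ _ => Finset.prod_nonneg fun j _ => hf j (m j)
        exact Fintype.mem_piFinset.2 fun j => Finset.mem_image_of_mem _ hm
    _ = ∏ j, ∑ k ∈ t j, f j k := (Finset.prod_univ_sum t f).symm
    _ ≤ ∏ j, ∑' k, f j k := by
        refine Finset.prod_le_prod (fun j _ => Finset.sum_nonneg fun k _ => hf j k) fun j _ => ?_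
        exact (hs j).sum_le_tsum _ fun k _ => hf j k

theorem memℓp_coherentCoeff {n : ℕ} (α : Fin n → ℂ) :
    Memℓp (E := fun _ : Fin n → ℕ => ℂ) (coherentCoeff α) 2 := by
  refine memℓp_gen ?_
  have h := (summable_prod_of_nonneg (fun j k => (‖α j‖ ^ 2) ^ k / (Nat.factorial k : ℝ))
    (fun j k => by positivity)
    (fun j => Real.summable_pow_div_factorial (‖α j‖ ^ 2))).mul_left
      (Real.exp (-(∑ j, ‖α j‖ ^ 2) / 2) ^ 2)
  refine h.congr fun m => ?_
  simp only [coherentCoeff, ENNReal.toReal_ofNat, Real.rpow_ofNat, norm_mul, norm_prod, norm_div,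
    norm_pow, Complex.norm_real, mul_pow, div_pow, Real.norm_eq_abs, sq_abs,
    Finset.prod_div_distrib]
  congr 2
  · rw [← Finset.prod_pow]
    exact Finset.prod_congr rfl fun j _ => by ring
  · rw [← Finset.prod_pow]
    exact Finset.prod_congr rfl fun j _ => by
      rw [sq_abs, Real.sq_sqrt (Nat.cast_nonneg _)]

/-- The coherent state `|α⟩`, `α ∈ ℂⁿ`. -/
def coherentState {n : ℕ} (α : Fin n → ℂ) : Fock n := ⟨coherentCoeff α, memℓp_coherentCoeff α⟩

/-! ### States, `Q` function, Wehrl entropy -/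

/-- An `n`-mode state: a positive operator of trace one. (For a positive bounded operator,
convergence of the diagonal sum in one orthonormal basis is the trace class property, and the sum
is the trace.) -/
@[ext]
structure State (n : ℕ) where
  op : Fock n →L[ℂ] Fock n
  isPositive : op.IsPositive
  trace_eq_one : HasSum (fun m => inner ℂ (numberState m) (op (numberState m))) 1

/-- The `Q` function `Q(α) = ⟨α|ρ|α⟩`. -/
def qFunction {n : ℕ} (ρ : State n) (α : Fin n → ℂ) : ℝ :=
  (inner ℂ (coherentState α) (ρ.op (coherentState α))).re

/-- The Wehrl entropy `-π⁻ⁿ ∫ Q log Q`, where `d²α = d(Re α) d(Im α)`. -/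
def wehrlEntropy {n : ℕ} (ρ : State n) : ℝ :=
  -(1 / Real.pi ^ n) * ∫ α : Fin n → ℂ, qFunction ρ α * Real.log (qFunction ρ α)

/-- The integral that defines the Wehrl entropy converges absolutely. -/
def HasFiniteWehrlEntropy {n : ℕ} (ρ : State n) : Prop :=
  Integrable fun α : Fin n → ℂ => qFunction ρ α * Real.log (qFunction ρ α)

/-! ### First and second moments -/

/-- The phase-space average `π⁻ⁿ ∫ g(α) Q(α) d²ⁿα`. -/
def qAverage {n : ℕ} (ρ : State n) (g : (Fin n → ℂ) → ℂ) : ℂ :=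
  (1 / Real.pi ^ n : ℂ) * ∫ α : Fin n → ℂ, g α * (qFunction ρ α : ℂ)

/-- The second moments of the `Q` function exist. -/
def HasFiniteSecondMoments {n : ℕ} (ρ : State n) : Prop :=
  ∀ j, Integrable fun α : Fin n → ℂ => ‖α j‖ ^ 2 * qFunction ρ α

/-- `ρ` and `σ` have the same (finite) first and second moments. -/
structure SameMoments {n : ℕ} (ρ σ : State n) : Prop where
  finite_left : HasFiniteSecondMoments ρ
  finite_right : HasFiniteSecondMoments σ
  first : ∀ j, qAverage ρ (fun α => α j) = qAverage σ (fun α => α j)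
  second : ∀ j k, qAverage ρ (fun α => α j * α k) = qAverage σ (fun α => α j * α k)
  second_conj : ∀ j k,
    qAverage ρ (fun α => α j * conj (α k)) = qAverage σ (fun α => α j * conj (α k))

/-! ### Displacement operators, Wigner function, Gaussian states -/

/-- Finite linear combinations of number states, the common invariant domain of the ladder
operators. -/
abbrev FiniteVec (n : ℕ) : Type := (Fin n → ℕ) →₀ ℂ

/-- The inclusion of the finite linear combinations of number states in the Hilbert space. -/
def toFock {n : ℕ} : FiniteVec n →ₗ[ℂ] Fock n := Finsupp.linearCombination ℂ numberState

/-- `aⱼ|m⟩ = √mⱼ |m - eⱼ⟩`, which is `0` if `mⱼ = 0`. -/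
def annihilation {n : ℕ} (j : Fin n) : Module.End ℂ (FiniteVec n) :=
  Finsupp.linearCombination ℂ fun m : Fin n → ℕ =>
    Finsupp.single (m - Pi.single j 1) (Real.sqrt (m j) : ℂ)

/-- `aⱼ†|m⟩ = √(mⱼ + 1) |m + eⱼ⟩`. -/
def creation {n : ℕ} (j : Fin n) : Module.End ℂ (FiniteVec n) :=
  Finsupp.linearCombination ℂ fun m : Fin n → ℕ =>
    Finsupp.single (m + Pi.single j 1) (Real.sqrt (m j + 1) : ℂ)

/-- The generator `∑ⱼ (ξⱼ aⱼ† - ξⱼ* aⱼ)`. -/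
def displacementGenerator {n : ℕ} (ξ : Fin n → ℂ) : Module.End ℂ (FiniteVec n) :=
  ∑ j, (ξ j • creation j - conj (ξ j) • annihilation j)

/-- The vector `D(ξ)|m⟩`, where `D(ξ) = exp(∑ⱼ (ξⱼ aⱼ† - ξⱼ* aⱼ))`. Number states are analytic
vectors of the generator, so the exponential series converges in norm on them. -/
def displacedNumberState {n : ℕ} (ξ : Fin n → ℂ) (m : Fin n → ℕ) : Fock n :=
  ∑' k : ℕ, ((Nat.factorial k : ℂ)⁻¹) •
    toFock ((displacementGenerator ξ ^ k) (Finsupp.single m 1))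

/-- The characteristic function `Tr(ρ D(ξ))`. -/
def charFunction {n : ℕ} (ρ : State n) (ξ : Fin n → ℂ) : ℂ :=
  ∑' m : Fin n → ℕ, inner ℂ (numberState m) (ρ.op (displacedNumberState ξ m))

/-- The Wigner function `π⁻ⁿ ∫ exp(∑ⱼ (αⱼ ξⱼ* - αⱼ* ξⱼ)) Tr(ρ D(ξ)) d²ⁿξ`. -/
def wigner {n : ℕ} (ρ : State n) (α : Fin n → ℂ) : ℂ :=
  (1 / Real.pi ^ n : ℂ) * ∫ ξ : Fin n → ℂ,
    Complex.exp (∑ j, (α j * conj (ξ j) - conj (α j) * ξ j)) * charFunction ρ ξ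

/-- `f` is a Gaussian function on phase space `ℂⁿ = ℝ²ⁿ`: up to a positive factor it is `exp` of
minus a positive definite real quadratic form, centred at some point. -/
def IsGaussianFunction {n : ℕ} (f : (Fin n → ℂ) → ℂ) : Prop :=
  ∃ (c : ℝ) (μ : Fin n → ℂ) (q : QuadraticForm ℝ (Fin n → ℂ)), 0 < c ∧ q.PosDef ∧
    ∀ α, f α = ((c * Real.exp (-q (α - μ)) : ℝ) : ℂ)

/-- A state is Gaussian if its Wigner function is Gaussian. (If the characteristic function is not
integrable, then the state is not Gaussian and `wigner` takes the value `0`, not a Gaussian.) -/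
def IsGaussian {n : ℕ} (ρ : State n) : Prop := IsGaussianFunction (wigner ρ)

/-! ### The non-Gaussianity measure -/

/-- `σ` is a Gaussian state with the same first and second moments as `ρ`. -/
def IsGaussianPartner {n : ℕ} (ρ σ : State n) : Prop := IsGaussian σ ∧ SameMoments ρ σ

open Classical in
/-- The Gaussian state `ρ_G` with the same first and second moments as `ρ` (and `ρ` itself in case
there is none, as for a state without second moments). -/
def gaussianPartner {n : ℕ} (ρ : State n) : State n :=
  if h : ∃ σ, IsGaussianPartner ρ σ then h.choose else ρ

/-- The non-Gaussianity measure `N(ρ) = H_W(ρ_G) - H_W(ρ)`. -/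
def nonGaussianity {n : ℕ} (ρ : State n) : ℝ :=
  wehrlEntropy (gaussianPartner ρ) - wehrlEntropy ρ

end Bosonic

end

noncomputable section

open Filter Topology

namespace Bosonic

/-! ### Fock space in the Bargmann representation -/

section

/-! ### Sums over multi-indices -/

/-! The entropy bound is Gibbs' inequality for the densities π⁻ⁿQ. The logarithm of a Gaussian Q
function is a polynomial of degree two, so its average is the same for `ρ` and for a state `σ` with
Gaussian Q function and the same first and second moments. Hence `wehrlEntropy σ - wehrlEntropy ρ`
is the relative entropy of the two densities. It is nonnegative and vanishes only if the Q functions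
agree; then the states agree, because the values ⟨α|ρ|α⟩ fix all ⟨β|ρ|α⟩ by analytic continuation
(`State.eq_of_qFunction_eq`). This is `SameMoments.gibbs`. Applied in both directions to two
Gaussian partners, it also gives uniqueness.

Gaussian Wigner functions and Gaussian Q functions are linked by `charFunction_eq`: Tr(ρD(ξ)) is
e^{|ξ|²/2} π⁻ⁿ times the symplectic Fourier transform of Q. Passing from Wigner to Q adds |ξ|²/2 to
a positive definite form, which is harmless (`IsGaussian.exists_hasGaussianQ`). The way back
subtracts it and needs a lower bound for the form (`HasGaussianQ.isGaussian`).

Existence of the partner rests on `uncertainty`: the average of |u·α + v·α* + s|² is at least |u|².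
The functions α ↦ ⟨α|ψ⟩ are e^{-|α|²/2} times an entire function of α*, and they form a closed
subspace of L². Square-integrable multiples by v·α* + s stay in it, while multiplication by u·α
leaves it, with an orthogonal component of squared norm at least |u|²πⁿ‖ψ‖². Two consequences for
the covariance of Q are used. The strict form for real functionals (`uncertainty_strict`) is the
lower bound required above. The form `Whitens.two_mul_sum_norm_sq_le` allows the Gaussian with the
given covariance to be written as ∑ |⟨α|ψ_κ⟩|², so that it is the Q function of ∑ |ψ_κ⟩⟨ψ_κ|
(`exists_state_hasGaussianQ`). -/

theorem tendsto_cubes (n : ℕ) :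
    Tendsto (fun N : ℕ => Fintype.piFinset fun _ : Fin n => Finset.range N) atTop atTop := by
  refine tendsto_atTop_finset_of_monotone (fun N M h m => ?_) fun m => ?_
  · simp only [Fintype.mem_piFinset, Finset.mem_range]
    exact fun hm j => (hm j).trans_le h
  · refine ⟨∑ j, m j + 1, ?_⟩
    simp only [Fintype.mem_piFinset, Finset.mem_range]
    exact fun j => Nat.lt_succ_of_le (Finset.single_le_sum (fun _ _ => Nat.zero_le _)
      (Finset.mem_univ j))

/-- Sums over cubes factorise, and the cubes exhaust the index set; absolute convergence makes the
limit along cubes the sum. -/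
theorem hasSum_prod_pi {n : ℕ} {f : Fin n → ℕ → ℂ} {a : Fin n → ℂ}
    (hf : ∀ j, Summable fun k => ‖f j k‖) (ha : ∀ j, HasSum (f j) (a j)) :
    HasSum (fun m : Fin n → ℕ => ∏ j, f j (m j)) (∏ j, a j) := by
  have hs : Summable fun m : Fin n → ℕ => ∏ j, f j (m j) := by
    refine Summable.of_norm ?_
    simp only [norm_prod]
    exact summable_prod_of_nonneg (fun j k => ‖f j k‖) (fun _ _ => norm_nonneg _) hf
  have h1 := hs.hasSum.comp (tendsto_cubes n)
  have h2 : Tendsto (fun N : ℕ => ∏ j, ∑ k ∈ Finset.range N, f j k) atTop (𝓝 (∏ j, a j)) :=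
    tendsto_finsetProd _ fun j _ => (ha j).tendsto_sum_nat
  have h3 : (fun N : ℕ => ∏ j, ∑ k ∈ Finset.range N, f j k) =
      (fun s : Finset (Fin n → ℕ) => ∑ m ∈ s, ∏ j, f j (m j)) ∘
        fun N : ℕ => Fintype.piFinset fun _ : Fin n => Finset.range N := by
    funext N
    exact Finset.prod_univ_sum _ _
  rw [h3] at h2
  rw [← tendsto_nhds_unique h1 h2]
  exact hs.hasSum

/-- The squared Euclidean length `|α|²`. -/
def absSq {n : ℕ} (α : Fin n → ℂ) : ℝ := ∑ j, ‖α j‖ ^ 2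

theorem absSq_nonneg {n : ℕ} (α : Fin n → ℂ) : 0 ≤ absSq α :=
  Finset.sum_nonneg fun _ _ => by positivity

/-- The normalised monomial `∏ⱼ zⱼ^{mⱼ} / √(mⱼ!)`. -/
def monomialFun {n : ℕ} (m : Fin n → ℕ) (z : Fin n → ℂ) : ℂ :=
  ∏ j, z j ^ m j / (Real.sqrt (Nat.factorial (m j)) : ℂ)

theorem coherentCoeff_eq {n : ℕ} (α : Fin n → ℂ) (m : Fin n → ℕ) :
    coherentCoeff α m = (Real.exp (-absSq α / 2) : ℂ) * monomialFun m α := rfl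

theorem monomialFun_star {n : ℕ} (m : Fin n → ℕ) (z : Fin n → ℂ) :
    monomialFun m (star z) = conj (monomialFun m z) := by
  simp [monomialFun, map_prod]

theorem norm_monomialFun {n : ℕ} (m : Fin n → ℕ) (z : Fin n → ℂ) :
    ‖monomialFun m z‖ = ∏ j, ‖z j‖ ^ m j / Real.sqrt (Nat.factorial (m j)) := by
  simp [monomialFun, norm_prod, abs_of_nonneg, Real.sqrt_nonneg]

/-- The absolute value of the term is the product of (2|r|)^k/√(k!) and (1/2)^k, and is bounded by
the sum of their squares, which are terms of an exponential and of a geometric series. -/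
theorem summable_pow_div_sqrt_factorial (r : ℝ) :
    Summable fun k : ℕ => r ^ k / Real.sqrt (Nat.factorial k) := by
  have h1 := Real.summable_pow_div_factorial (4 * r ^ 2)
  have h2 := summable_geometric_of_lt_one (r := (1 / 4 : ℝ)) (by norm_num) (by norm_num)
  refine Summable.of_norm_bounded (h1.add h2) fun k => ?_
  have hf : 0 < Real.sqrt (Nat.factorial k) := Real.sqrt_pos.2 (by exact_mod_cast k.factorial_pos)
  have hs : Real.sqrt (Nat.factorial k) ^ 2 = Nat.factorial k := Real.sq_sqrt (Nat.cast_nonneg _)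
  have e1 : (4 * r ^ 2) ^ k / (Nat.factorial k : ℝ) =
      ((2 * |r|) ^ k / Real.sqrt (Nat.factorial k)) ^ 2 := by
    rw [div_pow, hs, ← pow_mul, mul_comm k 2, pow_mul, mul_pow 2 |r| 2, sq_abs]; norm_num
  have e2 : (1 / 4 : ℝ) ^ k = ((1 / 2) ^ k) ^ 2 := by
    rw [← pow_mul, mul_comm k 2, pow_mul]; norm_num
  have e3 : ‖r ^ k / Real.sqrt (Nat.factorial k)‖ =
      ((2 * |r|) ^ k / Real.sqrt (Nat.factorial k)) * (1 / 2) ^ k := by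
    rw [norm_div, norm_pow, Real.norm_eq_abs, Real.norm_eq_abs, abs_of_pos hf, mul_pow, one_div,
      inv_pow]
    field_simp
  rw [e1, e2, e3]
  nlinarith [sq_nonneg ((2 * |r|) ^ k / Real.sqrt (Nat.factorial k) - (1 / 2) ^ k),
    sq_nonneg ((2 * |r|) ^ k / Real.sqrt (Nat.factorial k)), sq_nonneg ((1 / 2 : ℝ) ^ k)]

theorem summable_norm_monomialFun {n : ℕ} (z : Fin n → ℂ) :
    Summable fun m : Fin n → ℕ => ‖monomialFun m z‖ := by
  simp only [norm_monomialFun]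
  exact summable_prod_of_nonneg (fun j k => ‖z j‖ ^ k / Real.sqrt (Nat.factorial k))
    (fun _ _ => by positivity) fun j => summable_pow_div_sqrt_factorial _

theorem hasSum_monomialFun_mul {n : ℕ} (z w : Fin n → ℂ) :
    HasSum (fun m : Fin n → ℕ => monomialFun m z * monomialFun m w)
      (Complex.exp (∑ j, z j * w j)) := by
  rw [Complex.exp_sum]
  have h := hasSum_prod_pi (f := fun j k => (z j * w j) ^ k / (Nat.factorial k : ℂ))
    (a := fun j => Complex.exp (z j * w j)) (fun j => ?_) fun j => ?_
  · convert h using 2 with m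
    rw [monomialFun, monomialFun, ← Finset.prod_mul_distrib]
    refine Finset.prod_congr rfl fun j _ => ?_
    rw [div_mul_div_comm, ← mul_pow, ← Complex.ofReal_mul,
      Real.mul_self_sqrt (Nat.cast_nonneg _), Complex.ofReal_natCast]
  · refine (Real.summable_pow_div_factorial ‖z j * w j‖).congr fun k => ?_
    simp
  · rw [Complex.exp_eq_exp_ℂ]
    exact NormedSpace.expSeries_div_hasSum_exp _

theorem hasSum_of_eq {ι E : Type*} [AddCommMonoid E] [TopologicalSpace E] {f g : ι → E} {a : E}
    (h : HasSum f a) (e : ∀ i, g i = f i) : HasSum g a := (funext e : g = f) ▸ h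

/-! ### Functions that are entire along complex lines -/

/-- Continuous functions on `ℂⁿ` that are entire along every complex line. -/
structure LineEntire {n : ℕ} (h : (Fin n → ℂ) → ℂ) : Prop where
  continuous : Continuous h
  differentiable : ∀ p q : Fin n → ℂ, Differentiable ℂ fun t : ℂ => h (p + t • q)

namespace LineEntire

variable {n : ℕ} {f g : (Fin n → ℂ) → ℂ}

theorem const (c : ℂ) : LineEntire fun _ : Fin n → ℂ => c :=
  ⟨continuous_const, fun _ _ => differentiable_const _⟩

theorem mul (hf : LineEntire f) (hg : LineEntire g) : LineEntire fun z => f z * g z :=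
  ⟨hf.1.mul hg.1, fun p q => (hf.2 p q).mul (hg.2 p q)⟩

theorem add (hf : LineEntire f) (hg : LineEntire g) : LineEntire fun z => f z + g z :=
  ⟨hf.1.add hg.1, fun p q => (hf.2 p q).add (hg.2 p q)⟩

theorem pow (hf : LineEntire f) (k : ℕ) : LineEntire fun z => f z ^ k :=
  ⟨hf.1.pow k, fun p q => (hf.2 p q).pow k⟩

theorem cexp (hf : LineEntire f) : LineEntire fun z => Complex.exp (f z) :=
  ⟨hf.1.cexp, fun p q => (hf.2 p q).cexp⟩

theorem prod {ι : Type*} (s : Finset ι) {F : ι → (Fin n → ℂ) → ℂ} (hF : ∀ i, LineEntire (F i)) :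
    LineEntire fun z => ∏ i ∈ s, F i z := by
  classical
  induction s using Finset.induction_on with
  | empty => simpa using const 1
  | insert i s hi ih => simpa only [Finset.prod_insert hi] using (hF i).mul ih

theorem sum {ι : Type*} (s : Finset ι) {F : ι → (Fin n → ℂ) → ℂ} (hF : ∀ i, LineEntire (F i)) :
    LineEntire fun z => ∑ i ∈ s, F i z := by
  classical
  induction s using Finset.induction_on with
  | empty => simpa using const 0
  | insert i s hi ih => simpa only [Finset.sum_insert hi] using (hF i).add ih

theorem coord (j : Fin n) : LineEntire fun z : Fin n → ℂ => z j := by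
  refine ⟨continuous_apply j, fun p q => ?_⟩
  simp only [Pi.add_apply, Pi.smul_apply, smul_eq_mul]
  fun_prop

theorem linear (a : Fin n → ℂ) : LineEntire fun z : Fin n → ℂ => ∑ j, a j * z j :=
  sum _ fun j => (const (a j)).mul (coord j)

theorem linear' (a : Fin n → ℂ) : LineEntire fun z : Fin n → ℂ => ∑ j, z j * a j :=
  sum _ fun j => (coord j).mul (const (a j))

theorem translate (hf : LineEntire f) (w : Fin n → ℂ) : LineEntire fun z => f (z + w) := by
  refine ⟨hf.1.comp (continuous_id.add continuous_const), fun p q => ?_⟩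
  simpa only [add_right_comm p w] using hf.2 (p + w) q

end LineEntire

theorem lineEntire_monomialFun {n : ℕ} (m : Fin n → ℕ) : LineEntire (monomialFun m) := by
  refine LineEntire.prod _ fun j => ?_
  simp only [div_eq_mul_inv]
  exact ((LineEntire.coord j).pow _).mul (LineEntire.const _)

/-- For ‖t‖ < R the terms are dominated by the monomials at the point with coordinates ‖pⱼ‖ + R‖qⱼ‖,
so the convergence is locally uniform in t. Coefficients in a Banach space cover scalar series as
well as series of kets and of bras. -/
theorem differentiable_tsum_monomialFun {n : ℕ} {E : Type*} [NormedAddCommGroup E]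
    [NormedSpace ℂ E] [CompleteSpace E] (v : (Fin n → ℕ) → E) {C : ℝ} (hv : ∀ m, ‖v m‖ ≤ C)
    (p q : Fin n → ℂ) : Differentiable ℂ fun t : ℂ => ∑' m, monomialFun m (p + t • q) • v m := by
  intro t₀
  set R : ℝ := ‖t₀‖ + 1
  let r : Fin n → ℂ := fun j => ((‖p j‖ + R * ‖q j‖ : ℝ) : ℂ)
  have hR : 0 ≤ R := by positivity
  have hC : 0 ≤ C := (norm_nonneg _).trans (hv 0)
  have hd := Complex.differentiableOn_tsum_of_summable_norm
    (F := fun m (t : ℂ) => monomialFun m (p + t • q) • v m) (U := Metric.ball 0 R)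
    ((summable_norm_monomialFun r).mul_right C) (fun m => ?_) Metric.isOpen_ball
    fun m t ht => ?_
  · exact hd.differentiableAt (Metric.isOpen_ball.mem_nhds (by simp [R]))
  · exact (((lineEntire_monomialFun m).2 p q).smul_const _).differentiableOn
  · rw [norm_smul]
    refine mul_le_mul ?_ (hv m) (norm_nonneg _) (norm_nonneg _)
    rw [norm_monomialFun, norm_monomialFun]
    refine Finset.prod_le_prod (fun _ _ => by positivity) fun j _ => ?_
    gcongr
    simp only [r, Pi.add_apply, Pi.smul_apply, smul_eq_mul, Complex.norm_real]
    rw [Real.norm_of_nonneg (by positivity)]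
    refine (norm_add_le _ _).trans ?_
    rw [norm_mul]
    have : ‖t‖ ≤ R := by simpa using (Metric.mem_ball.1 ht).le
    gcongr

/-! ### Number states and coherent states -/

/-- The number states form a Hilbert basis. -/
def numberBasis (n : ℕ) : HilbertBasis (Fin n → ℕ) ℂ (Fock n) :=
  HilbertBasis.ofRepr (LinearIsometryEquiv.refl ℂ _)

theorem coe_numberBasis {n : ℕ} (m : Fin n → ℕ) : numberBasis n m = numberState m := by
  rw [← HilbertBasis.repr_symm_single]
  simp only [numberBasis, numberState]
  rfl

theorem inner_numberState {n : ℕ} (m : Fin n → ℕ) (v : Fock n) : inner ℂ (numberState m) v = v m := by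
  rw [numberState, lp.inner_single_left]; simp

theorem inner_numberState_right {n : ℕ} (m : Fin n → ℕ) (v : Fock n) :
    inner ℂ v (numberState m) = conj (v m) := by
  rw [← inner_conj_symm, inner_numberState]

theorem norm_numberState {n : ℕ} (m : Fin n → ℕ) : ‖(numberState m : Fock n)‖ = 1 := by
  rw [← coe_numberBasis]; exact (numberBasis n).orthonormal.1 m

theorem hasSum_inner_numberState {n : ℕ} (v w : Fock n) :
    HasSum (fun m => inner ℂ v (numberState m) * inner ℂ (numberState m) w) (inner ℂ v w) := by
  simpa only [coe_numberBasis] using (numberBasis n).hasSum_inner_mul_inner v w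

theorem hasSum_numberState {n : ℕ} (v : Fock n) :
    HasSum (fun m => v m • (numberState m : Fock n)) v := by
  have := (numberBasis n).hasSum_repr v
  simpa only [coe_numberBasis, HilbertBasis.repr_apply_apply, inner_numberState] using this

theorem hasSum_norm_sq {n : ℕ} (v : Fock n) : HasSum (fun m => ‖v m‖ ^ 2) (‖v‖ ^ 2) := by
  have h := hasSum_inner_numberState v v
  rw [inner_self_eq_norm_sq_to_K] at h
  have h2 := Complex.hasSum_re h
  convert h2 using 2 with m
  · rw [inner_numberState, inner_numberState_right, Complex.conj_mul']
    norm_cast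
  · norm_cast

theorem coherentState_apply {n : ℕ} (α : Fin n → ℂ) (m : Fin n → ℕ) :
    coherentState α m = (Real.exp (-absSq α / 2) : ℂ) * monomialFun m α := rfl

theorem inner_coherentState_numberState {n : ℕ} (α : Fin n → ℂ) (m : Fin n → ℕ) :
    inner ℂ (coherentState α) (numberState m) =
      (Real.exp (-absSq α / 2) : ℂ) * monomialFun m (star α) := by
  rw [inner_numberState_right, coherentState_apply, map_mul, Complex.conj_ofReal, monomialFun_star]

/-- The Bargmann function of a vector. -/
def bargmann {n : ℕ} (ψ : Fock n) (z : Fin n → ℂ) : ℂ := ∑' m, monomialFun m z • ψ m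

theorem norm_apply_le {n : ℕ} (ψ : Fock n) (m : Fin n → ℕ) : ‖ψ m‖ ≤ ‖ψ‖ :=
  lp.norm_apply_le_norm (by norm_num) ψ m

theorem hasSum_bargmann {n : ℕ} (ψ : Fock n) (z : Fin n → ℂ) :
    HasSum (fun m => monomialFun m z * ψ m) (bargmann ψ z) := by
  refine Summable.hasSum (Summable.of_norm_bounded
    ((summable_norm_monomialFun z).mul_right ‖ψ‖) fun m => ?_)
  rw [norm_mul]
  gcongr
  exact norm_apply_le ψ m

theorem inner_coherentState {n : ℕ} (α : Fin n → ℂ) (ψ : Fock n) :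
    inner ℂ (coherentState α) ψ = (Real.exp (-absSq α / 2) : ℂ) * bargmann ψ (star α) := by
  refine (hasSum_inner_numberState (coherentState α) ψ).unique ?_
  refine hasSum_of_eq
    ((hasSum_bargmann ψ (star α)).mul_left (Real.exp (-absSq α / 2) : ℂ)) fun m => ?_
  rw [inner_coherentState_numberState, inner_numberState, mul_assoc]

theorem bargmann_coherentState {n : ℕ} (α z : Fin n → ℂ) :
    bargmann (coherentState α) z = (Real.exp (-absSq α / 2) : ℂ) * Complex.exp (∑ j, z j * α j) := by
  refine (hasSum_bargmann _ z).unique ?_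
  refine hasSum_of_eq
    ((hasSum_monomialFun_mul z α).mul_left (Real.exp (-absSq α / 2) : ℂ)) fun m => ?_
  rw [coherentState_apply]; ring

theorem inner_coherentState_coherentState {n : ℕ} (α β : Fin n → ℂ) :
    inner ℂ (coherentState α) (coherentState β) = Complex.exp
      (-(absSq α : ℂ) / 2 - (absSq β : ℂ) / 2 + ∑ j, conj (α j) * β j) := by
  rw [inner_coherentState, bargmann_coherentState, Complex.exp_add, sub_eq_add_neg,
    Complex.exp_add]
  push_cast
  rw [mul_assoc, neg_div, neg_div]
  rfl

theorem sum_conj_mul_self {n : ℕ} (α : Fin n → ℂ) : ∑ j, conj (α j) * α j = (absSq α : ℂ) := by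
  simp [absSq, Complex.conj_mul']

theorem sum_mul_conj_self {n : ℕ} (α : Fin n → ℂ) : ∑ j, α j * conj (α j) = (absSq α : ℂ) := by
  simp [absSq, Complex.mul_conj']

theorem norm_coherentState {n : ℕ} (α : Fin n → ℂ) : ‖coherentState α‖ = 1 := by
  have h : ‖coherentState α‖ ^ 2 = 1 := by
    have h := inner_coherentState_coherentState α α
    rw [sum_conj_mul_self, inner_self_eq_norm_sq_to_K,
      show (-(absSq α : ℂ) / 2 - (absSq α : ℂ) / 2 + absSq α) = 0 by ring, Complex.exp_zero] at h
    exact Complex.ofReal_injective (by push_cast; exact h)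
  nlinarith [norm_nonneg (coherentState α)]

theorem continuous_absSq {n : ℕ} : Continuous (absSq : (Fin n → ℂ) → ℝ) := by
  unfold absSq; fun_prop

/-- The identity ‖|α⟩ - |β⟩‖² = 2 - 2 Re⟨α|β⟩ reduces norm continuity to continuity of the explicit
overlap. -/
theorem continuous_coherentState {n : ℕ} :
    Continuous (coherentState : (Fin n → ℂ) → Fock n) := by
  refine continuous_iff_continuousAt.2 fun β => ?_
  rw [ContinuousAt, tendsto_iff_norm_sub_tendsto_zero]
  have hsq : Tendsto (fun α => ‖coherentState α - coherentState β‖ ^ 2) (𝓝 β) (𝓝 0) := by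
    have e : (fun α => ‖coherentState α - coherentState β‖ ^ 2) = fun α => 2 - 2 * (Complex.exp
      (-(absSq α : ℂ) / 2 - (absSq β : ℂ) / 2 + ∑ j, conj (α j) * β j)).re := by
      funext α
      rw [@norm_sub_sq ℂ, norm_coherentState, norm_coherentState,
        inner_coherentState_coherentState]
      simp only [RCLike.re_eq_complex_re]
      ring
    rw [e]
    have hc : Continuous fun α => 2 - 2 * (Complex.exp
      (-(absSq α : ℂ) / 2 - (absSq β : ℂ) / 2 + ∑ j, conj (α j) * β j)).re := by
      have := @continuous_absSq n
      fun_prop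
    have := hc.tendsto β
    rw [sum_conj_mul_self, show (-(absSq β : ℂ) / 2 - (absSq β : ℂ) / 2 + absSq β) = 0 by ring] at this
    simpa using this
  have := hsq.sqrt
  simpa [Real.sqrt_sq] using this

theorem lineEntire_bargmann {n : ℕ} (ψ : Fock n) : LineEntire (bargmann ψ) := by
  refine ⟨?_, fun p q => differentiable_tsum_monomialFun _ (norm_apply_le ψ) p q⟩
  have h : bargmann ψ = fun z => (Real.exp (absSq (star z) / 2) : ℂ) *
      inner ℂ (coherentState (star z)) ψ := by
    funext z
    rw [inner_coherentState, star_star, ← mul_assoc, ← Complex.ofReal_mul, ← Real.exp_add]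
    simp [neg_div]
  rw [h]
  have h1 := @continuous_absSq n
  have h2 := @continuous_coherentState n
  fun_prop

end

/-! ### Integration against the Gaussian weight -/

section

/-! ### Gaussian integrals over phase space -/

theorem integral_norm_pow_mul_exp (k : ℕ) :
    ∫ z : ℂ, ‖z‖ ^ k * Real.exp (-‖z‖ ^ 2) = Real.pi * Real.Gamma ((k + 2) / 2) := by
  have h := Complex.integral_rpow_mul_exp_neg_rpow (p := 2) (q := k) (by norm_num)
    (by have : (0 : ℝ) ≤ k := Nat.cast_nonneg k
        linarith)
  simp only [Real.rpow_natCast, Real.rpow_ofNat] at h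
  rw [h]; ring

/-- A function that is not integrable has integral 0 by convention, but the formula for the integral
gives a positive value. -/
theorem integrable_norm_pow_mul_exp (k : ℕ) :
    Integrable fun z : ℂ => ‖z‖ ^ k * Real.exp (-‖z‖ ^ 2) := by
  by_contra hc
  have h := integral_norm_pow_mul_exp k
  rw [integral_undef hc] at h
  have : 0 < Real.Gamma ((k + 2) / 2 : ℝ) := Real.Gamma_pos_of_pos (by positivity)
  have := mul_pos Real.pi_pos this
  linarith

theorem integrable_pow_mul_conj_pow (k m : ℕ) :
    Integrable fun z : ℂ => z ^ k * conj z ^ m * (Real.exp (-‖z‖ ^ 2) : ℂ) := by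
  refine (integrable_norm_pow_mul_exp (k + m)).mono' (by fun_prop) (ae_of_all _ fun z => ?_)
  rw [norm_mul, norm_mul, norm_pow, norm_pow, Complex.norm_conj, Complex.norm_real, pow_add,
    Real.norm_of_nonneg (Real.exp_pos _).le]

theorem integral_pow_mul_conj_pow (k m : ℕ) :
    ∫ z : ℂ, z ^ k * conj z ^ m * (Real.exp (-‖z‖ ^ 2) : ℂ) =
      if k = m then (Real.pi : ℂ) * Nat.factorial k else 0 := by
  split_ifs with h
  · subst h
    have e : ∀ z : ℂ, z ^ k * conj z ^ k * (Real.exp (-‖z‖ ^ 2) : ℂ) =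
        ((‖z‖ ^ (2 * k) * Real.exp (-‖z‖ ^ 2) : ℝ) : ℂ) := fun z => by
      rw [← mul_pow, Complex.mul_conj']; push_cast; rw [pow_mul]
    simp_rw [e]
    rw [integral_complex_ofReal, integral_norm_pow_mul_exp]
    have : ((2 * k : ℕ) + 2 : ℝ) / 2 = (k : ℝ) + 1 := by push_cast; ring
    rw [this, Real.Gamma_nat_eq_factorial]
    push_cast; rfl
  · have hd : ((k : ℂ) - m) ≠ 0 := sub_ne_zero.2 (by exact_mod_cast h)
    -- This rotation satisfies ω^(k-m) = e^{iπ} = -1, so rotation invariance shows that the integral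
    -- equals its own negative.
    let ω : Circle := Circle.exp (Real.pi / ((k : ℝ) - m))
    have hω : (ω : ℂ) ^ k * conj (ω : ℂ) ^ m = -1 := by
      simp only [ω, Circle.coe_exp, ← Complex.exp_conj, ← Complex.exp_nat_mul, ← Complex.exp_add]
      rw [← Complex.exp_pi_mul_I]
      congr 1
      simp only [map_mul, Complex.conj_ofReal, Complex.conj_I]
      push_cast
      field_simp
      ring
    have hrot := (rotation ω).measurePreserving.integral_comp'
      (f := (rotation ω).toHomeomorph.toMeasurableEquiv)
      (fun z : ℂ => z ^ k * conj z ^ m * (Real.exp (-‖z‖ ^ 2) : ℂ))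
    have e : ∀ z : ℂ, (rotation ω z) ^ k * conj (rotation ω z) ^ m *
        (Real.exp (-‖rotation ω z‖ ^ 2) : ℂ) =
        (-1) * (z ^ k * conj z ^ m * (Real.exp (-‖z‖ ^ 2) : ℂ)) := fun z => by
      rw [LinearIsometryEquiv.norm_map, ← hω, rotation_apply, map_mul, mul_pow, mul_pow]; ring
    change ∫ z : ℂ, (rotation ω z) ^ k * conj (rotation ω z) ^ m *
        (Real.exp (-‖rotation ω z‖ ^ 2) : ℂ) = _ at hrot
    simp_rw [e] at hrot
    rw [integral_const_mul] at hrot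
    linear_combination (-1 / 2 : ℂ) * hrot

theorem exp_neg_absSq {n : ℕ} (α : Fin n → ℂ) :
    Real.exp (-absSq α) = ∏ j, Real.exp (-‖α j‖ ^ 2) := by
  rw [← Real.exp_sum, absSq, Finset.sum_neg_distrib]

theorem exp_half_mul_exp_half {n : ℕ} (α : Fin n → ℂ) :
    Real.exp (-absSq α / 2) * Real.exp (-absSq α / 2) = Real.exp (-absSq α) := by
  rw [← Real.exp_add]; ring_nf

theorem coherentCoeff_mul_conj {n : ℕ} (k m : Fin n → ℕ) (α : Fin n → ℂ) :
    coherentCoeff α k * conj (coherentCoeff α m) =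
      ∏ j, ((α j ^ k j * conj (α j) ^ m j * (Real.exp (-‖α j‖ ^ 2) : ℂ)) *
        ((Real.sqrt (Nat.factorial (k j)) : ℂ)⁻¹ * (Real.sqrt (Nat.factorial (m j)) : ℂ)⁻¹)) := by
  rw [coherentCoeff_eq, coherentCoeff_eq, map_mul, Complex.conj_ofReal, mul_mul_mul_comm,
    ← Complex.ofReal_mul, exp_half_mul_exp_half, exp_neg_absSq, ← monomialFun_star, monomialFun,
    monomialFun, Complex.ofReal_prod, ← Finset.prod_mul_distrib, ← Finset.prod_mul_distrib]
  refine Finset.prod_congr rfl fun j _ => ?_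
  simp only [Pi.star_apply, RCLike.star_def]
  ring

theorem integrable_coherentCoeff_mul_conj {n : ℕ} (k m : Fin n → ℕ) :
    Integrable fun α : Fin n → ℂ => coherentCoeff α k * conj (coherentCoeff α m) := by
  simp only [coherentCoeff_mul_conj]
  exact Integrable.fintype_prod (f := fun j (z : ℂ) =>
    (z ^ k j * conj z ^ m j * (Real.exp (-‖z‖ ^ 2) : ℂ)) *
      ((Real.sqrt (Nat.factorial (k j)) : ℂ)⁻¹ * (Real.sqrt (Nat.factorial (m j)) : ℂ)⁻¹))
    fun j => (integrable_pow_mul_conj_pow _ _).mul_const _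

theorem integral_coherentCoeff_mul_conj {n : ℕ} (k m : Fin n → ℕ) :
    ∫ α : Fin n → ℂ, coherentCoeff α k * conj (coherentCoeff α m) =
      if k = m then (Real.pi : ℂ) ^ n else 0 := by
  simp only [coherentCoeff_mul_conj]
  rw [volume_pi, integral_fintype_prod_eq_prod (f := fun j (z : ℂ) =>
    (z ^ k j * conj z ^ m j * (Real.exp (-‖z‖ ^ 2) : ℂ)) *
      ((Real.sqrt (Nat.factorial (k j)) : ℂ)⁻¹ * (Real.sqrt (Nat.factorial (m j)) : ℂ)⁻¹))]
  simp_rw [integral_mul_const, integral_pow_mul_conj_pow]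
  split_ifs with h
  · subst h
    have hn : (Real.pi : ℂ) ^ n = ∏ _j : Fin n, (Real.pi : ℂ) := by simp
    rw [hn]
    refine Finset.prod_congr rfl fun j _ => ?_
    rw [if_pos rfl, ← mul_inv, ← Complex.ofReal_mul, Real.mul_self_sqrt (Nat.cast_nonneg _)]
    have : ((Nat.factorial (k j) : ℕ) : ℂ) ≠ 0 := by exact_mod_cast (k j).factorial_ne_zero
    push_cast
    field_simp
  · obtain ⟨j, hj⟩ := Function.ne_iff.1 h
    exact Finset.prod_eq_zero (Finset.mem_univ j) (by rw [if_neg hj, zero_mul])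

/-! ### The mean value property -/

/-- The Gaussian weight `e^{-|α|²}`. -/
def gaussWeight {n : ℕ} (α : Fin n → ℂ) : ℂ := (Real.exp (-absSq α) : ℂ)

theorem integral_gaussWeight (n : ℕ) :
    ∫ α : Fin n → ℂ, gaussWeight α = (Real.pi : ℂ) ^ n := by
  have h := integral_coherentCoeff_mul_conj (0 : Fin n → ℕ) 0
  rw [if_pos rfl] at h
  rw [← h]
  refine integral_congr_ae (ae_of_all _ fun α => ?_)
  change gaussWeight α = coherentCoeff α 0 * conj (coherentCoeff α 0)
  rw [coherentCoeff_eq, map_mul, Complex.conj_ofReal]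
  simp only [monomialFun, Pi.zero_apply, pow_zero, Nat.factorial_zero, Nat.cast_one,
    Real.sqrt_one, Complex.ofReal_one, div_one, Finset.prod_const_one, mul_one, map_one]
  rw [← Complex.ofReal_mul, exp_half_mul_exp_half, gaussWeight]

theorem continuous_gaussWeight {n : ℕ} : Continuous (gaussWeight : (Fin n → ℂ) → ℂ) := by
  have := @continuous_absSq n
  unfold gaussWeight; fun_prop

theorem measurePreserving_circle_smul {n : ℕ} (ω : Circle) :
    MeasurePreserving fun α : Fin n → ℂ => (ω : ℂ) • α := by
  have h := volume_preserving_pi (f := fun _ : Fin n => fun z : ℂ => rotation ω z)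
    fun _ => (rotation ω).measurePreserving
  convert h using 1
  funext α j
  simp [rotation_apply]

theorem absSq_circle_smul {n : ℕ} (ω : Circle) (α : Fin n → ℂ) :
    absSq ((ω : ℂ) • α) = absSq α := by
  simp only [absSq, Pi.smul_apply, smul_eq_mul, norm_mul, Circle.norm_coe, one_mul]

theorem measurableEmbedding_circle_smul {n : ℕ} (ω : Circle) :
    MeasurableEmbedding fun α : Fin n → ℂ => (ω : ℂ) • α :=
  (Homeomorph.smulOfNeZero (ω : ℂ) (by simp)).measurableEmbedding

/-- The weight and the measure are invariant under α ↦ e^{-iθ}α, so the integrand may be averaged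
over θ. At fixed α this is the average of `h` over a circle in the complex line through 0 and α*,
which equals h(0) by the mean value property in one variable. -/
theorem LineEntire.integral_mul_gaussWeight {n : ℕ} {h : (Fin n → ℂ) → ℂ} (hh : LineEntire h)
    (hi : Integrable fun α => h (star α) * gaussWeight α) :
    ∫ α, h (star α) * gaussWeight α = (Real.pi : ℂ) ^ n * h 0 := by
  set G : (Fin n → ℂ) → ℂ := fun α => h (star α) * gaussWeight α with hG
  have hGc : Continuous G := (hh.1.comp continuous_star).mul continuous_gaussWeight
  -- The minus sign makes α* rotate by +θ, as in `circleMap`.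
  let c : ℝ → Circle := fun θ => Circle.exp (-θ)
  have hc : Continuous fun θ => ((c θ : Circle) : ℂ) := by
    simp only [c, Circle.coe_exp]; fun_prop
  have hrot : ∀ θ, ∫ α, G ((c θ : ℂ) • α) = ∫ α, G α := fun θ =>
    (measurePreserving_circle_smul (c θ)).integral_comp (measurableEmbedding_circle_smul _) G
  have hroti : ∀ θ, Integrable fun α => G ((c θ : ℂ) • α) := fun θ =>
    ((measurePreserving_circle_smul (c θ)).integrable_comp_emb
      (measurableEmbedding_circle_smul _)).2 hi
  have hrotn : ∀ θ, ∫ α, ‖G ((c θ : ℂ) • α)‖ = ∫ α, ‖G α‖ := fun θ =>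
    (measurePreserving_circle_smul (c θ)).integral_comp (measurableEmbedding_circle_smul _)
      fun α => ‖G α‖
  have hprod : Integrable (fun x : ℝ × (Fin n → ℂ) => G ((c x.1 : ℂ) • x.2))
      ((volume.restrict (Set.uIoc 0 (2 * Real.pi))).prod volume) := by
    rw [integrable_prod_iff]
    · refine ⟨ae_of_all _ fun θ => hroti θ, ?_⟩
      simp only [hrotn]
      rw [Set.uIoc_of_le (by positivity)]
      exact integrable_const _
    · refine Continuous.aestronglyMeasurable (hGc.comp ?_)
      exact (hc.comp continuous_fst).smul continuous_snd
  have hswap := intervalIntegral_integral_swap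
    (f := fun θ α => G ((c θ : ℂ) • α)) (a := 0) (b := 2 * Real.pi) (μ := volume) hprod
  simp only [hrot] at hswap
  have hmean : ∀ α : Fin n → ℂ, ∫ θ in (0 : ℝ)..(2 * Real.pi), G ((c θ : ℂ) • α) =
      2 * Real.pi * h 0 * gaussWeight α := fun α => by
    have h1 : ∀ θ : ℝ, G ((c θ : ℂ) • α) =
        h (0 + circleMap 0 1 θ • star α) * gaussWeight α := fun θ => by
      simp only [hG, gaussWeight, absSq_circle_smul]
      congr 2
      funext j
      simp [circleMap, c, ← Complex.exp_conj, Complex.exp_neg]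
    simp_rw [h1]
    rw [intervalIntegral.integral_mul_const]
    have h2 := (((hh.2 0 (star α)).diffContOnCl (s := Metric.ball 0 |1|))).circleAverage
    rw [Real.circleAverage] at h2
    simp only [zero_smul, add_zero] at h2
    have hpi : (2 * Real.pi : ℝ) ≠ 0 := by positivity
    rw [inv_smul_eq_iff₀ hpi] at h2
    rw [h2, Complex.real_smul]
    push_cast; ring
  simp only [hmean] at hswap
  rw [integral_const_mul, integral_gaussWeight, intervalIntegral.integral_const] at hswap
  rw [sub_zero, Complex.real_smul] at hswap
  have hpi : (2 * Real.pi : ℂ) ≠ 0 := by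
    exact_mod_cast (by positivity : (2 * Real.pi : ℝ) ≠ 0)
  refine mul_left_cancel₀ hpi ?_
  push_cast at hswap
  rw [hswap]; ring

end

/-! ### The subspace of coherent-state transforms in L² -/

section

/-! ### The coherent-state transform is an isometry -/

theorem integral_conj_numberState_mul {n : ℕ} (k m : Fin n → ℕ) :
    ∫ α : Fin n → ℂ, conj (inner ℂ (coherentState α) (numberState k)) *
      inner ℂ (coherentState α) (numberState m) = if k = m then (Real.pi : ℂ) ^ n else 0 := by
  rw [← integral_coherentCoeff_mul_conj]
  refine integral_congr_ae (ae_of_all _ fun α => ?_)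
  simp only [inner_numberState_right, Complex.conj_conj]
  rfl

theorem continuous_inner_coherentState {n : ℕ} (ψ : Fock n) :
    Continuous fun α : Fin n → ℂ => inner ℂ (coherentState α) ψ :=
  continuous_coherentState.inner continuous_const

theorem memLp_inner_numberState {n : ℕ} (m : Fin n → ℕ) :
    MemLp (fun α : Fin n → ℂ => inner ℂ (coherentState α) (numberState m)) 2 := by
  rw [memLp_two_iff_integrable_sq_norm (continuous_inner_coherentState _).aestronglyMeasurable]
  refine (integrable_coherentCoeff_mul_conj m m).norm.congr (ae_of_all _ fun α => ?_)
  simp only [inner_numberState_right, norm_mul, Complex.norm_conj, sq]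
  rfl

/-- The normalisation constant `π^{-n/2}` of the coherent-state transform. -/
def transformConst (n : ℕ) : ℝ := (Real.sqrt (Real.pi ^ n))⁻¹

theorem transformConst_sq (n : ℕ) : transformConst n * transformConst n = (Real.pi ^ n)⁻¹ := by
  rw [transformConst, ← mul_inv, Real.mul_self_sqrt (by positivity)]

theorem transformConst_pos (n : ℕ) : 0 < transformConst n := by
  have := Real.pi_pos
  unfold transformConst; positivity

/-- The number states as an orthonormal family of functions on phase space. -/
def numberFun {n : ℕ} (m : Fin n → ℕ) : Lp ℂ 2 (volume : Measure (Fin n → ℂ)) :=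
  (transformConst n : ℂ) • (memLp_inner_numberState m).toLp

theorem orthonormal_numberFun (n : ℕ) : Orthonormal ℂ (numberFun (n := n)) := by
  classical
  rw [orthonormal_iff_ite]
  intro k m
  have h : inner ℂ (memLp_inner_numberState k).toLp (memLp_inner_numberState m).toLp =
      if k = m then (Real.pi : ℂ) ^ n else 0 := by
    rw [L2.inner_def, ← integral_conj_numberState_mul]
    refine integral_congr_ae ?_
    filter_upwards [(memLp_inner_numberState k).coeFn_toLp,
      (memLp_inner_numberState m).coeFn_toLp] with α h1 h2
    rw [h1, h2, RCLike.inner_apply, mul_comm]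
  rw [numberFun, numberFun, inner_smul_left, inner_smul_right, h, Complex.conj_ofReal,
    ← mul_assoc, ← Complex.ofReal_mul, transformConst_sq]
  have hpi : (Real.pi : ℂ) ≠ 0 := by exact_mod_cast Real.pi_ne_zero
  split_ifs
  · push_cast
    exact inv_mul_cancel₀ (pow_ne_zero _ hpi)
  · simp

/-- The coherent-state transform `ψ ↦ π^{-n/2} ⟨α|ψ⟩`. -/
def transform (n : ℕ) : Fock n →ₗᵢ[ℂ] Lp ℂ 2 (volume : Measure (Fin n → ℂ)) :=
  (orthonormal_numberFun n).orthogonalFamily.linearIsometry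

theorem hasSum_transform {n : ℕ} (ψ : Fock n) :
    HasSum (fun m => ψ m • numberFun m) (transform n ψ) :=
  (orthonormal_numberFun n).orthogonalFamily.hasSum_linearIsometry ψ

theorem coeFn_sum_numberFun {n : ℕ} (ψ : Fock n) (s : Finset (Fin n → ℕ)) :
    (∑ m ∈ s, ψ m • numberFun m : Lp ℂ 2 (volume : Measure (Fin n → ℂ))) =ᵐ[volume] fun α =>
      ∑ m ∈ s, (transformConst n : ℂ) *
        (inner ℂ (coherentState α) (numberState m) * inner ℂ (numberState m) ψ) := by
  classical
  induction s using Finset.induction_on with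
  | empty =>
    simp only [Finset.sum_empty]
    exact Lp.coeFn_zero ℂ 2 (volume : Measure (Fin n → ℂ))
  | insert m s hm ih =>
    rw [Finset.sum_insert hm]
    filter_upwards [Lp.coeFn_add (ψ m • numberFun m) (∑ m ∈ s, ψ m • numberFun m), ih,
      Lp.coeFn_smul (ψ m) (numberFun m),
      Lp.coeFn_smul (transformConst n : ℂ) (memLp_inner_numberState m).toLp,
      (memLp_inner_numberState m).coeFn_toLp] with α h1 h2 h3 h4 h5
    rw [h1, Pi.add_apply, h2, h3, Pi.smul_apply, numberFun, h4, Pi.smul_apply, h5,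
      Finset.sum_insert hm, inner_numberState]
    simp only [smul_eq_mul]
    ring

/-- The number-state expansion converges in L² to the transform and pointwise to a multiple of
⟨α|ψ⟩. A subsequence of the sums over cubes that converges almost everywhere identifies the two
limits. -/
theorem coeFn_transform {n : ℕ} (ψ : Fock n) :
    transform n ψ =ᵐ[volume] fun α => (transformConst n : ℂ) * inner ℂ (coherentState α) ψ := by
  have h1 := (hasSum_transform ψ).comp (tendsto_cubes n)
  obtain ⟨ns, hns, hae⟩ := (tendstoInMeasure_of_tendsto_Lp h1).exists_seq_tendsto_ae
  have h2 : ∀ᵐ α, ∀ N, (∑ m ∈ Fintype.piFinset fun _ : Fin n => Finset.range N,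
      ψ m • numberFun m : Lp ℂ 2 (volume : Measure (Fin n → ℂ))) α = _ :=
    ae_all_iff.2 fun N => coeFn_sum_numberFun ψ _
  filter_upwards [hae, h2] with α h3 h4
  refine tendsto_nhds_unique h3 ?_
  have h5 := (((hasSum_inner_numberState (coherentState α) ψ).mul_left
    (transformConst n : ℂ)).comp (tendsto_cubes n)).comp hns.tendsto_atTop
  refine h5.congr fun N => ?_
  simp only [Function.comp]
  exact (h4 (ns N)).symm

theorem memLp_inner_coherentState {n : ℕ} (ψ : Fock n) :
    MemLp (fun α : Fin n → ℂ => inner ℂ (coherentState α) ψ) 2 := by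
  have h := ((memLp_congr_ae (coeFn_transform ψ)).1 (Lp.memLp (transform n ψ))).const_mul
    ((transformConst n : ℂ)⁻¹)
  have h0 : (transformConst n : ℂ) ≠ 0 := by exact_mod_cast (transformConst_pos n).ne'
  simpa [inv_mul_cancel_left₀ h0] using h

/-- The adjoint of the coherent-state transform. -/
theorem exists_inner_eq_integral {n : ℕ} {g : (Fin n → ℂ) → ℂ} (hg : MemLp g 2) :
    ∃ χ : Fock n, ∀ ψ : Fock n, inner ℂ ψ χ =
      (1 / Real.pi ^ n : ℂ) * ∫ α, conj (inner ℂ (coherentState α) ψ) * g α := by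
  refine ⟨(transformConst n : ℂ) • ContinuousLinearMap.adjoint
    (transform n).toContinuousLinearMap (hg.toLp g), fun ψ => ?_⟩
  rw [inner_smul_right, ContinuousLinearMap.adjoint_inner_right, L2.inner_def]
  have : ∫ α, inner ℂ ((transform n).toContinuousLinearMap ψ α) (hg.toLp g α) =
      ∫ α, (transformConst n : ℂ) * (conj (inner ℂ (coherentState α) ψ) * g α) := by
    refine integral_congr_ae ?_
    filter_upwards [coeFn_transform ψ, hg.coeFn_toLp] with α h1 h2
    rw [h2, LinearIsometry.coe_toContinuousLinearMap, h1, RCLike.inner_apply, map_mul,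
      Complex.conj_ofReal]
    ring
  rw [this, integral_const_mul, ← mul_assoc, ← Complex.ofReal_mul, transformConst_sq]
  push_cast
  rw [one_div]

theorem integral_conj_inner_mul_inner {n : ℕ} (ψ χ : Fock n) :
    ∫ α : Fin n → ℂ, conj (inner ℂ (coherentState α) ψ) * inner ℂ (coherentState α) χ =
      (Real.pi : ℂ) ^ n * inner ℂ ψ χ := by
  have h := (transform n).inner_map_map ψ χ
  rw [L2.inner_def] at h
  have : ∫ α, inner ℂ (transform n ψ α) (transform n χ α) = ∫ α, (((Real.pi ^ n)⁻¹ : ℝ) : ℂ) *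
      (conj (inner ℂ (coherentState α) ψ) * inner ℂ (coherentState α) χ) := by
    refine integral_congr_ae ?_
    filter_upwards [coeFn_transform ψ, coeFn_transform χ] with α h1 h2
    rw [h1, h2, RCLike.inner_apply, map_mul, Complex.conj_ofReal, ← transformConst_sq]
    push_cast
    ring
  rw [this, integral_const_mul] at h
  have hpi : (Real.pi : ℂ) ^ n ≠ 0 := pow_ne_zero _ (by exact_mod_cast Real.pi_ne_zero)
  rw [← h]
  push_cast
  rw [mul_inv_cancel_left₀ hpi]

theorem integrable_norm_sq_inner {n : ℕ} (ψ : Fock n) :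
    Integrable fun α : Fin n → ℂ => ‖inner ℂ (coherentState α) ψ‖ ^ 2 :=
  (memLp_two_iff_integrable_sq_norm (continuous_inner_coherentState _).aestronglyMeasurable).1
    (memLp_inner_coherentState ψ)

theorem integral_norm_sq_inner {n : ℕ} (ψ : Fock n) :
    ∫ α : Fin n → ℂ, ‖inner ℂ (coherentState α) ψ‖ ^ 2 = Real.pi ^ n * ‖ψ‖ ^ 2 := by
  have h := integral_conj_inner_mul_inner ψ ψ
  rw [inner_self_eq_norm_sq_to_K] at h
  simp_rw [Complex.conj_mul'] at h
  have h2 : ((∫ α : Fin n → ℂ, ‖inner ℂ (coherentState α) ψ‖ ^ 2 : ℝ) : ℂ) =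
      ((Real.pi ^ n * ‖ψ‖ ^ 2 : ℝ) : ℂ) := by
    rw [← integral_complex_ofReal]
    push_cast
    exact h
  exact_mod_cast h2

theorem eq_zero_of_inner_coherentState {n : ℕ} {ψ : Fock n}
    (h : ∀ α, inner ℂ (coherentState α) ψ = 0) : ψ = 0 := by
  have h1 := integral_norm_sq_inner ψ
  simp only [h, norm_zero] at h1
  have hpi : (0 : ℝ) < Real.pi ^ n := pow_pos Real.pi_pos n
  simp only [ne_eq, OfNat.ofNat_ne_zero, not_false_eq_true, zero_pow, integral_zero,
    zero_eq_mul, hpi.ne', false_or] at h1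
  simpa using h1

theorem eq_of_inner_coherentState {n : ℕ} {ψ χ : Fock n}
    (h : ∀ α, inner ℂ (coherentState α) ψ = inner ℂ (coherentState α) χ) : ψ = χ :=
  sub_eq_zero.1 (eq_zero_of_inner_coherentState fun α => by rw [inner_sub_right, h, sub_self])

/-- Coherent states are total, so a vector representing `g` through the adjoint vanishes as soon as
it is orthogonal to all of them. Thus orthogonality to the range of the transform need only be
tested on coherent states, where the integrals are explicit. -/
theorem integral_conj_inner_mul_eq_zero {n : ℕ} {g : (Fin n → ℂ) → ℂ} (hg : MemLp g 2)
    (h : ∀ β, ∫ α, conj (inner ℂ (coherentState α) (coherentState β)) * g α = 0) (ψ : Fock n) :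
    ∫ α, conj (inner ℂ (coherentState α) ψ) * g α = 0 := by
  obtain ⟨χ, hχ⟩ := exists_inner_eq_integral hg
  have h0 : χ = 0 := eq_zero_of_inner_coherentState fun β => by rw [hχ, h, mul_zero]
  have h1 := hχ ψ
  rw [h0, inner_zero_right] at h1
  have hpi : (1 / Real.pi ^ n : ℂ) ≠ 0 :=
    one_div_ne_zero (pow_ne_zero _ (by exact_mod_cast Real.pi_ne_zero))
  exact (mul_eq_zero.1 h1.symm).resolve_left hpi

/-! ### The reproducing property -/

theorem absSq_add {n : ℕ} (α β : Fin n → ℂ) : (absSq (α + β) : ℂ) =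
    absSq α + absSq β + ∑ j, conj (α j) * β j + ∑ j, α j * conj (β j) := by
  rw [← sum_conj_mul_self, ← sum_conj_mul_self, ← sum_conj_mul_self, ← Finset.sum_add_distrib,
    ← Finset.sum_add_distrib, ← Finset.sum_add_distrib]
  refine Finset.sum_congr rfl fun j _ => ?_
  rw [Pi.add_apply, map_add]; ring

theorem absSq_star {n : ℕ} (α : Fin n → ℂ) : absSq (star α) = absSq α := by simp [absSq]

/-- The shift α ↦ α + w* completes the square: the factor e^{α·w} cancels against the weight and
leaves e^{-w*·α*}, which is entire in α*. The mean value property at 0 then returns h(w). -/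
theorem LineEntire.reproducing {n : ℕ} {h : (Fin n → ℂ) → ℂ} (hh : LineEntire h)
    (w : Fin n → ℂ)
    (hi : Integrable fun α => h (star α) * Complex.exp (∑ j, α j * w j) * gaussWeight α) :
    ∫ α, h (star α) * Complex.exp (∑ j, α j * w j) * gaussWeight α = (Real.pi : ℂ) ^ n * h w := by
  let g : (Fin n → ℂ) → ℂ := fun z => h (z + w) * Complex.exp (∑ j, (-conj (w j)) * z j)
  have hg : LineEntire g := (hh.translate w).mul (LineEntire.linear fun j => -conj (w j)).cexp
  have e : ∀ α, h (star (α + star w)) * Complex.exp (∑ j, (α + star w) j * w j) *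
      gaussWeight (α + star w) = g (star α) * gaussWeight α := fun α => by
    simp only [g, gaussWeight]
    rw [star_add, star_star]
    push_cast
    rw [absSq_add, absSq_star, mul_assoc, mul_assoc, ← Complex.exp_add, ← Complex.exp_add]
    congr 2
    simp only [Pi.add_apply, Pi.star_apply, RCLike.star_def, Complex.conj_conj, add_mul,
      Finset.sum_add_distrib, sum_conj_mul_self, neg_mul, Finset.sum_neg_distrib]
    simp only [mul_comm]
    ring
  have h1 := integral_add_right_eq_self (μ := (volume : Measure (Fin n → ℂ)))
    (fun α => h (star α) * Complex.exp (∑ j, α j * w j) * gaussWeight α) (star w)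
  simp only [e] at h1
  have h2 : Integrable fun α => g (star α) * gaussWeight α :=
    (hi.comp_add_right (star w)).congr (ae_of_all _ fun α => e α)
  rw [← h1, hg.integral_mul_gaussWeight h2]
  simp [g]

theorem conj_inner_coherentState_mul {n : ℕ} (α β : Fin n → ℂ) (x : ℂ) :
    conj (inner ℂ (coherentState α) (coherentState β)) * ((Real.exp (-absSq α / 2) : ℂ) * x) =
      (Real.exp (-absSq β / 2) : ℂ) *
        (x * Complex.exp (∑ j, α j * star β j) * gaussWeight α) := by
  rw [inner_coherentState_coherentState, ← Complex.exp_conj, gaussWeight]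
  push_cast
  rw [show ∀ a b c d : ℂ, a * (b * c * d) = c * d * a * b by intros; ring, ← mul_assoc,
    ← Complex.exp_add, ← Complex.exp_add, ← Complex.exp_add]
  congr 2
  simp only [map_add, map_sub, map_div₀, map_neg, Complex.conj_ofReal, map_sum, map_mul,
    Complex.conj_conj, Pi.star_apply, RCLike.star_def, Complex.conj_ofNat]
  ring

theorem LineEntire.integral_conj_coherentState_mul {n : ℕ} {h : (Fin n → ℂ) → ℂ}
    (hh : LineEntire h)
    (β : Fin n → ℂ) (hi : Integrable fun α => conj (inner ℂ (coherentState α) (coherentState β)) *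
      ((Real.exp (-absSq α / 2) : ℂ) * h (star α))) :
    ∫ α, conj (inner ℂ (coherentState α) (coherentState β)) *
      ((Real.exp (-absSq α / 2) : ℂ) * h (star α)) =
      (Real.pi : ℂ) ^ n * ((Real.exp (-absSq β / 2) : ℂ) * h (star β)) := by
  simp only [conj_inner_coherentState_mul] at hi ⊢
  have h0 : (Real.exp (-absSq β / 2) : ℂ) ≠ 0 := by exact_mod_cast (Real.exp_pos _).ne'
  rw [integral_const_mul, hh.reproducing _ ?_]
  · ring
  · have := hi.const_mul (Real.exp (-absSq β / 2) : ℂ)⁻¹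
    simpa [inv_mul_cancel_left₀ h0] using this

/-- By the reproducing property, the vector that the adjoint of the transform assigns to such a
function has this very function as its transform. This identifies the range of the transform, and it
produces vectors from formulas: polynomials in α* times ⟨α|ψ⟩, and the components of Gaussian
states. -/
theorem LineEntire.exists_inner_coherentState {n : ℕ} {h : (Fin n → ℂ) → ℂ} (hh : LineEntire h)
    (hi : MemLp (fun α => (Real.exp (-absSq α / 2) : ℂ) * h (star α)) 2) :
    ∃ ψ : Fock n, ∀ α, inner ℂ (coherentState α) ψ =
      (Real.exp (-absSq α / 2) : ℂ) * h (star α) := by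
  obtain ⟨χ, hχ⟩ := exists_inner_eq_integral hi
  refine ⟨χ, fun β => ?_⟩
  have hpi : (Real.pi : ℂ) ^ n ≠ 0 := pow_ne_zero _ (by exact_mod_cast Real.pi_ne_zero)
  rw [hχ, hh.integral_conj_coherentState_mul, ← mul_assoc, one_div_mul_cancel hpi, one_mul]
  have := (memLp_inner_coherentState (coherentState β)).star.integrable_mul hi
  exact this

end

/-! ### The uncertainty inequality for a vector -/

section

/-! ### Square-integrable functions -/

theorem MemLp.integrable_conj_mul {X : Type*} [MeasurableSpace X] {μ : Measure X} {f g : X → ℂ}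
    (hf : MemLp f 2 μ) (hg : MemLp g 2 μ) : Integrable (fun x => conj (f x) * g x) μ :=
  hf.star.integrable_mul hg

theorem norm_sq_toLp {X : Type*} [MeasurableSpace X] {μ : Measure X} {f : X → ℂ}
    (hf : MemLp f 2 μ) : ‖hf.toLp f‖ ^ 2 = ∫ x, ‖f x‖ ^ 2 ∂μ := by
  have h : inner ℂ (hf.toLp f) (hf.toLp f) = ((∫ x, ‖f x‖ ^ 2 ∂μ : ℝ) : ℂ) := by
    rw [L2.inner_def, ← integral_complex_ofReal]
    refine integral_congr_ae ?_
    filter_upwards [hf.coeFn_toLp] with x hx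
    rw [hx, RCLike.inner_apply, Complex.mul_conj']
    push_cast; rfl
  rw [inner_self_eq_norm_sq_to_K] at h
  exact Complex.ofReal_injective (by rw [← h]; push_cast; rfl)

theorem norm_integral_conj_mul_sq_le {X : Type*} [MeasurableSpace X] {μ : Measure X} {f g : X → ℂ}
    (hf : MemLp f 2 μ) (hg : MemLp g 2 μ) :
    ‖∫ x, conj (f x) * g x ∂μ‖ ^ 2 ≤ (∫ x, ‖f x‖ ^ 2 ∂μ) * ∫ x, ‖g x‖ ^ 2 ∂μ := by
  have h : ∫ x, conj (f x) * g x ∂μ = inner ℂ (hf.toLp f) (hg.toLp g) := by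
    rw [L2.inner_def]
    refine integral_congr_ae ?_
    filter_upwards [hf.coeFn_toLp, hg.coeFn_toLp] with x h1 h2
    rw [h1, h2, RCLike.inner_apply, mul_comm]
  rw [h, ← norm_sq_toLp hf, ← norm_sq_toLp hg, ← mul_pow]
  gcongr
  exact norm_inner_le_norm _ _

theorem integral_norm_sub_sq {X : Type*} [MeasurableSpace X] {μ : Measure X} {f g : X → ℂ}
    (hf : MemLp f 2 μ) (hg : MemLp g 2 μ) :
    ∫ x, ‖f x - g x‖ ^ 2 ∂μ = ∫ x, ‖f x‖ ^ 2 ∂μ -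
      2 * (∫ x, conj (g x) * f x ∂μ).re + ∫ x, ‖g x‖ ^ 2 ∂μ := by
  have h : ∫ x, conj (g x) * f x ∂μ = inner ℂ (hg.toLp g) (hf.toLp f) := by
    rw [L2.inner_def]
    refine integral_congr_ae ?_
    filter_upwards [hf.coeFn_toLp, hg.coeFn_toLp] with x h1 h2
    rw [h1, h2, RCLike.inner_apply, mul_comm]
  have h2 := norm_sq_toLp (hf.sub hg)
  simp only [Pi.sub_apply] at h2
  rw [← h2, h, ← norm_sq_toLp hf, ← norm_sq_toLp hg, MemLp.toLp_sub, @norm_sub_sq ℂ,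
    inner_re_symm]
  rfl

/-! ### Phase-space translations -/

/-- The symplectic pairing `∑ⱼ (ξⱼ αⱼ* - ξⱼ* αⱼ)`, which is purely imaginary. -/
def sympl {n : ℕ} (ξ α : Fin n → ℂ) : ℂ := ∑ j, (ξ j * conj (α j) - conj (ξ j) * α j)

theorem sympl_eq {n : ℕ} (ξ α : Fin n → ℂ) :
    sympl ξ α = ∑ j, ξ j * conj (α j) - ∑ j, conj (ξ j) * α j := Finset.sum_sub_distrib ..

theorem conj_sympl {n : ℕ} (ξ α : Fin n → ℂ) : conj (sympl ξ α) = -sympl ξ α := by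
  simp only [sympl, map_sum, ← Finset.sum_neg_distrib, map_sub, map_mul, Complex.conj_conj]
  exact Finset.sum_congr rfl fun j _ => by ring

theorem sympl_neg_left {n : ℕ} (ξ α : Fin n → ℂ) : sympl (-ξ) α = -sympl ξ α := by
  simp only [sympl, ← Finset.sum_neg_distrib, Pi.neg_apply, map_neg]
  exact Finset.sum_congr rfl fun j _ => by ring

theorem sympl_self {n : ℕ} (ξ : Fin n → ℂ) : sympl ξ ξ = 0 := by
  simp [sympl, mul_comm]

theorem sympl_add_right {n : ℕ} (ξ α β : Fin n → ℂ) : sympl ξ (α + β) = sympl ξ α + sympl ξ β := by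
  simp only [sympl, ← Finset.sum_add_distrib, Pi.add_apply, map_add]
  exact Finset.sum_congr rfl fun j _ => by ring

theorem continuous_sympl {n : ℕ} (ξ : Fin n → ℂ) : Continuous (sympl ξ) := by
  unfold sympl; fun_prop

theorem sympl_re {n : ℕ} (ξ α : Fin n → ℂ) : (sympl ξ α).re = 0 := by
  have := congrArg Complex.re (conj_sympl ξ α)
  simp only [Complex.conj_re, Complex.neg_re] at this
  linarith

theorem norm_exp_mul_sympl {n : ℕ} (c : ℝ) (ξ α : Fin n → ℂ) :
    ‖Complex.exp (c * sympl ξ α)‖ = 1 := by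
  rw [Complex.norm_exp]; simp [sympl_re]

/-- The function `e^{|δ|²/2} e^{(δ·α* - δ*·α)/2} ⟨α + δ|ψ⟩`. -/
def translateFun {n : ℕ} (ψ : Fock n) (δ α : Fin n → ℂ) : ℂ :=
  (Real.exp (absSq δ / 2) : ℂ) * Complex.exp ((1 / 2 : ℝ) * sympl δ α) *
    inner ℂ (coherentState (α + δ)) ψ

theorem translateFun_eq {n : ℕ} (ψ : Fock n) (δ α : Fin n → ℂ) :
    translateFun ψ δ α = (Real.exp (-absSq α / 2) : ℂ) *
      (bargmann ψ (star α + star δ) * Complex.exp (-∑ j, conj (δ j) * α j)) := by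
  rw [translateFun, inner_coherentState, star_add]
  push_cast
  rw [absSq_add, sympl_eq, ← mul_assoc, ← Complex.exp_add, ← Complex.exp_add, mul_left_comm,
    ← Complex.exp_add, mul_comm]
  congr 2
  simp only [mul_comm]
  ring

theorem norm_translateFun {n : ℕ} (ψ : Fock n) (δ α : Fin n → ℂ) :
    ‖translateFun ψ δ α‖ = Real.exp (absSq δ / 2) * ‖inner ℂ (coherentState (α + δ)) ψ‖ := by
  rw [translateFun, norm_mul, norm_mul, norm_exp_mul_sympl, mul_one, Complex.norm_real,
    Real.norm_of_nonneg (Real.exp_pos _).le]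

theorem continuous_translateFun {n : ℕ} (ψ : Fock n) (δ : Fin n → ℂ) :
    Continuous (translateFun ψ δ) := by
  have h1 := continuous_sympl δ
  have h2 := (continuous_inner_coherentState ψ).comp (continuous_add_const δ)
  unfold translateFun
  exact (continuous_const.mul (continuous_const.mul h1).cexp).mul h2

theorem memLp_translateFun {n : ℕ} (ψ : Fock n) (δ : Fin n → ℂ) :
    MemLp (translateFun ψ δ) 2 := by
  rw [memLp_two_iff_integrable_sq_norm (continuous_translateFun ψ δ).aestronglyMeasurable]
  simp only [norm_translateFun, mul_pow]
  exact ((integrable_norm_sq_inner ψ).comp_add_right δ).const_mul _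

theorem integral_norm_sq_translateFun {n : ℕ} (ψ : Fock n) (δ : Fin n → ℂ) :
    ∫ α, ‖translateFun ψ δ α‖ ^ 2 = Real.exp (absSq δ) * (Real.pi ^ n * ‖ψ‖ ^ 2) := by
  simp only [norm_translateFun, mul_pow]
  rw [integral_const_mul, integral_add_right_eq_self (μ := (volume : Measure (Fin n → ℂ)))
    (fun α => ‖inner ℂ (coherentState α) ψ‖ ^ 2), integral_norm_sq_inner, ← Real.exp_nat_mul]
  congr 2
  push_cast; ring

/-- For a coherent state χ = |β⟩ the exponential factor moves the evaluation point of the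
reproducing formula from β* to β* - δ*, which undoes the translation of the Bargmann function.
Totality gives all χ. Hence `translateFun ψ δ` minus ⟨α|ψ⟩ is orthogonal to the range of the
transform. -/
theorem integral_conj_mul_translateFun {n : ℕ} (χ ψ : Fock n) (δ : Fin n → ℂ) :
    ∫ α, conj (inner ℂ (coherentState α) χ) * translateFun ψ δ α =
      (Real.pi : ℂ) ^ n * inner ℂ χ ψ := by
  have hm := (memLp_translateFun ψ δ).sub (memLp_inner_coherentState ψ)
  have h := integral_conj_inner_mul_eq_zero hm (fun β => ?_) χ
  · simp only [Pi.sub_apply, mul_sub] at h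
    rw [integral_sub (MemLp.integrable_conj_mul (memLp_inner_coherentState χ)
      (memLp_translateFun ψ δ)) (MemLp.integrable_conj_mul (memLp_inner_coherentState χ)
      (memLp_inner_coherentState ψ)), integral_conj_inner_mul_inner, sub_eq_zero] at h
    exact h
  · simp only [Pi.sub_apply, mul_sub]
    have hi := MemLp.integrable_conj_mul (memLp_inner_coherentState (coherentState β))
      (memLp_translateFun ψ δ)
    rw [integral_sub hi (MemLp.integrable_conj_mul
      (memLp_inner_coherentState (coherentState β)) (memLp_inner_coherentState ψ)),
      integral_conj_inner_mul_inner, sub_eq_zero, inner_coherentState]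
    simp only [translateFun_eq, conj_inner_coherentState_mul] at hi ⊢
    have e : ∀ α, bargmann ψ (star α + star δ) * Complex.exp (-∑ j, conj (δ j) * α j) *
        Complex.exp (∑ j, α j * star β j) * gaussWeight α =
        bargmann ψ (star α + star δ) *
        Complex.exp (∑ j, α j * (star β - star δ) j) * gaussWeight α := fun α => by
      rw [mul_assoc (bargmann ψ _), ← Complex.exp_add]
      congr 3
      simp only [Pi.sub_apply, mul_sub, Finset.sum_sub_distrib, Pi.star_apply, RCLike.star_def]
      simp only [mul_comm]
      ring
    simp only [e] at hi ⊢
    have h0 : (Real.exp (-absSq β / 2) : ℂ) ≠ 0 := by exact_mod_cast (Real.exp_pos _).ne'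
    have hi2 := hi.const_mul (Real.exp (-absSq β / 2) : ℂ)⁻¹
    simp only [inv_mul_cancel_left₀ h0] at hi2
    rw [integral_const_mul, ((lineEntire_bargmann ψ).translate (star δ)).reproducing _ hi2,
      sub_add_cancel]
    ring

/-! ### The uncertainty inequality for a vector -/

theorem absSq_conj_mul_sum {n : ℕ} (δ : Fin n → ℂ) : ∑ j, conj (δ j) * δ j = (absSq δ : ℂ) :=
  sum_conj_mul_self δ

/-- The substitution α ↦ α - δ moves the translation to the other factor, where it becomes
`translateFun ψ (-δ)`, and replaces δ*·α by δ*·α - |δ|². The conjugate of δ*·α is linear in α*,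
hence absorbed in a vector χ, and `integral_conj_mul_translateFun` removes both translations. The
terms with δ*·α cancel and -|δ|² remains. -/
theorem integral_conj_translateFun_mul {n : ℕ} (ψ : Fock n) (δ : Fin n → ℂ)
    (hδ : MemLp (fun α => (∑ j, δ j * conj (α j)) * inner ℂ (coherentState α) ψ) 2) :
    ∫ α, conj (translateFun ψ δ α - inner ℂ (coherentState α) ψ) *
      ((∑ j, conj (δ j) * α j) * inner ℂ (coherentState α) ψ) =
      -((absSq δ : ℂ) * ((Real.pi : ℂ) ^ n * inner ℂ ψ ψ)) := by
  have hφ := memLp_inner_coherentState ψ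
  have hδ' : MemLp (fun α => (∑ j, conj (δ j) * α j) * inner ℂ (coherentState α) ψ) 2 := by
    refine hδ.of_le ?_ (ae_of_all _ fun α => le_of_eq ?_)
    · have := continuous_inner_coherentState ψ
      exact Continuous.aestronglyMeasurable (by fun_prop)
    · rw [norm_mul, norm_mul, ← Complex.norm_conj (∑ j, δ j * conj (α j))]
      simp
  obtain ⟨χ, hχ⟩ : ∃ χ : Fock n, ∀ α, inner ℂ (coherentState α) χ =
      (∑ j, δ j * conj (α j)) * inner ℂ (coherentState α) ψ := by
    have e : ∀ α : Fin n → ℂ, (∑ j, δ j * conj (α j)) * inner ℂ (coherentState α) ψ =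
        (Real.exp (-absSq α / 2) : ℂ) * ((∑ j, δ j * star α j) * bargmann ψ (star α)) :=
      fun α => by rw [inner_coherentState]; simp; ring
    simp only [e] at hδ ⊢
    exact ((LineEntire.linear δ).mul (lineEntire_bargmann ψ)).exists_inner_coherentState hδ
  have hshift := integral_sub_right_eq_self (μ := (volume : Measure (Fin n → ℂ)))
    (fun α => conj (translateFun ψ δ α) *
      ((∑ j, conj (δ j) * α j) * inner ℂ (coherentState α) ψ)) δ
  have e : ∀ α, conj (translateFun ψ δ (α - δ)) *
      ((∑ j, conj (δ j) * (α - δ) j) * inner ℂ (coherentState (α - δ)) ψ) =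
      conj (inner ℂ (coherentState α) χ) * translateFun ψ (-δ) α -
        (absSq δ : ℂ) * (conj (inner ℂ (coherentState α) ψ) * translateFun ψ (-δ) α) := fun α => by
    have h1 : sympl δ (α - δ) = sympl δ α := by
      have := sympl_add_right δ (α - δ) δ
      rw [sub_add_cancel, sympl_self, add_zero] at this
      exact this.symm
    have h2 : absSq (-δ) = absSq δ := by simp [absSq]
    have h3 : ∑ j, conj (δ j) * (α - δ) j = ∑ j, conj (δ j) * α j - absSq δ := by
      rw [← absSq_conj_mul_sum, ← Finset.sum_sub_distrib]
      exact Finset.sum_congr rfl fun j _ => by rw [Pi.sub_apply]; ring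
    rw [hχ, h3, translateFun, translateFun, sub_add_cancel, h1, h2, sympl_neg_left,
      ← sub_eq_add_neg]
    simp only [map_mul, Complex.conj_ofReal, ← Complex.exp_conj, conj_sympl, map_sum,
      Complex.conj_conj]
    ring
  simp only [e] at hshift
  rw [integral_sub (MemLp.integrable_conj_mul (memLp_inner_coherentState χ)
    (memLp_translateFun ψ (-δ))) ((MemLp.integrable_conj_mul hφ
    (memLp_translateFun ψ (-δ))).const_mul _), integral_const_mul,
    integral_conj_mul_translateFun, integral_conj_mul_translateFun,
    ← integral_conj_inner_mul_inner χ ψ] at hshift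
  simp only [map_sub, sub_mul]
  rw [integral_sub (MemLp.integrable_conj_mul (memLp_translateFun ψ δ) hδ')
    (MemLp.integrable_conj_mul hφ hδ'), ← hshift]
  have e2 : ∀ α, conj (inner ℂ (coherentState α) χ) * inner ℂ (coherentState α) ψ =
      conj (inner ℂ (coherentState α) ψ) *
        ((∑ j, conj (δ j) * α j) * inner ℂ (coherentState α) ψ) := fun α => by
    rw [hχ]
    simp only [map_mul, map_sum, Complex.conj_conj]
    ring
  simp only [e2]
  ring

theorem memLp_coord_mul {n : ℕ} {ψ : Fock n}
    (hψ : ∀ j, Integrable fun α : Fin n → ℂ => ‖α j‖ ^ 2 * ‖inner ℂ (coherentState α) ψ‖ ^ 2)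
    (j : Fin n) : MemLp (fun α : Fin n → ℂ => α j * inner ℂ (coherentState α) ψ) 2 := by
  have hc := continuous_inner_coherentState ψ
  rw [memLp_two_iff_integrable_sq_norm (Continuous.aestronglyMeasurable (by fun_prop))]
  simpa only [norm_mul, mul_pow] using hψ j

theorem memLp_conj_coord_mul {n : ℕ} {ψ : Fock n}
    (hψ : ∀ j, Integrable fun α : Fin n → ℂ => ‖α j‖ ^ 2 * ‖inner ℂ (coherentState α) ψ‖ ^ 2)
    (j : Fin n) : MemLp (fun α : Fin n → ℂ => conj (α j) * inner ℂ (coherentState α) ψ) 2 := by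
  have hc := continuous_inner_coherentState ψ
  rw [memLp_two_iff_integrable_sq_norm (Continuous.aestronglyMeasurable (by fun_prop))]
  simpa only [norm_mul, mul_pow, Complex.norm_conj] using hψ j

theorem memLp_linear_mul {n : ℕ} {ψ : Fock n}
    (hψ : ∀ j, Integrable fun α : Fin n → ℂ => ‖α j‖ ^ 2 * ‖inner ℂ (coherentState α) ψ‖ ^ 2)
    (u : Fin n → ℂ) :
    MemLp (fun α : Fin n → ℂ => (∑ j, u j * α j) * inner ℂ (coherentState α) ψ) 2 := by
  simp only [Finset.sum_mul, mul_assoc]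
  exact memLp_finsetSum _ fun j _ => (memLp_coord_mul hψ j).const_mul _

theorem memLp_conj_linear_mul {n : ℕ} {ψ : Fock n}
    (hψ : ∀ j, Integrable fun α : Fin n → ℂ => ‖α j‖ ^ 2 * ‖inner ℂ (coherentState α) ψ‖ ^ 2)
    (u : Fin n → ℂ) :
    MemLp (fun α : Fin n → ℂ => (∑ j, u j * conj (α j)) * inner ℂ (coherentState α) ψ) 2 := by
  simp only [Finset.sum_mul, mul_assoc]
  exact memLp_finsetSum _ fun j _ => (memLp_conj_coord_mul hψ j).const_mul _

/-- Cauchy–Schwarz against r = `translateFun ψ δ` - ⟨·|ψ⟩. As r is orthogonal to the range, which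
contains (v·α* + s)⟨α|ψ⟩, only δ*·α contributes to the pairing. The exponential factor is the value
of ‖r‖². -/
theorem absSq_sq_mul_le {n : ℕ} {ψ : Fock n}
    (hψ : ∀ j, Integrable fun α : Fin n → ℂ => ‖α j‖ ^ 2 * ‖inner ℂ (coherentState α) ψ‖ ^ 2)
    (δ v : Fin n → ℂ) (s : ℂ) :
    (absSq δ * (Real.pi ^ n * ‖ψ‖ ^ 2)) ^ 2 ≤
      (Real.exp (absSq δ) - 1) * (Real.pi ^ n * ‖ψ‖ ^ 2) *
        ∫ α : Fin n → ℂ, ‖∑ j, conj (δ j) * α j + ∑ j, v j * conj (α j) + s‖ ^ 2 *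
          ‖inner ℂ (coherentState α) ψ‖ ^ 2 := by
  have hφ := memLp_inner_coherentState ψ
  have hr : MemLp (fun α => translateFun ψ δ α - inner ℂ (coherentState α) ψ) 2 :=
    (memLp_translateFun ψ δ).sub hφ
  have hp : MemLp (fun α : Fin n → ℂ => (∑ j, v j * conj (α j)) * inner ℂ (coherentState α) ψ +
      s * inner ℂ (coherentState α) ψ) 2 := (memLp_conj_linear_mul hψ v).add (hφ.const_mul s)
  obtain ⟨χ, hχ⟩ : ∃ χ : Fock n, ∀ α, inner ℂ (coherentState α) χ =
      (∑ j, v j * conj (α j)) * inner ℂ (coherentState α) ψ +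
      s * inner ℂ (coherentState α) ψ := by
    have e : ∀ α : Fin n → ℂ, (∑ j, v j * conj (α j)) * inner ℂ (coherentState α) ψ +
        s * inner ℂ (coherentState α) ψ = (Real.exp (-absSq α / 2) : ℂ) *
          (((∑ j, v j * star α j) + s) * bargmann ψ (star α)) :=
      fun α => by rw [inner_coherentState]; simp; ring
    simp only [e] at hp ⊢
    exact (((LineEntire.linear v).add (LineEntire.const s)).mul
      (lineEntire_bargmann ψ)).exists_inner_coherentState hp
  have hg := (memLp_linear_mul hψ fun j => conj (δ j)).add (memLp_inner_coherentState χ)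
  have hcs := norm_integral_conj_mul_sq_le hr hg
  simp only [Pi.add_apply] at hcs
  have h1 : ∫ α, ‖translateFun ψ δ α - inner ℂ (coherentState α) ψ‖ ^ 2 =
      (Real.exp (absSq δ) - 1) * (Real.pi ^ n * ‖ψ‖ ^ 2) := by
    rw [integral_norm_sub_sq (memLp_translateFun ψ δ) hφ, integral_norm_sq_translateFun,
      integral_norm_sq_inner, integral_conj_mul_translateFun, inner_self_eq_norm_sq_to_K]
    have : ((Real.pi : ℂ) ^ n * (‖ψ‖ : ℂ) ^ 2).re = Real.pi ^ n * ‖ψ‖ ^ 2 := by norm_cast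
    simp only [Complex.coe_algebraMap]
    rw [this]
    ring
  have h2 : ∫ α, conj (translateFun ψ δ α - inner ℂ (coherentState α) ψ) *
      inner ℂ (coherentState α) χ = 0 := by
    have h3 : ∫ α, conj (inner ℂ (coherentState α) χ) *
        (translateFun ψ δ α - inner ℂ (coherentState α) ψ) = 0 := by
      simp only [mul_sub]
      rw [integral_sub (MemLp.integrable_conj_mul (memLp_inner_coherentState χ)
        (memLp_translateFun ψ δ)) (MemLp.integrable_conj_mul (memLp_inner_coherentState χ) hφ),
        integral_conj_mul_translateFun, integral_conj_inner_mul_inner, sub_self]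
    have h4 := congrArg conj h3
    rw [← integral_conj, map_zero] at h4
    rw [← h4]
    refine integral_congr_ae (ae_of_all _ fun α => ?_)
    simp only [map_mul, Complex.conj_conj]
    ring
  simp only [mul_add] at hcs
  rw [h1, integral_add (MemLp.integrable_conj_mul hr (memLp_linear_mul hψ fun j => conj (δ j)))
    (MemLp.integrable_conj_mul hr (memLp_inner_coherentState χ))] at hcs
  rw [h2, add_zero, integral_conj_translateFun_mul ψ δ (memLp_conj_linear_mul hψ δ), norm_neg,
    inner_self_eq_norm_sq_to_K] at hcs
  have h5 : ‖(absSq δ : ℂ) * ((Real.pi : ℂ) ^ n * (‖ψ‖ : ℂ) ^ 2)‖ =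
      absSq δ * (Real.pi ^ n * ‖ψ‖ ^ 2) := by
    have := Real.pi_pos
    rw [← Complex.ofReal_pow, ← Complex.ofReal_pow, ← Complex.ofReal_mul, ← Complex.ofReal_mul,
      Complex.norm_real, Real.norm_of_nonneg]
    exact mul_nonneg (absSq_nonneg δ) (by positivity)
  simp only [Complex.coe_algebraMap] at hcs
  rw [h5] at hcs
  refine hcs.trans_eq ?_
  congr 1
  refine integral_congr_ae (ae_of_all _ fun α => ?_)
  simp only [hχ]
  rw [← mul_pow, ← norm_mul]
  congr 2
  ring

/-- Insert t·(u*, v, s) for (δ, v, s) in `absSq_sq_mul_le`, cancel the powers of t, and let t → 0,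
where (eˣ - 1)/x → 1. Finite translations avoid any differentiation in L². -/
theorem uncertainty_vector {n : ℕ} {ψ : Fock n}
    (hψ : ∀ j, Integrable fun α : Fin n → ℂ => ‖α j‖ ^ 2 * ‖inner ℂ (coherentState α) ψ‖ ^ 2)
    (u v : Fin n → ℂ) (s : ℂ) :
    absSq u * (Real.pi ^ n * ‖ψ‖ ^ 2) ≤
      ∫ α : Fin n → ℂ, ‖∑ j, u j * α j + ∑ j, v j * conj (α j) + s‖ ^ 2 *
        ‖inner ℂ (coherentState α) ψ‖ ^ 2 := by
  set N := ∫ α : Fin n → ℂ, ‖∑ j, u j * α j + ∑ j, v j * conj (α j) + s‖ ^ 2 *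
        ‖inner ℂ (coherentState α) ψ‖ ^ 2 with hN
  have hN0 : 0 ≤ N := integral_nonneg fun α => by positivity
  set M := Real.pi ^ n * ‖ψ‖ ^ 2 with hM
  have hM0 : 0 ≤ M := by have := Real.pi_pos; positivity
  rcases hM0.eq_or_lt with h0 | hMpos
  · rw [← h0]; simpa using hN0
  rcases (absSq_nonneg u).eq_or_lt with h0 | hu
  · rw [← h0]; simpa using hN0
  have key : ∀ t : ℝ, 0 < t → absSq u * M ≤ (Real.exp (t ^ 2 * absSq u) - 1) / t ^ 2 / absSq u * N := by
    intro t ht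
    have h := absSq_sq_mul_le hψ (fun j => t * conj (u j)) (fun j => t * v j) (t * s)
    have e1 : absSq (fun j => (t : ℂ) * conj (u j)) = t ^ 2 * absSq u := by
      simp [absSq, mul_pow, Finset.mul_sum]
    have e2 : ∀ α : Fin n → ℂ, ‖∑ j, conj ((t : ℂ) * conj (u j)) * α j +
        ∑ j, (t : ℂ) * v j * conj (α j) + t * s‖ ^ 2 * ‖inner ℂ (coherentState α) ψ‖ ^ 2 =
        t ^ 2 * (‖∑ j, u j * α j + ∑ j, v j * conj (α j) + s‖ ^ 2 *
        ‖inner ℂ (coherentState α) ψ‖ ^ 2) := fun α => by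
      have : ∑ j, conj ((t : ℂ) * conj (u j)) * α j + ∑ j, (t : ℂ) * v j * conj (α j) + t * s =
          t * (∑ j, u j * α j + ∑ j, v j * conj (α j) + s) := by
        simp only [map_mul, Complex.conj_ofReal, Complex.conj_conj, mul_add, Finset.mul_sum,
          mul_assoc]
      rw [this, norm_mul, mul_pow, Complex.norm_real, Real.norm_eq_abs, sq_abs, mul_assoc]
    simp only [e1, e2] at h
    rw [integral_const_mul, ← hN, ← hM] at h
    have h3 : (t ^ 2 * absSq u * M) * (t ^ 2 * absSq u * M) ≤
        (t ^ 2 * absSq u * M) * ((Real.exp (t ^ 2 * absSq u) - 1) / absSq u * N) := by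
      calc _ = (t ^ 2 * absSq u * M) ^ 2 := by ring
        _ ≤ _ := h
        _ = _ := by field_simp
    have h4 := le_of_mul_le_mul_left h3 (by positivity)
    calc absSq u * M = (t ^ 2 * absSq u * M) / t ^ 2 := by field_simp
      _ ≤ ((Real.exp (t ^ 2 * absSq u) - 1) / absSq u * N) / t ^ 2 := by gcongr
      _ = _ := by field_simp
  have hlim : Tendsto (fun x : ℝ => (Real.exp x - 1) / x * N) (𝓝[>] 0) (𝓝 (1 * N)) := by
    refine Tendsto.mul_const _ ?_
    have := (Real.hasDerivAt_exp 0).tendsto_slope_zero_right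
    simp only [zero_add, Real.exp_zero, smul_eq_mul] at this
    refine this.congr fun x => ?_
    rw [div_eq_inv_mul]
  rw [one_mul] at hlim
  refine ge_of_tendsto hlim ?_
  filter_upwards [self_mem_nhdsWithin] with x hx
  have hx : 0 < x := hx
  -- With this t the product t²|u|² is x.
  have h := key (Real.sqrt (x / absSq u)) (Real.sqrt_pos.2 (by positivity))
  rw [Real.sq_sqrt (by positivity), div_mul_cancel₀ _ hu.ne', div_div, div_mul_cancel₀ _ hu.ne'] at h
  exact h

end

/-! ### Displacement operators on phase space -/

section

/-! ### Displaced number states -/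

/-- The polynomial in the Bargmann representation of a finite vector, evaluated at `z`. -/
def evalVec {n : ℕ} (z : Fin n → ℂ) : FiniteVec n →ₗ[ℂ] ℂ :=
  Finsupp.linearCombination ℂ fun m => monomialFun m z

theorem evalVec_single {n : ℕ} (z : Fin n → ℂ) (m : Fin n → ℕ) (c : ℂ) :
    evalVec z (Finsupp.single m c) = c * monomialFun m z := by
  simp [evalVec]

theorem toFock_single {n : ℕ} (m : Fin n → ℕ) (c : ℂ) :
    toFock (Finsupp.single m c) = c • (numberState m : Fock n) := by
  simp [toFock]

theorem inner_coherentState_toFock {n : ℕ} (α : Fin n → ℂ) (v : FiniteVec n) :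
    inner ℂ (coherentState α) (toFock v) = (Real.exp (-absSq α / 2) : ℂ) * evalVec (star α) v := by
  induction v using Finsupp.induction_linear with
  | zero => simp
  | add v w hv hw => rw [map_add, map_add, inner_add_right, hv, hw, mul_add]
  | single m c =>
    rw [toFock_single, inner_smul_right, inner_coherentState_numberState, evalVec_single]
    ring

/-- In the Bargmann representation aⱼ is ∂/∂zⱼ. Truncated subtraction at mⱼ = 0 is harmless, since
both sides then vanish. -/
theorem monomialFun_sub_single {n : ℕ} (m : Fin n → ℕ) (j : Fin n) (z : Fin n → ℂ) :
    (Real.sqrt (m j) : ℂ) * monomialFun (m - Pi.single j 1) z =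
      (∏ i ∈ Finset.univ.erase j, z i ^ m i / (Real.sqrt (Nat.factorial (m i)) : ℂ)) *
        ((m j : ℂ) * z j ^ (m j - 1) / (Real.sqrt (Nat.factorial (m j)) : ℂ)) := by
  rw [monomialFun, ← Finset.prod_erase_mul _ _ (Finset.mem_univ j)]
  have h1 : ∏ i ∈ Finset.univ.erase j, z i ^ (m - Pi.single j 1 : Fin n → ℕ) i /
      (Real.sqrt (Nat.factorial ((m - Pi.single j 1 : Fin n → ℕ) i)) : ℂ) =
      ∏ i ∈ Finset.univ.erase j, z i ^ m i / (Real.sqrt (Nat.factorial (m i)) : ℂ) := by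
    refine Finset.prod_congr rfl fun i hi => ?_
    have : (m - Pi.single j 1 : Fin n → ℕ) i = m i := by
      simp [Pi.single_eq_of_ne (Finset.ne_of_mem_erase hi)]
    rw [this]
  rw [h1, Pi.sub_apply, Pi.single_eq_same]
  rcases Nat.eq_zero_or_pos (m j) with h0 | hpos
  · simp [h0]
  · obtain ⟨k, hk⟩ := Nat.exists_eq_succ_of_ne_zero hpos.ne'
    rw [hk, Nat.succ_sub_one, Nat.factorial_succ, Nat.cast_mul, Real.sqrt_mul (Nat.cast_nonneg _)]
    have h2 : Real.sqrt ((k + 1 : ℕ) : ℝ) ≠ 0 := (Real.sqrt_pos.2 (by positivity)).ne'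
    have h3 : Real.sqrt ((Nat.factorial k : ℕ) : ℝ) ≠ 0 :=
      (Real.sqrt_pos.2 (by exact_mod_cast k.factorial_pos)).ne'
    have h4 : ((k.succ : ℕ) : ℂ) = (Real.sqrt ((k + 1 : ℕ) : ℝ) : ℂ) * Real.sqrt ((k + 1 : ℕ) : ℝ) := by
      rw [← Complex.ofReal_mul, Real.mul_self_sqrt (Nat.cast_nonneg _)]; norm_cast
    rw [h4]
    have h2' : (Real.sqrt ((k + 1 : ℕ) : ℝ) : ℂ) ≠ 0 := by exact_mod_cast h2
    have h3' : (Real.sqrt ((Nat.factorial k : ℕ) : ℝ) : ℂ) ≠ 0 := by exact_mod_cast h3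
    push_cast at h2' h3' ⊢
    field_simp

theorem monomialFun_add_single {n : ℕ} (m : Fin n → ℕ) (j : Fin n) (z : Fin n → ℂ) :
    (Real.sqrt (m j + 1) : ℂ) * monomialFun (m + Pi.single j 1) z = z j * monomialFun m z := by
  rw [monomialFun, monomialFun, ← Finset.prod_erase_mul _ _ (Finset.mem_univ j),
    ← Finset.prod_erase_mul Finset.univ
      (fun i => z i ^ m i / (Real.sqrt (Nat.factorial (m i)) : ℂ)) (Finset.mem_univ j)]
  have h1 : ∏ i ∈ Finset.univ.erase j, z i ^ (m + Pi.single j 1 : Fin n → ℕ) i /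
      (Real.sqrt (Nat.factorial ((m + Pi.single j 1 : Fin n → ℕ) i)) : ℂ) =
      ∏ i ∈ Finset.univ.erase j, z i ^ m i / (Real.sqrt (Nat.factorial (m i)) : ℂ) := by
    refine Finset.prod_congr rfl fun i hi => ?_
    have : (m + Pi.single j 1 : Fin n → ℕ) i = m i := by
      simp [Pi.single_eq_of_ne (Finset.ne_of_mem_erase hi)]
    rw [this]
  rw [h1, Pi.add_apply, Pi.single_eq_same, Nat.factorial_succ, Nat.cast_mul,
    Real.sqrt_mul (Nat.cast_nonneg _)]
  have h2 : (Real.sqrt ((m j + 1 : ℕ) : ℝ) : ℂ) ≠ 0 := by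
    exact_mod_cast (Real.sqrt_pos.2 (by positivity)).ne'
  have h3 : (Real.sqrt ((Nat.factorial (m j) : ℕ) : ℝ) : ℂ) ≠ 0 := by
    exact_mod_cast (Real.sqrt_pos.2 (by exact_mod_cast (m j).factorial_pos)).ne'
  push_cast at h2 h3 ⊢
  field_simp
  ring

theorem hasDerivAt_monomialFun {n : ℕ} (m : Fin n → ℕ) (p q : Fin n → ℂ) (t : ℂ) :
    HasDerivAt (fun t : ℂ => monomialFun m (p + t • q))
      (∑ j, q j * ((Real.sqrt (m j) : ℂ) * monomialFun (m - Pi.single j 1) (p + t • q))) t := by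
  have h := HasDerivAt.fun_finsetProd (u := Finset.univ)
    (f := fun (j : Fin n) (t : ℂ) =>
      (p j + t * q j) ^ m j / (Real.sqrt (Nat.factorial (m j)) : ℂ))
    (f' := fun j => ((m j : ℂ) * (p j + t * q j) ^ (m j - 1) * q j) /
      (Real.sqrt (Nat.factorial (m j)) : ℂ)) (x := t) fun j _ => by
    have h1 : HasDerivAt (fun t : ℂ => p j + t * q j) (q j) t := by
      simpa using ((hasDerivAt_id t).mul_const (q j)).const_add (p j)
    exact (h1.pow (m j)).div_const _
  refine h.congr_deriv (Finset.sum_congr rfl fun j _ => ?_)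
  rw [monomialFun_sub_single, smul_eq_mul]
  simp only [Pi.add_apply, Pi.smul_apply, smul_eq_mul]
  ring

/-- The Bargmann function of `e^{tG} v`, where `G` is the displacement generator. -/
def displacedEval {n : ℕ} (ξ z : Fin n → ℂ) (v : FiniteVec n) (t : ℂ) : ℂ :=
  Complex.exp (t * ∑ j, ξ j * z j - t ^ 2 * absSq ξ / 2) * evalVec (z + t • -star ξ) v

theorem displacementGenerator_single {n : ℕ} (ξ : Fin n → ℂ) (m : Fin n → ℕ) (c : ℂ) :
    displacementGenerator ξ (Finsupp.single m c) = ∑ j,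
      (Finsupp.single (m + Pi.single j 1) (ξ j * (c * Real.sqrt (m j + 1))) -
        Finsupp.single (m - Pi.single j 1) (conj (ξ j) * (c * Real.sqrt (m j)))) := by
  simp only [displacementGenerator, creation, annihilation, LinearMap.sum_apply,
    LinearMap.sub_apply, LinearMap.smul_apply, Finsupp.linearCombination_single,
    Finsupp.smul_single, smul_eq_mul]

/-- The generator acts on Bargmann functions as ξ·z - ξ*·∂, and `displacedEval` is the explicit
solution of the resulting transport equation. Since the derivative has the same form with the
generator applied to `v`, iteration yields all Taylor coefficients. -/
theorem hasDerivAt_displacedEval {n : ℕ} (ξ z : Fin n → ℂ) (v : FiniteVec n) (t : ℂ) :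
    HasDerivAt (displacedEval ξ z v) (displacedEval ξ z (displacementGenerator ξ v) t) t := by
  induction v using Finsupp.induction_linear with
  | zero =>
    simp only [map_zero]
    have : displacedEval ξ z 0 = fun _ => 0 := by funext t; simp [displacedEval]
    rw [this]
    exact hasDerivAt_const _ _
  | add v w hv hw =>
    have : displacedEval ξ z (v + w) = fun t => displacedEval ξ z v t + displacedEval ξ z w t := by
      funext t; simp [displacedEval, mul_add]
    rw [this, map_add]
    refine (hv.add hw).congr_deriv ?_
    simp [displacedEval, mul_add]
  | single m c =>
    have h1 : HasDerivAt (fun t : ℂ => Complex.exp (t * ∑ j, ξ j * z j - t ^ 2 * absSq ξ / 2))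
        (Complex.exp (t * ∑ j, ξ j * z j - t ^ 2 * absSq ξ / 2) *
          (∑ j, ξ j * z j - t * absSq ξ)) t := by
      refine HasDerivAt.cexp ?_
      have a := (hasDerivAt_id t).mul_const (∑ j, ξ j * z j)
      have b := (((hasDerivAt_id t).pow 2).mul_const (absSq ξ : ℂ)).div_const 2
      refine (a.sub b).congr_deriv ?_
      simp
      ring
    have h2 := (hasDerivAt_monomialFun m z (-star ξ) t).const_mul c
    have h3 := h1.mul h2
    have e : displacedEval ξ z (Finsupp.single m c) = fun t =>
        Complex.exp (t * ∑ j, ξ j * z j - t ^ 2 * absSq ξ / 2) *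
          (c * monomialFun m (z + t • -star ξ)) := by
      funext t; rw [displacedEval, evalVec_single]
    rw [e]
    refine h3.congr_deriv ?_
    rw [displacedEval, displacementGenerator_single, map_sum]
    simp only [map_sub, evalVec_single]
    have e2 : ∀ j, ξ j * (c * (Real.sqrt (m j + 1) : ℂ)) *
        monomialFun (m + Pi.single j 1) (z + t • -star ξ) =
        c * monomialFun m (z + t • -star ξ) * (ξ j * z j - t * (ξ j * conj (ξ j))) := fun j => by
      calc _ = ξ j * c * ((Real.sqrt (m j + 1) : ℂ) *
            monomialFun (m + Pi.single j 1) (z + t • -star ξ)) := by ring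
        _ = _ := by
          rw [monomialFun_add_single]
          simp only [Pi.add_apply, Pi.smul_apply, Pi.neg_apply, Pi.star_apply, smul_eq_mul,
            RCLike.star_def]
          ring
    simp only [e2, Finset.sum_sub_distrib, ← Finset.mul_sum, sum_mul_conj_self]
    rw [mul_assoc, ← mul_add]
    congr 1
    rw [sub_eq_add_neg (c * _ * _), ← Finset.sum_neg_distrib, Finset.mul_sum, mul_comm]
    congr 1
    refine Finset.sum_congr rfl fun j _ => ?_
    simp only [Pi.neg_apply, Pi.star_apply, RCLike.star_def]
    ring

theorem iteratedDeriv_displacedEval {n : ℕ} (ξ z : Fin n → ℂ) (k : ℕ) (v : FiniteVec n) :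
    iteratedDeriv k (displacedEval ξ z v) = displacedEval ξ z ((displacementGenerator ξ ^ k) v) := by
  induction k generalizing v with
  | zero => simp
  | succ k ih =>
    have h : deriv (displacedEval ξ z v) = displacedEval ξ z (displacementGenerator ξ v) :=
      funext fun t => (hasDerivAt_displacedEval ξ z v t).deriv
    rw [iteratedDeriv_succ', h, ih, pow_succ]
    rfl

theorem hasSum_displacedEval {n : ℕ} (ξ z : Fin n → ℂ) (v : FiniteVec n) :
    HasSum (fun k : ℕ => (Nat.factorial k : ℂ)⁻¹ * evalVec z ((displacementGenerator ξ ^ k) v))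
      (displacedEval ξ z v 1) := by
  have h := Complex.hasSum_taylorSeries_of_entire
    (f := displacedEval ξ z v) (fun t => (hasDerivAt_displacedEval ξ z v t).differentiableAt) 0 1
  refine hasSum_of_eq h fun k => ?_
  rw [iteratedDeriv_displacedEval]
  simp [displacedEval]

theorem ascFactorial_le_ascFactorial {a b : ℕ} (h : a ≤ b) (k : ℕ) :
    a.ascFactorial k ≤ b.ascFactorial k := by
  induction k with
  | zero => simp
  | succ k ih =>
    rw [Nat.ascFactorial_succ, Nat.ascFactorial_succ]
    gcongr

/-- One application of the generator to |m⟩ yields, for each mode j, two number states of total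
occupation at most |m| + 1 with coefficients at most ‖ξⱼ‖√(|m| + 1). The induction peels off the
factor that acts first, so it runs over all `m`. -/
theorem norm_toFock_displacementGenerator_pow_le {n : ℕ} (ξ : Fin n → ℂ) (k : ℕ)
    (m : Fin n → ℕ) : ‖toFock ((displacementGenerator ξ ^ k) (Finsupp.single m 1))‖ ≤
      (2 * ∑ j, ‖ξ j‖) ^ k * Real.sqrt ((∑ j, m j + 1).ascFactorial k) := by
  induction k generalizing m with
  | zero => simp [toFock_single, norm_numberState]
  | succ k ih =>
    set C := 2 * ∑ j, ‖ξ j‖ with hC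
    have hC0 : 0 ≤ C := by positivity
    rw [pow_succ, Module.End.mul_apply, displacementGenerator_single, map_sum, map_sum]
    have hs : ∀ (m' : Fin n → ℕ) (c : ℂ), (displacementGenerator ξ ^ k) (Finsupp.single m' c) =
        c • (displacementGenerator ξ ^ k) (Finsupp.single m' 1) := fun m' c => by
      rw [← map_smul, Finsupp.smul_single, smul_eq_mul, mul_one]
    set B := C ^ k * Real.sqrt ((∑ j, m j + 2).ascFactorial k) with hB
    have hB0 : 0 ≤ B := by positivity
    have hle : ∀ m' : Fin n → ℕ, ∑ j, m' j ≤ ∑ j, m j + 1 →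
        ‖toFock ((displacementGenerator ξ ^ k) (Finsupp.single m' 1))‖ ≤ B := fun m' hm' => by
      refine (ih m').trans ?_
      rw [hB]
      gcongr ?_ * Real.sqrt ?_
      exact_mod_cast ascFactorial_le_ascFactorial (by omega) k
    have hmj : ∀ j, m j ≤ ∑ j, m j := fun j =>
      Finset.single_le_sum (fun _ _ => Nat.zero_le _) (Finset.mem_univ j)
    set r := Real.sqrt ((∑ j, m j + 1 : ℕ) : ℝ) with hr
    have hterm : ∀ j, ‖toFock ((displacementGenerator ξ ^ k)
        (Finsupp.single (m + Pi.single j 1) (ξ j * (1 * (Real.sqrt (m j + 1) : ℂ))) -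
        Finsupp.single (m - Pi.single j 1) (conj (ξ j) * (1 * (Real.sqrt (m j) : ℂ)))))‖ ≤
        ‖ξ j‖ * (2 * (r * B)) := fun j => by
      rw [map_sub, map_sub, hs, hs (m - Pi.single j 1), map_smul, map_smul]
      refine (norm_sub_le _ _).trans ?_
      rw [norm_smul, norm_smul, one_mul, one_mul, norm_mul, norm_mul, Complex.norm_conj,
        Complex.norm_real, Complex.norm_real, Real.norm_of_nonneg (Real.sqrt_nonneg _),
        Real.norm_of_nonneg (Real.sqrt_nonneg _)]
      have h1 : Real.sqrt (m j + 1) ≤ r := by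
        refine Real.sqrt_le_sqrt ?_
        have := hmj j
        push_cast
        have h' : (m j : ℝ) ≤ ((∑ j, m j : ℕ) : ℝ) := by exact_mod_cast this
        push_cast at h'
        linarith
      have h2 : Real.sqrt (m j) ≤ r := (Real.sqrt_le_sqrt (by linarith)).trans h1
      have h3 := hle (m + Pi.single j 1) (by
        simp [Finset.sum_add_distrib])
      have h4 := hle (m - Pi.single j 1) (by
        refine (Finset.sum_le_sum fun i _ => ?_).trans (Nat.le_succ _)
        simp)
      calc _ ≤ ‖ξ j‖ * r * B + ‖ξ j‖ * r * B := by gcongr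
        _ = _ := by ring
    refine (norm_sum_le _ _).trans ((Finset.sum_le_sum fun j _ => hterm j).trans_eq ?_)
    rw [← Finset.sum_mul]
    have h5 : Real.sqrt ((∑ j, m j + 1).ascFactorial (k + 1)) =
        r * Real.sqrt ((∑ j, m j + 2).ascFactorial k) := by
      rw [hr, ← Real.sqrt_mul (Nat.cast_nonneg _)]
      congr 1
      have h6 : (∑ j, m j + 1).ascFactorial (k + 1) = (∑ j, m j + 1) * (∑ j, m j + 2).ascFactorial k := by
        have := Nat.succ_ascFactorial (∑ j, m j + 1) k
        rw [Nat.ascFactorial_succ]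
        exact this.symm
      exact_mod_cast h6
    rw [h5, hB, hC, pow_succ]
    ring

theorem summable_displacedNumberState {n : ℕ} (ξ : Fin n → ℂ) (m : Fin n → ℕ) :
    Summable fun k : ℕ => ((Nat.factorial k : ℂ)⁻¹) •
      toFock ((displacementGenerator ξ ^ k) (Finsupp.single m 1)) := by
  set M := ∑ j, m j with hM
  set C := 2 * ∑ j, ‖ξ j‖ with hC
  have hC0 : 0 ≤ C := by positivity
  refine Summable.of_norm_bounded ((summable_pow_div_sqrt_factorial
    (C * Real.sqrt 2)).mul_left (Real.sqrt (2 ^ M))) fun k => ?_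
  rw [norm_smul, norm_inv, Complex.norm_natCast]
  -- The rising factorial is k! times a binomial coefficient of M + k. After the square root, the
  -- factor 1/k! of the exponential series still leaves 1/√(k!).
  have h1 : (M + 1).ascFactorial k ≤ 2 ^ (M + k) * Nat.factorial k := by
    rw [Nat.ascFactorial_eq_factorial_mul_choose, mul_comm]
    gcongr
    exact Nat.choose_le_two_pow _ _
  have h2 : Real.sqrt ((M + 1).ascFactorial k) ≤
      Real.sqrt (2 ^ M) * Real.sqrt 2 ^ k * Real.sqrt (Nat.factorial k) := by
    refine (Real.sqrt_le_sqrt (by exact_mod_cast h1 : ((M + 1).ascFactorial k : ℝ) ≤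
      2 ^ (M + k) * Nat.factorial k)).trans_eq ?_
    have h3 : Real.sqrt (2 ^ k) = Real.sqrt 2 ^ k :=
      (Real.sqrt_eq_iff_mul_self_eq (by positivity) (by positivity)).2
        (by rw [← mul_pow, Real.mul_self_sqrt (by norm_num)])
    rw [Real.sqrt_mul (by positivity), pow_add, Real.sqrt_mul (by positivity), h3]
  have hk : (0 : ℝ) < Nat.factorial k := by exact_mod_cast k.factorial_pos
  have hsk : Real.sqrt (Nat.factorial k) * Real.sqrt (Nat.factorial k) = Nat.factorial k :=
    Real.mul_self_sqrt hk.le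
  have hsp : 0 < Real.sqrt (Nat.factorial k) := Real.sqrt_pos.2 hk
  calc _ ≤ (Nat.factorial k : ℝ)⁻¹ * (C ^ k *
        (Real.sqrt (2 ^ M) * Real.sqrt 2 ^ k * Real.sqrt (Nat.factorial k))) := by
        gcongr
        exact (norm_toFock_displacementGenerator_pow_le ξ k m).trans (by gcongr)
    _ = _ := by
        rw [mul_pow]
        nth_rewrite 1 [← hsk]
        field_simp
        rw [hC]; ring

/-- Norm convergence of the exponential series allows it to be paired termwise with ⟨α|, and the
result is the Taylor series of `displacedEval` at t = 1. -/
theorem inner_coherentState_displacedNumberState {n : ℕ} (ξ α : Fin n → ℂ) (m : Fin n → ℕ) :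
    inner ℂ (coherentState α) (displacedNumberState ξ m) =
      Complex.exp ((1 / 2 : ℝ) * sympl ξ α) * inner ℂ (coherentState (α - ξ)) (numberState m) := by
  have h1 := (summable_displacedNumberState ξ m).hasSum.mapL (innerSL ℂ (coherentState α))
  simp only [innerSL_apply_apply, inner_smul_right, inner_coherentState_toFock] at h1
  have h2 := (hasSum_displacedEval ξ (star α) (Finsupp.single m 1)).mul_left
    (Real.exp (-absSq α / 2) : ℂ)
  have h3 := h1.unique (hasSum_of_eq h2 fun k => by ring)
  change inner ℂ (coherentState α) (displacedNumberState ξ m) = _ at h3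
  rw [h3, displacedEval, evalVec_single, inner_coherentState_numberState]
  have e : star α + (1 : ℂ) • -star ξ = star (α - ξ) := by rw [one_smul, star_sub]; abel
  simp only [e, one_mul, one_pow]
  rw [← mul_assoc, ← mul_assoc]
  congr 1
  have h5 : (absSq (α - ξ) : ℂ) = absSq α + absSq ξ - ∑ j, conj (α j) * ξ j -
      ∑ j, α j * conj (ξ j) := by
    have h4 : absSq (-ξ) = absSq ξ := by simp [absSq]
    rw [sub_eq_add_neg, absSq_add, h4]
    simp only [Pi.neg_apply, map_neg, mul_neg, Finset.sum_neg_distrib]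
    ring
  push_cast
  rw [h5, ← Complex.exp_add, ← Complex.exp_add, sympl_eq]
  congr 1
  simp only [Pi.star_apply, RCLike.star_def, mul_comm]
  ring

/-- Written as integrals over phase space, the inner products lose their phases, and translation
invariance removes ξ. -/
theorem orthonormal_displacedNumberState {n : ℕ} (ξ : Fin n → ℂ) :
    Orthonormal ℂ (displacedNumberState (n := n) ξ) := by
  classical
  rw [orthonormal_iff_ite]
  intro k m
  have hpi : (Real.pi : ℂ) ^ n ≠ 0 := pow_ne_zero _ (by exact_mod_cast Real.pi_ne_zero)
  refine mul_left_cancel₀ hpi ?_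
  rw [← integral_conj_inner_mul_inner]
  simp only [inner_coherentState_displacedNumberState, map_mul]
  have e : ∀ α : Fin n → ℂ, conj (Complex.exp ((1 / 2 : ℝ) * sympl ξ α)) *
      conj (inner ℂ (coherentState (α - ξ)) (numberState k)) *
      (Complex.exp ((1 / 2 : ℝ) * sympl ξ α) *
        inner ℂ (coherentState (α - ξ)) (numberState m)) =
      conj (inner ℂ (coherentState (α - ξ)) (numberState k)) *
        inner ℂ (coherentState (α - ξ)) (numberState m) := fun α => by
    have h := Complex.conj_mul' (Complex.exp ((1 / 2 : ℝ) * sympl ξ α))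
    rw [norm_exp_mul_sympl] at h
    rw [mul_mul_mul_comm, h]
    simp
  simp only [e]
  rw [integral_sub_right_eq_self (μ := (volume : Measure (Fin n → ℂ)))
    (fun α => conj (inner ℂ (coherentState α) (numberState k)) *
      inner ℂ (coherentState α) (numberState m)) ξ, integral_conj_numberState_mul]
  split_ifs <;> simp

/-- The displacement operator `D(ξ)`. -/
def displacement {n : ℕ} (ξ : Fin n → ℂ) : Fock n →ₗᵢ[ℂ] Fock n :=
  (orthonormal_displacedNumberState ξ).orthogonalFamily.linearIsometry

theorem hasSum_displacement {n : ℕ} (ξ : Fin n → ℂ) (ψ : Fock n) :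
    HasSum (fun m => ψ m • displacedNumberState ξ m) (displacement ξ ψ) :=
  (orthonormal_displacedNumberState ξ).orthogonalFamily.hasSum_linearIsometry ψ

theorem inner_coherentState_displacement {n : ℕ} (ξ α : Fin n → ℂ) (ψ : Fock n) :
    inner ℂ (coherentState α) (displacement ξ ψ) =
      Complex.exp ((1 / 2 : ℝ) * sympl ξ α) * inner ℂ (coherentState (α - ξ)) ψ := by
  have h1 := (hasSum_displacement ξ ψ).mapL (innerSL ℂ (coherentState α))
  have h2 := (hasSum_inner_numberState (coherentState (α - ξ)) ψ).mul_left
    (Complex.exp ((1 / 2 : ℝ) * sympl ξ α))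
  refine h1.unique (hasSum_of_eq h2 fun m => ?_)
  rw [innerSL_apply_apply, inner_smul_right, inner_coherentState_displacedNumberState,
    inner_numberState]
  ring

theorem displacement_numberState {n : ℕ} (ξ : Fin n → ℂ) (m : Fin n → ℕ) :
    displacement ξ (numberState m) = displacedNumberState ξ m :=
  eq_of_inner_coherentState fun α => by
    rw [inner_coherentState_displacement, inner_coherentState_displacedNumberState]

theorem memLp_exp_sympl_mul {n : ℕ} (ξ : Fin n → ℂ) (ψ : Fock n) :
    MemLp (fun α => Complex.exp (sympl ξ α) * inner ℂ (coherentState α) ψ) 2 := by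
  refine (memLp_inner_coherentState ψ).of_le ?_ (ae_of_all _ fun α => le_of_eq ?_)
  · have h1 := continuous_inner_coherentState ψ
    have h2 := continuous_sympl ξ
    exact Continuous.aestronglyMeasurable (by fun_prop)
  · have := norm_exp_mul_sympl 1 ξ α
    rw [Complex.ofReal_one, one_mul] at this
    rw [norm_mul, this, one_mul]

/-- Compressing multiplication by the phase e^{ξ·α* - ξ*·α} to the range of the transform gives the
antinormally ordered exponential, which is e^{-|ξ|²/2} D(ξ). The identity is tested on coherent
states by the reproducing property. -/
theorem integral_conj_inner_mul_exp_sympl {n : ℕ} (ξ : Fin n → ℂ) (χ ψ : Fock n) :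
    ∫ α, conj (inner ℂ (coherentState α) χ) *
      (Complex.exp (sympl ξ α) * inner ℂ (coherentState α) ψ) =
      (Real.exp (-absSq ξ / 2) : ℂ) * ((Real.pi : ℂ) ^ n * inner ℂ χ (displacement ξ ψ)) := by
  have hm := memLp_exp_sympl_mul ξ ψ
  have hd := (memLp_inner_coherentState (displacement ξ ψ)).const_mul (Real.exp (-absSq ξ / 2) : ℂ)
  have h := integral_conj_inner_mul_eq_zero (hm.sub hd) (fun β => ?_) χ
  · simp only [Pi.sub_apply, mul_sub] at h
    rw [integral_sub (MemLp.integrable_conj_mul (memLp_inner_coherentState χ) hm)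
      (MemLp.integrable_conj_mul (memLp_inner_coherentState χ) hd), sub_eq_zero] at h
    rw [h]
    simp only [mul_left_comm _ (Real.exp (-absSq ξ / 2) : ℂ)]
    rw [integral_const_mul, integral_conj_inner_mul_inner]
  · have hβ := memLp_inner_coherentState (coherentState β)
    simp only [Pi.sub_apply, mul_sub]
    rw [integral_sub (MemLp.integrable_conj_mul hβ hm) (MemLp.integrable_conj_mul hβ hd),
      sub_eq_zero]
    simp only [mul_left_comm _ (Real.exp (-absSq ξ / 2) : ℂ)]
    rw [integral_const_mul, integral_conj_inner_mul_inner, inner_coherentState_displacement]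
    have hi := MemLp.integrable_conj_mul hβ hm
    have e : ∀ α, conj (inner ℂ (coherentState α) (coherentState β)) *
        (Complex.exp (sympl ξ α) * inner ℂ (coherentState α) ψ) =
        (Real.exp (-absSq β / 2) : ℂ) *
        (bargmann ψ (star α) * Complex.exp (∑ j, ξ j * star α j) *
          Complex.exp (∑ j, α j * (star β - star ξ) j) * gaussWeight α) := fun α => by
      rw [inner_coherentState α ψ, mul_left_comm (Complex.exp (sympl ξ α)),
        conj_inner_coherentState_mul, sympl_eq]
      rw [mul_right_comm (Complex.exp _) (bargmann ψ _), mul_comm (_ * _) (bargmann ψ _),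
        mul_assoc (bargmann ψ _) (Complex.exp _), ← Complex.exp_add, ← Complex.exp_add]
      congr 4
      simp only [Pi.sub_apply, mul_sub, Finset.sum_sub_distrib, Pi.star_apply, RCLike.star_def]
      simp only [mul_comm]
      ring
    simp only [e] at hi ⊢
    have h0 : (Real.exp (-absSq β / 2) : ℂ) ≠ 0 := by exact_mod_cast (Real.exp_pos _).ne'
    have hi2 := hi.const_mul (Real.exp (-absSq β / 2) : ℂ)⁻¹
    simp only [inv_mul_cancel_left₀ h0] at hi2
    rw [integral_const_mul,
      ((lineEntire_bargmann ψ).mul (LineEntire.linear ξ).cexp).reproducing _ hi2,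
      inner_coherentState, star_sub]
    have h5 : (absSq (β - ξ) : ℂ) = absSq β + absSq ξ - ∑ j, conj (β j) * ξ j -
        ∑ j, β j * conj (ξ j) := by
      have h4 : absSq (-ξ) = absSq ξ := by simp [absSq]
      rw [sub_eq_add_neg, absSq_add, h4]
      simp only [Pi.neg_apply, map_neg, mul_neg, Finset.sum_neg_distrib]
      ring
    have h6 : ∑ j, ξ j * (star β - star ξ) j = ∑ j, ξ j * conj (β j) - absSq ξ := by
      rw [← sum_mul_conj_self, ← Finset.sum_sub_distrib]
      exact Finset.sum_congr rfl fun j _ => by simp [mul_sub]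
    rw [h6]
    push_cast
    rw [h5, sympl_eq]
    have e7 : ∀ a b c d x y : ℂ, a * b = c * d * x → a * (y * (bargmann ψ (star β - star ξ) * b)) =
        c * (y * (d * (x * bargmann ψ (star β - star ξ)))) := fun a b c d x y h => by
      calc _ = (a * b) * y * bargmann ψ (star β - star ξ) := by ring
        _ = _ := by rw [h]; ring
    refine e7 _ _ _ _ _ _ ?_
    rw [← Complex.exp_add, ← Complex.exp_add, ← Complex.exp_add]
    congr 1
    simp only [mul_comm]
    ring

end

/-! ### States as mixtures of vectors, and their `Q` functions -/

section

/-! ### Double sums -/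

theorem hasSum_swap_of_nonneg {ι κ : Type*} {f : ι → κ → ℝ} (h0 : ∀ i m, 0 ≤ f i m)
    {a : κ → ℝ} {b : ι → ℝ} {s : ℝ} (ha : ∀ m, HasSum (fun i => f i m) (a m))
    (hb : ∀ i, HasSum (f i) (b i)) (hs : HasSum a s) : HasSum b s := by
  have h1 : Summable fun x : κ × ι => f x.2 x.1 := by
    refine (_root_.summable_prod_of_nonneg fun x => h0 x.2 x.1).2 ⟨fun m => (ha m).summable, ?_⟩
    simpa only [(ha _).tsum_eq] using hs.summable
  have h2 : HasSum (fun x : κ × ι => f x.2 x.1) s := by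
    have := h1.hasSum
    rwa [(this.prod_fiberwise ha).unique hs] at this
  have h3 : HasSum (fun x : ι × κ => f x.1 x.2) s := (Equiv.prodComm ι κ).hasSum_iff.2 h2
  exact h3.prod_fiberwise hb

theorem hasSum_swap {ι κ : Type*} {f : ι → κ → ℂ} {g : ι → κ → ℝ} (hg : ∀ i m, ‖f i m‖ ≤ g i m)
    {a : κ → ℂ} {b : ι → ℂ} {c : ι → ℝ} {s : ℂ} (ha : ∀ m, HasSum (fun i => f i m) (a m))
    (hb : ∀ i, HasSum (f i) (b i)) (hc : ∀ i, HasSum (g i) (c i)) (hc' : Summable c)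
    (hs : HasSum b s) : HasSum a s := by
  have h1 : Summable fun x : ι × κ => g x.1 x.2 := by
    refine (_root_.summable_prod_of_nonneg fun x => (norm_nonneg _).trans (hg x.1 x.2)).2
      ⟨fun i => (hc i).summable, ?_⟩
    simpa only [(hc _).tsum_eq] using hc'
  have h2 : Summable fun x : ι × κ => f x.1 x.2 := Summable.of_norm_bounded h1 fun x => hg x.1 x.2
  have h3 : HasSum (fun x : ι × κ => f x.1 x.2) s := by
    have := h2.hasSum
    rwa [(this.prod_fiberwise hb).unique hs] at this
  have h4 : HasSum (fun x : κ × ι => f x.2 x.1) s := (Equiv.prodComm κ ι).hasSum_iff.2 h3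
  exact h4.prod_fiberwise ha

/-! ### Decomposition of a state into vectors -/

theorem exists_eq_star_mul_self {H : Type*} [NormedAddCommGroup H] [InnerProductSpace ℂ H]
    [CompleteSpace H] {a : H →L[ℂ] H} (h : 0 ≤ a) : ∃ b, a = star b * b :=
  CStarAlgebra.nonneg_iff_eq_star_mul_self.1 h

/-- The family `ψ` decomposes the operator of `ρ` as `∑ᵢ |ψᵢ⟩⟨ψᵢ|`. -/
structure Decomposes {n : ℕ} {ι : Type*} (ρ : State n) (ψ : ι → Fock n) : Prop where
  hasSum_norm_sq : HasSum (fun i => ‖ψ i‖ ^ 2) 1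
  hasSum_inner : ∀ v w, HasSum (fun i => inner ℂ w (ψ i) * inner ℂ (ψ i) v) (inner ℂ w (ρ.op v))

theorem hasSum_norm_sq_inner_numberState {n : ℕ} (v : Fock n) :
    HasSum (fun m => ‖inner ℂ (numberState m) v‖ ^ 2) (‖v‖ ^ 2) := by
  simpa only [inner_numberState] using hasSum_norm_sq v

/-- Write ρ = B*B and take ψᵢ = B*|i⟩; no diagonalisation is needed. Both ∑‖B*|i⟩‖² and ∑‖B|m⟩‖² sum
the squared matrix elements of B, and the latter sum is the trace of ρ. -/
theorem State.exists_decomposes {n : ℕ} (ρ : State n) :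
    ∃ ψ : (Fin n → ℕ) → Fock n, Decomposes ρ ψ := by
  obtain ⟨B, hB⟩ := exists_eq_star_mul_self
    ((ContinuousLinearMap.nonneg_iff_isPositive _).2 ρ.isPositive)
  have hB' : ∀ v w, inner ℂ w (ρ.op v) = inner ℂ (B w) (B v) := fun v w => by
    rw [hB, ContinuousLinearMap.star_eq_adjoint, mul_apply_eq_comp,
      ContinuousLinearMap.adjoint_inner_right]
  refine ⟨fun i => ContinuousLinearMap.adjoint B (numberState i), ?_, fun v w => ?_⟩
  · refine hasSum_swap_of_nonneg
      (f := fun i m => ‖inner ℂ (numberState i) (B (numberState m))‖ ^ 2)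
      (a := fun m => ‖B (numberState m)‖ ^ 2) (fun _ _ => by positivity)
      (fun m => hasSum_norm_sq_inner_numberState _) (fun i => ?_) ?_
    · refine hasSum_of_eq (hasSum_norm_sq_inner_numberState _) fun m => ?_
      rw [ContinuousLinearMap.adjoint_inner_right, ← inner_conj_symm, Complex.norm_conj]
    · have h := Complex.hasSum_re ρ.trace_eq_one
      refine hasSum_of_eq h fun m => ?_
      rw [hB', inner_self_eq_norm_sq_to_K]
      norm_cast
  · rw [hB']
    refine hasSum_of_eq (hasSum_inner_numberState (B w) (B v)) fun i => ?_
    rw [ContinuousLinearMap.adjoint_inner_right, ContinuousLinearMap.adjoint_inner_left]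

theorem exists_state_decomposes {n : ℕ} {ι : Type*} {ψ : ι → Fock n}
    (hψ : HasSum (fun i => ‖ψ i‖ ^ 2) 1) : ∃ ρ : State n, Decomposes ρ ψ := by
  have hs : Summable fun i => InnerProductSpace.rankOne ℂ (ψ i) (ψ i) := by
    refine Summable.of_norm ?_
    simpa only [InnerProductSpace.norm_rankOne, ← sq] using hψ.summable
  set T : Fock n →L[ℂ] Fock n := ∑' i, InnerProductSpace.rankOne ℂ (ψ i) (ψ i) with hT
  have hsum : ∀ v w, HasSum (fun i => inner ℂ w (ψ i) * inner ℂ (ψ i) v) (inner ℂ w (T v)) :=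
      fun v w => by
    have h := (hs.hasSum.mapL (ContinuousLinearMap.apply ℂ (Fock n) v)).mapL (innerSL ℂ w)
    refine hasSum_of_eq h fun i => ?_
    simp [mul_comm]
  have hself : ∀ v, HasSum (fun i => ((‖inner ℂ (ψ i) v‖ ^ 2 : ℝ) : ℂ)) (inner ℂ v (T v)) :=
      fun v => by
    refine hasSum_of_eq (hsum v v) fun i => ?_
    rw [← inner_conj_symm v (ψ i), Complex.conj_mul']
    push_cast; rfl
  have hre : ∀ v, HasSum (fun i => ‖inner ℂ (ψ i) v‖ ^ 2) (inner ℂ v (T v)).re := fun v => by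
    exact Complex.hasSum_re (hself v)
  have hreal : ∀ v, inner ℂ v (T v) = ((inner ℂ v (T v)).re : ℂ) := fun v =>
    (hself v).unique (Complex.hasSum_ofReal.2 (hre v))
  have hpos : T.IsPositive := by
    rw [ContinuousLinearMap.isPositive_iff_complex]
    intro v
    have h1 : inner ℂ (T v) v = ((inner ℂ v (T v)).re : ℂ) := by
      rw [← inner_conj_symm, hreal v, Complex.conj_ofReal]; rfl
    rw [h1]
    simp only [RCLike.re_eq_complex_re, Complex.ofReal_re, true_and]
    exact (hre v).nonneg fun i => by positivity
  have htr : HasSum (fun m => inner ℂ (numberState m) (T (numberState m))) 1 := by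
    have h := hasSum_swap_of_nonneg
      (f := fun m i => ‖inner ℂ (ψ i) (numberState m)‖ ^ 2) (fun _ _ => by positivity)
      (fun i => ?_) (fun m => hre (numberState m)) hψ
    · have h2 := Complex.hasSum_ofReal.2 h
      refine hasSum_of_eq (by simpa using h2) fun m => hreal _
    · refine hasSum_of_eq (hasSum_norm_sq_inner_numberState (ψ i)) fun m => ?_
      rw [← inner_conj_symm, Complex.norm_conj]
  exact ⟨⟨T, hpos, htr⟩, hψ, hsum⟩

/-! ### The `Q` function -/

variable {n : ℕ} {ι : Type*} {ρ : State n} {ψ : ι → Fock n}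

theorem Decomposes.hasSum_qFunction (h : Decomposes ρ ψ) (α : Fin n → ℂ) :
    HasSum (fun i => ‖inner ℂ (coherentState α) (ψ i)‖ ^ 2) (qFunction ρ α) := by
  have h1 := Complex.hasSum_re (h.hasSum_inner (coherentState α) (coherentState α))
  refine hasSum_of_eq h1 fun i => ?_
  rw [← inner_conj_symm (ψ i), Complex.mul_conj']
  norm_cast

theorem qFunction_nonneg (ρ : State n) (α : Fin n → ℂ) : 0 ≤ qFunction ρ α := by
  obtain ⟨ψ, hψ⟩ := ρ.exists_decomposes
  exact (hψ.hasSum_qFunction α).nonneg fun i => by positivity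

theorem qFunction_le_one (ρ : State n) (α : Fin n → ℂ) : qFunction ρ α ≤ 1 := by
  obtain ⟨ψ, hψ⟩ := ρ.exists_decomposes
  refine hasSum_le (fun i => ?_) (hψ.hasSum_qFunction α) hψ.hasSum_norm_sq
  have := norm_inner_le_norm (𝕜 := ℂ) (coherentState α) (ψ i)
  rw [norm_coherentState, one_mul] at this
  gcongr

theorem continuous_qFunction (ρ : State n) : Continuous (qFunction ρ) :=
  Complex.continuous_re.comp
    (continuous_coherentState.inner (ρ.op.continuous.comp continuous_coherentState))

theorem Decomposes.hasSum_integral [Countable ι] (h : Decomposes ρ ψ) {g : (Fin n → ℂ) → ℂ}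
    (hg : Continuous g) (hg1 : ∀ α, ‖g α‖ = 1) :
    HasSum (fun i => ∫ α, g α * ((‖inner ℂ (coherentState α) (ψ i)‖ ^ 2 : ℝ) : ℂ))
      (∫ α, g α * (qFunction ρ α : ℂ)) := by
  have hn : ∀ i α, ‖g α * ((‖inner ℂ (coherentState α) (ψ i)‖ ^ 2 : ℝ) : ℂ)‖ =
      ‖inner ℂ (coherentState α) (ψ i)‖ ^ 2 := fun i α => by
    rw [norm_mul, hg1, one_mul, Complex.norm_real, Real.norm_of_nonneg (by positivity)]
  have h1 := hasSum_integral_of_summable_integral_norm (μ := (volume : Measure (Fin n → ℂ)))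
    (F := fun i α => g α * ((‖inner ℂ (coherentState α) (ψ i)‖ ^ 2 : ℝ) : ℂ)) (fun i => ?_) ?_
  · have e : ∀ α, g α * (qFunction ρ α : ℂ) =
        ∑' i, g α * ((‖inner ℂ (coherentState α) (ψ i)‖ ^ 2 : ℝ) : ℂ) := fun α =>
      ((Complex.hasSum_ofReal.2 (h.hasSum_qFunction α)).mul_left (g α)).tsum_eq.symm
    simpa only [e] using h1
  · refine (integrable_norm_sq_inner (ψ i)).mono' ?_ (ae_of_all _ fun α => (hn i α).le)
    have := continuous_inner_coherentState (ψ i)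
    exact Continuous.aestronglyMeasurable (by fun_prop)
  · simp only [hn, integral_norm_sq_inner]
    exact h.hasSum_norm_sq.summable.mul_left _

theorem integral_qFunction (ρ : State n) : ∫ α, qFunction ρ α = Real.pi ^ n := by
  obtain ⟨ψ, hψ⟩ := ρ.exists_decomposes
  have h := hψ.hasSum_integral (g := fun _ => 1) continuous_const (by simp)
  simp only [one_mul, integral_complex_ofReal, integral_norm_sq_inner] at h
  have h2 := Complex.hasSum_ofReal.2 (hψ.hasSum_norm_sq.mul_left (Real.pi ^ n))
  have h3 := h.unique h2
  rw [mul_one] at h3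
  exact_mod_cast h3

theorem integrable_qFunction (ρ : State n) : Integrable (qFunction ρ) := by
  by_contra hc
  have h := integral_qFunction ρ
  rw [integral_undef hc] at h
  exact (pow_pos Real.pi_pos n).ne h

/-! ### The characteristic function -/

/-- This is cyclicity of the trace. The inequality 2ab ≤ a² + b² dominates the double series by the
Parseval series of ψᵢ and D*ψᵢ, which justifies the exchange of sums. -/
theorem Decomposes.hasSum_trace_mul (h : Decomposes ρ ψ) (D : Fock n →ₗᵢ[ℂ] Fock n) {s : ℂ}
    (hs : HasSum (fun i => inner ℂ (ψ i) (D (ψ i))) s) :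
    HasSum (fun m => inner ℂ (numberState m) (ρ.op (D (numberState m)))) s := by
  let A := ContinuousLinearMap.adjoint D.toContinuousLinearMap
  have hA : ∀ v w, inner ℂ v (D w) = inner ℂ (A v) w := fun v w => by
    rw [ContinuousLinearMap.adjoint_inner_left]; rfl
  have hAn : ∀ v, ‖A v‖ ≤ ‖v‖ := fun v => by
    refine (A.le_opNorm v).trans ?_
    have : ‖A‖ ≤ 1 := by
      rw [LinearIsometryEquiv.norm_map]
      exact D.norm_toContinuousLinearMap_le
    nlinarith [norm_nonneg v]
  refine hasSum_swap
    (f := fun i m => inner ℂ (numberState m) (ψ i) * inner ℂ (ψ i) (D (numberState m)))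
    (g := fun i m => (‖inner ℂ (numberState m) (ψ i)‖ ^ 2 +
      ‖inner ℂ (numberState m) (A (ψ i))‖ ^ 2) / 2)
    (b := fun i => inner ℂ (ψ i) (D (ψ i)))
    (c := fun i => (‖ψ i‖ ^ 2 + ‖A (ψ i)‖ ^ 2) / 2)
    (fun i m => ?_) (fun m => h.hasSum_inner _ _) (fun i => ?_) (fun i => ?_) ?_ hs
  · rw [norm_mul, hA, ← inner_conj_symm (A (ψ i)), Complex.norm_conj]
    nlinarith [sq_nonneg (‖inner ℂ (numberState m) (ψ i)‖ - ‖inner ℂ (numberState m) (A (ψ i))‖)]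
  · rw [hA]
    refine hasSum_of_eq (hasSum_inner_numberState (A (ψ i)) (ψ i)) fun m => ?_
    rw [hA, mul_comm]
  · exact ((hasSum_norm_sq_inner_numberState _).add (hasSum_norm_sq_inner_numberState _)).div_const _
  · refine Summable.of_nonneg_of_le (fun i => by positivity) (fun i => ?_) h.hasSum_norm_sq.summable
    have := hAn (ψ i)
    nlinarith [norm_nonneg (A (ψ i)), norm_nonneg (ψ i)]

/-- The symplectic Fourier transform. -/
def symplFourier (f : (Fin n → ℂ) → ℂ) (ξ : Fin n → ℂ) : ℂ :=
  ∫ α, Complex.exp (sympl ξ α) * f α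

theorem norm_exp_sympl (ξ α : Fin n → ℂ) : ‖Complex.exp (sympl ξ α)‖ = 1 := by
  simpa using norm_exp_mul_sympl 1 ξ α

/-- Sum `integral_conj_inner_mul_exp_sympl` with χ = ψ over a decomposition of ρ; the factor
e^{|ξ|²/2} undoes the antinormal ordering. -/
theorem charFunction_eq (ρ : State n) (ξ : Fin n → ℂ) :
    charFunction ρ ξ = (Real.exp (absSq ξ / 2) : ℂ) * ((1 / Real.pi ^ n : ℂ) *
      symplFourier (fun α => (qFunction ρ α : ℂ)) ξ) := by
  obtain ⟨ψ, hψ⟩ := ρ.exists_decomposes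
  have h1 := hψ.hasSum_integral (g := fun α => Complex.exp (sympl ξ α))
    (continuous_sympl ξ).cexp (norm_exp_sympl ξ)
  have hpi : (Real.pi : ℂ) ^ n ≠ 0 := pow_ne_zero _ (by exact_mod_cast Real.pi_ne_zero)
  have h2 : HasSum (fun i => inner ℂ (ψ i) (displacement ξ (ψ i)))
      ((Real.exp (absSq ξ / 2) : ℂ) * ((1 / Real.pi ^ n : ℂ) *
      symplFourier (fun α => (qFunction ρ α : ℂ)) ξ)) := by
    refine hasSum_of_eq ((h1.mul_left (1 / Real.pi ^ n : ℂ)).mul_left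
      (Real.exp (absSq ξ / 2) : ℂ)) fun i => ?_
    have e : ∀ α, Complex.exp (sympl ξ α) * ((‖inner ℂ (coherentState α) (ψ i)‖ ^ 2 : ℝ) : ℂ) =
        conj (inner ℂ (coherentState α) (ψ i)) *
          (Complex.exp (sympl ξ α) * inner ℂ (coherentState α) (ψ i)) := fun α => by
      rw [mul_left_comm, Complex.conj_mul']; push_cast; rfl
    simp only [e]
    rw [integral_conj_inner_mul_exp_sympl, mul_left_comm _ (Real.exp (-absSq ξ / 2) : ℂ),
      ← mul_assoc (Real.exp (absSq ξ / 2) : ℂ), ← Complex.ofReal_mul, ← Real.exp_add,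
      ← mul_assoc (1 / Real.pi ^ n : ℂ), one_div_mul_cancel hpi]
    simp [neg_div]
  have h3 := hψ.hasSum_trace_mul (displacement ξ) h2
  simp only [displacement_numberState] at h3
  exact h3.tsum_eq

/-! ### The uncertainty inequality -/

theorem Decomposes.norm_sq_le_qFunction (h : Decomposes ρ ψ) (i : ι) (α : Fin n → ℂ) :
    ‖inner ℂ (coherentState α) (ψ i)‖ ^ 2 ≤ qFunction ρ α :=
  le_hasSum (h.hasSum_qFunction α) i fun _ _ => by positivity

theorem integrable_norm_sq_affine_mul (hρ : HasFiniteSecondMoments ρ) (u v : Fin n → ℂ) (s : ℂ) :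
    Integrable fun α : Fin n → ℂ =>
      ‖∑ j, u j * α j + ∑ j, v j * conj (α j) + s‖ ^ 2 * qFunction ρ α := by
  -- There are 2n + 1 summands inside the norm, and the squared norm of their sum is at most 2n + 1
  -- times the sum of their squared norms.
  have hb : Integrable fun α : Fin n → ℂ => ((2 * n + 1 : ℝ) *
      (∑ j, (‖u j‖ ^ 2 * (‖α j‖ ^ 2 * qFunction ρ α)) +
        ∑ j, (‖v j‖ ^ 2 * (‖α j‖ ^ 2 * qFunction ρ α)) + ‖s‖ ^ 2 * qFunction ρ α)) :=
    (((integrable_finsetSum _ fun j _ => (hρ j).const_mul _).add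
      (integrable_finsetSum _ fun j _ => (hρ j).const_mul _)).add
      ((integrable_qFunction ρ).const_mul _)).const_mul _
  have hc := continuous_qFunction ρ
  refine hb.mono' (Continuous.aestronglyMeasurable (by fun_prop)) (ae_of_all _ fun α => ?_)
  have hq := qFunction_nonneg ρ α
  rw [Real.norm_of_nonneg (by positivity)]
  have e : ((2 * n + 1 : ℝ) *
      (∑ j, (‖u j‖ ^ 2 * (‖α j‖ ^ 2 * qFunction ρ α)) +
        ∑ j, (‖v j‖ ^ 2 * (‖α j‖ ^ 2 * qFunction ρ α)) + ‖s‖ ^ 2 * qFunction ρ α)) =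
      (2 * n + 1 : ℝ) * (∑ j, ‖u j * α j‖ ^ 2 + ∑ j, ‖v j * conj (α j)‖ ^ 2 + ‖s‖ ^ 2) *
        qFunction ρ α := by
    simp only [norm_mul, mul_pow, Complex.norm_conj, ← mul_assoc, ← Finset.sum_mul, ← add_mul]
  rw [e]
  gcongr
  have hsum : ∑ j, u j * α j + ∑ j, v j * conj (α j) + s = ∑ x : (Fin n ⊕ Fin n) ⊕ Unit,
      Sum.elim (Sum.elim (fun j => u j * α j) fun j => v j * conj (α j)) (fun _ => s) x := by
    simp
  have hsq : ∑ j, ‖u j * α j‖ ^ 2 + ∑ j, ‖v j * conj (α j)‖ ^ 2 + ‖s‖ ^ 2 =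
      ∑ x : (Fin n ⊕ Fin n) ⊕ Unit, ‖Sum.elim (Sum.elim (fun j => u j * α j)
        fun j => v j * conj (α j)) (fun _ => s) x‖ ^ 2 := by
    simp
  rw [hsum, hsq]
  calc _ ≤ (∑ x : (Fin n ⊕ Fin n) ⊕ Unit, ‖Sum.elim (Sum.elim (fun j => u j * α j)
        fun j => v j * conj (α j)) (fun _ => s) x‖) ^ 2 := by
        gcongr
        exact norm_sum_le _ _
    _ ≤ _ := by
        refine sq_sum_le_card_mul_sum_sq.trans_eq ?_
        congr 1
        simp
        ring

/-- Both sides are additive over a decomposition of ρ. Finite partial sums suffice, as they are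
bounded by the Q function. -/
theorem uncertainty (hρ : HasFiniteSecondMoments ρ) (u v : Fin n → ℂ) (s : ℂ) :
    absSq u * Real.pi ^ n ≤
      ∫ α : Fin n → ℂ, ‖∑ j, u j * α j + ∑ j, v j * conj (α j) + s‖ ^ 2 * qFunction ρ α := by
  obtain ⟨ψ, hψ⟩ := ρ.exists_decomposes
  have hψ2 : ∀ i j, Integrable fun α : Fin n → ℂ =>
      ‖α j‖ ^ 2 * ‖inner ℂ (coherentState α) (ψ i)‖ ^ 2 := fun i j => by
    refine (hρ j).mono' ?_ (ae_of_all _ fun α => ?_)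
    · have := continuous_inner_coherentState (ψ i)
      exact Continuous.aestronglyMeasurable (by fun_prop)
    · rw [Real.norm_of_nonneg (by positivity)]
      gcongr
      exact hψ.norm_sq_le_qFunction i α
  have hint := integrable_norm_sq_affine_mul hρ u v s
  have hint' : ∀ i, Integrable fun α : Fin n → ℂ =>
      ‖∑ j, u j * α j + ∑ j, v j * conj (α j) + s‖ ^ 2 *
        ‖inner ℂ (coherentState α) (ψ i)‖ ^ 2 := fun i => by
    refine hint.mono' ?_ (ae_of_all _ fun α => ?_)
    · have := continuous_inner_coherentState (ψ i)
      exact Continuous.aestronglyMeasurable (by fun_prop)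
    · rw [Real.norm_of_nonneg (by positivity)]
      gcongr
      exact hψ.norm_sq_le_qFunction i α
  have hsum := hψ.hasSum_norm_sq.mul_left (absSq u * Real.pi ^ n)
  rw [mul_one] at hsum
  refine hasSum_le_of_sum_le hsum fun S => ?_
  calc ∑ i ∈ S, absSq u * Real.pi ^ n * ‖ψ i‖ ^ 2
      ≤ ∑ i ∈ S, ∫ α : Fin n → ℂ, ‖∑ j, u j * α j + ∑ j, v j * conj (α j) + s‖ ^ 2 *
        ‖inner ℂ (coherentState α) (ψ i)‖ ^ 2 := by
        refine Finset.sum_le_sum fun i _ => ?_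
        rw [mul_assoc]
        exact uncertainty_vector (hψ2 i) u v s
    _ = ∫ α : Fin n → ℂ, ∑ i ∈ S, ‖∑ j, u j * α j + ∑ j, v j * conj (α j) + s‖ ^ 2 *
        ‖inner ℂ (coherentState α) (ψ i)‖ ^ 2 := (integral_finsetSum _ fun i _ => hint' i).symm
    _ ≤ _ := by
        refine integral_mono (integrable_finsetSum _ fun i _ => hint' i) hint fun α => ?_
        simp only [← Finset.mul_sum]
        gcongr
        exact sum_le_hasSum S (fun _ _ => by positivity) (hψ.hasSum_qFunction α)

/-! ### The `Q` function determines the state -/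

/-- Without their Gaussian factors, kets are holomorphic and bras antiholomorphic in the label.
Matrix elements are therefore determined by the diagonal: along a suitable complex line they form an
entire function of t that vanishes for real t. -/
theorem eq_zero_of_inner_coherentState_self {T : Fock n →L[ℂ] Fock n}
    (h : ∀ α, inner ℂ (coherentState α) (T (coherentState α)) = 0) : T = 0 := by
  let ket : (Fin n → ℂ) → Fock n := fun z => ∑' m, monomialFun m z • numberState m
  let bra : (Fin n → ℂ) → Fock n →L[ℂ] ℂ := fun z =>
    ∑' m, monomialFun m z • innerSL ℂ (numberState m)
  have hket : ∀ z, coherentState z = (Real.exp (-absSq z / 2) : ℂ) • ket z := fun z => by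
    have h1 : Summable fun m => monomialFun m z • (numberState m : Fock n) := by
      refine Summable.of_norm ?_
      simpa only [norm_smul, norm_numberState, mul_one] using summable_norm_monomialFun z
    refine (hasSum_numberState (coherentState z)).unique ?_
    refine hasSum_of_eq (h1.hasSum.const_smul (Real.exp (-absSq z / 2) : ℂ)) fun m => ?_
    rw [coherentState_apply, mul_smul]
  have hn : ∀ m : Fin n → ℕ, ‖innerSL ℂ (numberState m : Fock n)‖ ≤ 1 := fun m => by
    rw [innerSL_apply_norm, norm_numberState]
  have hbra : ∀ α v, inner ℂ (coherentState α) v =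
      (Real.exp (-absSq α / 2) : ℂ) * bra (star α) v := fun α v => by
    have h1 : Summable fun m => monomialFun m (star α) • innerSL ℂ (numberState m : Fock n) := by
      refine Summable.of_norm_bounded (summable_norm_monomialFun (star α)) fun m => ?_
      rw [norm_smul]
      exact mul_le_of_le_one_right (norm_nonneg _) (hn m)
    rw [inner_coherentState]
    congr 1
    refine (hasSum_bargmann v (star α)).unique ?_
    refine hasSum_of_eq (h1.hasSum.mapL (ContinuousLinearMap.apply ℂ ℂ v)) fun m => ?_
    simp [inner_numberState]
  have hdiag : ∀ α, bra (star α) (T (ket α)) = 0 := fun α => by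
    have h1 := h α
    rw [hbra, hket, map_smul, map_smul, smul_eq_mul] at h1
    have h0 : (Real.exp (-absSq α / 2) : ℂ) ≠ 0 := by exact_mod_cast (Real.exp_pos _).ne'
    simpa [h0] using h1
  have hoff : ∀ α β, bra (star β) (T (ket α)) = 0 := fun α β => by
    -- These satisfy p + iq = α and p - iq = β, so t = i gives the matrix element between α and β,
    -- while real t stays on the diagonal.
    let p : Fin n → ℂ := (1 / 2 : ℂ) • (α + β)
    let q : Fin n → ℂ := (1 / (2 * Complex.I) : ℂ) • (α - β)
    let F : ℂ → ℂ := fun t => bra (star p + t • star q) (T (ket (p + t • q)))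
    have hF : Differentiable ℂ F :=
      (differentiable_tsum_monomialFun _ hn (star p) (star q)).clm_apply
        (T.differentiable.comp (differentiable_tsum_monomialFun _
          (fun m => (norm_numberState m).le) p q))
    have hreal : ∀ t : ℝ, F t = 0 := fun t => by
      have h1 := hdiag (p + (t : ℂ) • q)
      rw [star_add p, star_smul (t : ℂ) q, RCLike.star_def, Complex.conj_ofReal] at h1
      exact h1
    have hzero : F = fun _ => 0 := by
      refine AnalyticOnNhd.eq_of_frequently_eq (𝕜 := ℂ) (z₀ := 0)
        (hF.differentiableOn.analyticOnNhd isOpen_univ) analyticOnNhd_const ?_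
      have ht : Tendsto (fun t : ℝ => (t : ℂ)) (𝓝[≠] 0) (𝓝[≠] 0) := by
        refine tendsto_nhdsWithin_of_tendsto_nhds_of_eventually_within _ ?_ ?_
        · exact (Complex.continuous_ofReal.tendsto' 0 0 (by simp)).mono_left nhdsWithin_le_nhds
        · filter_upwards [self_mem_nhdsWithin] with t ht
          simpa using ht
      exact ht.frequently (Frequently.of_forall hreal)
    have hI := congrFun hzero Complex.I
    have e1 : p + Complex.I • q = α := by
      funext j
      simp only [p, q, Pi.add_apply, Pi.smul_apply, Pi.sub_apply, smul_eq_mul]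
      field_simp
      ring
    have e2 : star p + Complex.I • star q = star β := by
      funext j
      simp only [p, q, Pi.add_apply, Pi.smul_apply, Pi.sub_apply, Pi.star_apply, smul_eq_mul,
        RCLike.star_def, map_mul, map_add, map_sub, map_div₀, map_one, Complex.conj_I,
        Complex.conj_ofNat]
      field_simp
      ring
    simp only [F, e1, e2] at hI
    exact hI
  have hT : ∀ α, T (coherentState α) = 0 := fun α =>
    eq_zero_of_inner_coherentState fun β => by
      rw [hbra, hket, map_smul, map_smul, hoff, smul_zero, mul_zero]
  have hadj : ContinuousLinearMap.adjoint T = 0 := by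
    ext1 v
    refine eq_zero_of_inner_coherentState fun α => ?_
    rw [ContinuousLinearMap.adjoint_inner_right, hT, inner_zero_left]
  rw [← ContinuousLinearMap.adjoint_adjoint T, hadj, map_zero]

theorem State.eq_of_qFunction_eq {ρ σ : State n} (h : ∀ α, qFunction ρ α = qFunction σ α) :
    ρ = σ := by
  have hr : ∀ (τ : State n) α, inner ℂ (coherentState α) (τ.op (coherentState α)) =
      (qFunction τ α : ℂ) := fun τ α => by
    obtain ⟨ψ, hψ⟩ := τ.exists_decomposes
    refine (hψ.hasSum_inner (coherentState α) (coherentState α)).unique ?_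
    refine hasSum_of_eq (Complex.hasSum_ofReal.2 (hψ.hasSum_qFunction α)) fun i => ?_
    rw [← inner_conj_symm (ψ i), Complex.mul_conj']
    push_cast; rfl
  refine State.ext (sub_eq_zero.1 (eq_zero_of_inner_coherentState_self fun α => ?_))
  rw [sub_apply, inner_sub_right, hr, hr, h, sub_self]

end

/-! ### Quadratic forms and the symplectic Fourier transform -/

section

/-! ### Change of variables -/

/-- Uniqueness of Haar measure up to a factor. Only positivity of the Jacobian is needed below,
since normalisation of Q or Fourier inversion absorbs its value. -/
theorem exists_integral_comp_eq {E F : Type*} [NormedAddCommGroup E] [NormedSpace ℝ E]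
    [MeasurableSpace E] [BorelSpace E] [NormedAddCommGroup F]
    [NormedSpace ℝ F] [FiniteDimensional ℝ F] [MeasurableSpace F] [BorelSpace F]
    (μ : Measure E) [μ.IsAddHaarMeasure] (ν : Measure F) [ν.IsAddHaarMeasure] (S : E ≃L[ℝ] F) :
    ∃ κ : ℝ, 0 < κ ∧
      (∀ {G : Type} [NormedAddCommGroup G] [NormedSpace ℝ G] (g : F → G),
        ∫ x, g (S x) ∂μ = κ • ∫ y, g y ∂ν) ∧
      (∀ {G : Type} [NormedAddCommGroup G] (g : F → G),
        Integrable (fun x => g (S x)) μ ↔ Integrable g ν) := by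
  have := ContinuousLinearEquiv.isAddHaarMeasure_map S μ
  have hS : MeasurableEmbedding S := S.toHomeomorph.measurableEmbedding
  set c := Measure.addHaarScalarFactor (μ.map S) ν with hc
  have hmap : μ.map S = c • ν := Measure.isAddLeftInvariant_eq_smul _ _
  have hpos : 0 < c := Measure.addHaarScalarFactor_pos_of_isAddHaarMeasure _ _
  refine ⟨c, hpos, fun g => ?_, fun g => ?_⟩
  · rw [← hS.integral_map, hmap, integral_smul_nnreal_measure]
    rfl
  · have h := hS.integrable_map_iff (μ := μ) (g := g)
    rw [hmap] at h
    exact h.symm.trans (integrable_smul_measure (c := (c : ENNReal))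
      (by exact_mod_cast hpos.ne') ENNReal.coe_ne_top)

variable {n : ℕ}

theorem exists_integral_comp_linearEquiv {ι : Type*} [Fintype ι]
    (T : (Fin n → ℂ) ≃ₗ[ℝ] (ι → ℝ)) : ∃ κ : ℝ, 0 < κ ∧
      (∀ {G : Type} [NormedAddCommGroup G] [NormedSpace ℝ G] (g : (ι → ℝ) → G),
        ∫ x, g (T x) = κ • ∫ y, g y) ∧
      (∀ {G : Type} [NormedAddCommGroup G] (g : (ι → ℝ) → G),
        Integrable (fun x => g (T x)) ↔ Integrable g) :=
  exists_integral_comp_eq volume volume T.toContinuousLinearEquiv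

/-! ### Sums of squares -/

/-- The quadratic form `x ↦ ∑ᵢ (L x)ᵢ²`. -/
def sumSq {ι V : Type*} [Fintype ι] [AddCommGroup V] [Module ℝ V] (L : V →ₗ[ℝ] (ι → ℝ)) :
    QuadraticForm ℝ V :=
  (QuadraticMap.weightedSumSquares ℝ (fun _ : ι => (1 : ℝ))).comp L

theorem sumSq_apply {ι V : Type*} [Fintype ι] [AddCommGroup V] [Module ℝ V]
    (L : V →ₗ[ℝ] (ι → ℝ)) (x : V) : sumSq L x = ∑ i, L x i ^ 2 := by
  simp [sumSq, QuadraticMap.weightedSumSquares_apply, sq]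

theorem sumSq_posDef {ι V : Type*} [Fintype ι] [AddCommGroup V] [Module ℝ V]
    (T : V ≃ₗ[ℝ] (ι → ℝ)) : (sumSq (T : V →ₗ[ℝ] (ι → ℝ))).PosDef := by
  intro x hx
  rw [sumSq_apply]
  have h : T x ≠ 0 := by simpa using hx
  obtain ⟨i, hi⟩ := Function.ne_iff.1 h
  exact Finset.sum_pos' (fun _ _ => sq_nonneg _) ⟨i, Finset.mem_univ i, sq_pos_of_ne_zero hi⟩

/-- A positive definite quadratic form is a sum of squares of coordinates. -/
theorem exists_linearEquiv_of_posDef {V : Type*} [AddCommGroup V] [Module ℝ V]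
    [FiniteDimensional ℝ V] {q : QuadraticForm ℝ V} (hq : q.PosDef) :
    ∃ T : V ≃ₗ[ℝ] (Fin (Module.finrank ℝ V) → ℝ), ∀ x, q x = ∑ i, T x i ^ 2 := by
  obtain ⟨w, ⟨e⟩⟩ := QuadraticForm.equivalent_weightedSumSquares q
  have he : ∀ x, q x = ∑ i, w i * (e x i * e x i) := fun x => by
    rw [← e.map_app x, QuadraticMap.weightedSumSquares_apply]
    simp
  have hw : ∀ i, 0 < w i := fun i => by
    have h1 : e.toLinearEquiv.symm (Pi.single i 1) ≠ 0 := by simp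
    have h2 := hq _ h1
    have h3 : e (e.toLinearEquiv.symm (Pi.single i 1)) = Pi.single i 1 :=
      e.toLinearEquiv.apply_symm_apply _
    rw [he, h3] at h2
    simpa [Pi.single_apply] using h2
  refine ⟨e.toLinearEquiv.trans (LinearEquiv.piCongrRight fun i =>
    LinearEquiv.smulOfNeZero ℝ ℝ (Real.sqrt (w i)) (Real.sqrt_pos.2 (hw i)).ne'), fun x => ?_⟩
  rw [he]
  refine Finset.sum_congr rfl fun i _ => ?_
  change _ = (Real.sqrt (w i) * e x i) ^ 2
  rw [mul_pow, Real.sq_sqrt (hw i).le, sq]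

/-! ### The symplectic form -/

/-- The real symplectic form `ω(ξ, α) = Im ∑ⱼ (ξⱼ αⱼ* - ξⱼ* αⱼ)`. -/
def symplForm (n : ℕ) : (Fin n → ℂ) →ₗ[ℝ] (Fin n → ℂ) →ₗ[ℝ] ℝ :=
  LinearMap.mk₂ ℝ (fun ξ α => (sympl ξ α).im)
    (fun ξ ζ α => by
      rw [← Complex.add_im]
      simp only [sympl, ← Finset.sum_add_distrib, Pi.add_apply, map_add]
      congr 1
      exact Finset.sum_congr rfl fun j _ => by ring)
    (fun c ξ α => by
      have : sympl (c • ξ) α = c * sympl ξ α := by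
        simp only [sympl, Finset.mul_sum, Pi.smul_apply, Complex.real_smul, map_mul,
          Complex.conj_ofReal]
        exact Finset.sum_congr rfl fun j _ => by ring
      rw [this]; simp)
    (fun ξ α β => by rw [sympl_add_right, Complex.add_im])
    (fun c ξ α => by
      have : sympl ξ (c • α) = c * sympl ξ α := by
        simp only [sympl, Finset.mul_sum, Pi.smul_apply, Complex.real_smul, map_mul,
          Complex.conj_ofReal]
        exact Finset.sum_congr rfl fun j _ => by ring
      rw [this]; simp)

theorem sympl_eq_symplForm (ξ α : Fin n → ℂ) : sympl ξ α = (symplForm n ξ α : ℂ) * Complex.I := by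
  apply Complex.ext
  · simp [sympl_re]
  · simp [symplForm]

theorem sympl_swap (ξ α : Fin n → ℂ) : sympl ξ α = -sympl α ξ := by
  simp only [sympl, ← Finset.sum_neg_distrib]
  exact Finset.sum_congr rfl fun j _ => by ring

theorem sympl_add_left (ξ ζ α : Fin n → ℂ) : sympl (ξ + ζ) α = sympl ξ α + sympl ζ α := by
  rw [sympl_swap, sympl_add_right, sympl_swap ξ, sympl_swap ζ]; ring

theorem sympl_sub_left (ξ ζ α : Fin n → ℂ) : sympl (ξ - ζ) α = sympl ξ α - sympl ζ α := by
  rw [sub_eq_add_neg, sympl_add_left, sympl_neg_left, sub_eq_add_neg]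

theorem symplForm_swap (ξ α : Fin n → ℂ) : symplForm n ξ α = -symplForm n α ξ := by
  have := congrArg Complex.im (sympl_swap ξ α)
  simpa [sympl_eq_symplForm] using this

/-- Pairing ξ with -iξ gives 2i|ξ|². -/
theorem eq_zero_of_symplForm (ξ : Fin n → ℂ) (h : ∀ α, symplForm n ξ α = 0) : ξ = 0 := by
  have h1 : sympl ξ (-Complex.I • ξ) = 2 * Complex.I * absSq ξ := by
    rw [← sum_mul_conj_self, Finset.mul_sum, sympl]
    refine Finset.sum_congr rfl fun j _ => ?_
    simp only [Pi.smul_apply, smul_eq_mul, map_mul, map_neg, Complex.conj_I]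
    ring
  rw [sympl_eq_symplForm, h, Complex.ofReal_zero, zero_mul] at h1
  have h2 : absSq ξ = 0 := by
    have : (absSq ξ : ℂ) = 0 := by
      have hI : (2 * Complex.I : ℂ) ≠ 0 := by simp
      exact (mul_eq_zero.1 h1.symm).resolve_left hI
    exact_mod_cast this
  funext j
  have h3 := (Finset.sum_eq_zero_iff_of_nonneg fun j _ => by positivity).1 h2 j (Finset.mem_univ j)
  simpa using h3

/-- The coordinates `½ ω(·, bᵢ)`, where `bᵢ` is the basis with coordinates `T`. -/
def dualCoord {ι : Type*} [Fintype ι] [DecidableEq ι] (T : (Fin n → ℂ) ≃ₗ[ℝ] (ι → ℝ)) :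
    (Fin n → ℂ) ≃ₗ[ℝ] (ι → ℝ) :=
  LinearMap.linearEquivOfInjective
    (LinearMap.pi fun i => (1 / 2 : ℝ) • (symplForm n).flip (T.symm (Pi.single i 1)))
    ((injective_iff_map_eq_zero _).2 fun ξ hξ => by
      refine eq_zero_of_symplForm ξ fun α => ?_
      have h1 : ∀ i, symplForm n ξ (T.symm (Pi.single i 1)) = 0 := fun i => by
        have := congrFun hξ i
        simpa using this
      have h2 : α = ∑ i, T α i • T.symm (Pi.single i 1) := by
        apply T.injective
        rw [map_sum]
        simp only [map_smul, LinearEquiv.apply_symm_apply]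
        funext k
        simp [Pi.single_apply]
      rw [h2, map_sum]
      exact Finset.sum_eq_zero fun i _ => by rw [map_smul, h1, smul_zero])
    T.finrank_eq

theorem dualCoord_apply {ι : Type*} [Fintype ι] [DecidableEq ι] (T : (Fin n → ℂ) ≃ₗ[ℝ] (ι → ℝ))
    (ξ : Fin n → ℂ) (i : ι) :
    dualCoord T ξ i = 1 / 2 * symplForm n ξ (T.symm (Pi.single i 1)) := by
  simp [dualCoord]

theorem eq_sum_coord {ι : Type*} [Fintype ι] [DecidableEq ι] (T : (Fin n → ℂ) ≃ₗ[ℝ] (ι → ℝ))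
    (α : Fin n → ℂ) : α = ∑ i, T α i • T.symm (Pi.single i 1) := by
  apply T.injective
  rw [map_sum]
  simp only [map_smul, LinearEquiv.apply_symm_apply]
  funext k
  simp [Pi.single_apply]

theorem symplForm_eq_sum_dualCoord {ι : Type*} [Fintype ι] [DecidableEq ι]
    (T : (Fin n → ℂ) ≃ₗ[ℝ] (ι → ℝ)) (ξ α : Fin n → ℂ) :
    symplForm n ξ α = ∑ i, 2 * dualCoord T ξ i * T α i := by
  conv_lhs => rw [eq_sum_coord T α]
  rw [map_sum]
  refine Finset.sum_congr rfl fun i _ => ?_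
  rw [map_smul, dualCoord_apply, smul_eq_mul]; ring

/-! ### Fourier transforms of Gaussian functions -/

theorem integrable_gaussian {ι : Type*} [Fintype ι] (T : (Fin n → ℂ) ≃ₗ[ℝ] (ι → ℝ)) :
    Integrable fun x : Fin n → ℂ => (Real.exp (-∑ i, T x i ^ 2) : ℂ) := by
  obtain ⟨κ, -, -, h⟩ := exists_integral_comp_linearEquiv T
  refine (h fun y : ι → ℝ => (Real.exp (-∑ i, y i ^ 2) : ℂ)).2 ?_
  have := GaussianFourier.integrable_cexp_neg_mul_sum_add (ι := ι) (b := 1) (by simp) 0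
  refine this.congr (ae_of_all _ fun y => ?_)
  simp

/-- In the coordinates y = T(x) the pairing is 2i ∑ dualCoordᵢ yᵢ, and the Fourier integral of
e^{-∑yᵢ²} is standard. The factor 1/2 in `dualCoord` is what leaves the exponent free of constants.
-/
theorem exists_symplFourier_gaussian {ι : Type*} [Fintype ι] [DecidableEq ι]
    (T : (Fin n → ℂ) ≃ₗ[ℝ] (ι → ℝ)) : ∃ C : ℝ, 0 < C ∧ ∀ ξ,
      symplFourier (fun x => (Real.exp (-∑ i, T x i ^ 2) : ℂ)) ξ =
        (C : ℂ) * (Real.exp (-∑ i, dualCoord T ξ i ^ 2) : ℂ) := by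
  obtain ⟨κ, hκ, h, -⟩ := exists_integral_comp_linearEquiv T
  refine ⟨κ * Real.pi ^ ((Fintype.card ι : ℝ) / 2), mul_pos hκ (Real.rpow_pos_of_pos Real.pi_pos _),
    fun ξ => ?_⟩
  have e : ∀ x, Complex.exp (sympl ξ x) * (Real.exp (-∑ i, T x i ^ 2) : ℂ) =
      (fun y : ι → ℝ => Complex.exp (-1 * ∑ i, (y i : ℂ) ^ 2 +
        ∑ i, (2 * Complex.I * dualCoord T ξ i) * y i)) (T x) := fun x => by
    rw [sympl_eq_symplForm, symplForm_eq_sum_dualCoord T, Complex.ofReal_exp, ← Complex.exp_add]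
    congr 1
    push_cast
    rw [Finset.sum_mul, add_comm]
    congr 1
    · ring
    · exact Finset.sum_congr rfl fun i _ => by ring
  rw [symplFourier]
  simp only [e]
  rw [h (fun y : ι → ℝ => Complex.exp (-1 * ∑ i, (y i : ℂ) ^ 2 +
        ∑ i, (2 * Complex.I * dualCoord T ξ i) * y i)),
    GaussianFourier.integral_cexp_neg_mul_sum_add (by simp), Complex.real_smul]
  have e2 : (∑ i, (2 * Complex.I * (dualCoord T ξ i : ℂ)) ^ 2) / (4 * 1) =
      ((-∑ i, dualCoord T ξ i ^ 2 : ℝ) : ℂ) := by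
    push_cast
    rw [← Finset.sum_neg_distrib, Finset.sum_div]
    refine Finset.sum_congr rfl fun i _ => ?_
    rw [mul_pow, mul_pow, Complex.I_sq]; ring
  rw [e2, Complex.ofReal_exp, div_one]
  push_cast
  rw [Complex.ofReal_cpow Real.pi_pos.le]
  push_cast
  ring

theorem symplFourier_translate (f : (Fin n → ℂ) → ℂ) (μ ξ : Fin n → ℂ) :
    symplFourier (fun x => f (x - μ)) ξ = Complex.exp (sympl ξ μ) * symplFourier f ξ := by
  have h := integral_sub_right_eq_self (μ := (volume : Measure (Fin n → ℂ)))
    (fun x => Complex.exp (sympl ξ (x + μ)) * f x) μ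
  simp only [sub_add_cancel] at h
  rw [symplFourier, symplFourier, h, ← integral_const_mul]
  refine integral_congr_ae (ae_of_all _ fun x => ?_)
  simp only [sympl_add_right, Complex.exp_add]
  ring

theorem symplFourier_modulate (f : (Fin n → ℂ) → ℂ) (μ α : Fin n → ℂ) :
    symplFourier (fun ξ => Complex.exp (sympl ξ μ) * f ξ) α = symplFourier f (α - μ) := by
  refine integral_congr_ae (ae_of_all _ fun ξ => ?_)
  simp only [sympl_sub_left, sympl_swap ξ μ, ← mul_assoc, ← Complex.exp_add, ← sub_eq_add_neg]

theorem symplFourier_const_mul (c : ℂ) (f : (Fin n → ℂ) → ℂ) (ξ : Fin n → ℂ) :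
    symplFourier (fun x => c * f x) ξ = c * symplFourier f ξ := by
  rw [symplFourier, symplFourier, ← integral_const_mul]
  refine integral_congr_ae (ae_of_all _ fun x => ?_)
  simp only []
  ring

theorem integrable_exp_sympl_mul_iff (f : (Fin n → ℂ) → ℂ) (ξ : Fin n → ℂ) :
    Integrable (fun x => Complex.exp (sympl ξ x) * f x) ↔ Integrable f := by
  have hc := (continuous_sympl ξ).cexp
  have hc' := (continuous_sympl ξ).neg.cexp
  constructor <;> intro h
  · refine (h.bdd_mul (c := 1) hc'.aestronglyMeasurable (ae_of_all _ fun x => ?_)).congr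
      (ae_of_all _ fun x => ?_)
    · rw [Pi.neg_apply, ← sympl_neg_left, norm_exp_sympl]
    · simp only [← mul_assoc, ← Complex.exp_add]
      simp
  · exact h.bdd_mul (c := 1) hc.aestronglyMeasurable
      (ae_of_all _ fun x => (norm_exp_sympl ξ x).le)

theorem integrable_exp_sympl_mul_iff' (f : (Fin n → ℂ) → ℂ) (μ : Fin n → ℂ) :
    Integrable (fun ξ => Complex.exp (sympl ξ μ) * f ξ) ↔ Integrable f := by
  rw [← integrable_exp_sympl_mul_iff f (-μ)]
  simp only [sympl_neg_left, sympl_swap _ μ]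

theorem continuous_symplFourier {f : (Fin n → ℂ) → ℂ} (hf : Integrable f) :
    Continuous (symplFourier f) := by
  refine continuous_of_dominated (bound := fun x => ‖f x‖) (fun ξ => ?_) (fun ξ => ?_) hf.norm ?_
  · exact ((integrable_exp_sympl_mul_iff f ξ).2 hf).aestronglyMeasurable
  · exact ae_of_all _ fun x => by rw [norm_mul, norm_exp_sympl, one_mul]
  · refine ae_of_all _ fun x => ?_
    simp only [sympl_swap _ x]
    exact ((continuous_sympl x).neg.cexp).mul continuous_const

/-! ### Fourier inversion -/

/-- Inversion is transported from Euclidean Fourier analysis. Since `sympl` is antisymmetric,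
exchanging its arguments supplies the sign of the inverse transform, so the symplectic transform
inverts itself up to a constant. -/
theorem exists_symplFourier_inversion (n : ℕ) : ∃ K : ℝ, 0 < K ∧
    ∀ f : (Fin n → ℂ) → ℂ, Continuous f → Integrable f → Integrable (symplFourier f) →
      ∀ α, f α = (K : ℂ) * symplFourier (symplFourier f) α := by
  let E := PiLp 2 (fun _ : Fin n => ℂ)
  let S : E ≃L[ℝ] (Fin n → ℂ) := PiLp.continuousLinearEquiv 2 ℝ (fun _ : Fin n => ℂ)
  -- The factor i/π turns the phase -2π⟨v, Aξ⟩ of the Euclidean transform into the symplectic form.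
  let R : (Fin n → ℂ) ≃L[ℝ] (Fin n → ℂ) :=
    (ContinuousLinearEquiv.smulLeft (Units.mk0 (Complex.I / Real.pi) (by
      simp [Real.pi_ne_zero])) : (Fin n → ℂ) ≃L[ℂ] (Fin n → ℂ)).restrictScalars ℝ
  let A : (Fin n → ℂ) ≃L[ℝ] E := R.trans S.symm
  obtain ⟨κ₁, h1, hi1, hj1⟩ := exists_integral_comp_eq (volume : Measure E)
    (volume : Measure (Fin n → ℂ)) S
  obtain ⟨κ₂, h2, hi2, hj2⟩ := exists_integral_comp_eq (volume : Measure (Fin n → ℂ))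
    (volume : Measure E) A
  have hA : ∀ (ξ : Fin n → ℂ) (v : E), sympl ξ (S v) =
      ((-2 * Real.pi * inner ℝ v (A ξ) : ℝ) : ℂ) * Complex.I := fun ξ v => by
    rw [PiLp.inner_apply]
    have e : ∀ j, (inner ℝ (v.ofLp j) ((A ξ).ofLp j) : ℝ) =
        -(1 / (2 * Real.pi)) * (ξ j * conj (v.ofLp j) - conj (ξ j) * v.ofLp j).im := fun j => by
      have : (A ξ).ofLp j = Complex.I / Real.pi * ξ j := rfl
      rw [this, Complex.inner]
      have hpi := Real.pi_ne_zero
      simp [Complex.div_re, Complex.div_im, Complex.normSq_apply]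
      field_simp
      ring
    simp only [e]
    rw [← Finset.mul_sum, ← Complex.im_sum, sympl_eq_symplForm]
    congr 2
    have hpi := Real.pi_ne_zero
    have e3 : (∑ j, (ξ j * conj (v.ofLp j) - conj (ξ j) * v.ofLp j)).im = symplForm n ξ (S v) := rfl
    rw [e3]
    field_simp
  have hF : ∀ (f : (Fin n → ℂ) → ℂ) ξ,
      FourierTransform.fourier (fun v : E => f (S v)) (A ξ) = κ₁ * symplFourier f ξ :=
      fun f ξ => by
    rw [Real.fourier_eq', symplFourier, ← Complex.real_smul,
      ← hi1 fun x => Complex.exp (sympl ξ x) * f x]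
    simp only [hA, smul_eq_mul]
  have hFi : ∀ (g : E → ℂ) (v : E), κ₂ * FourierTransformInv.fourierInv g v =
      symplFourier (fun ξ => g (A ξ)) (S v) := fun g v => by
    rw [Real.fourierInv_eq', symplFourier, ← Complex.real_smul, ← hi2]
    refine integral_congr_ae (ae_of_all _ fun ξ => ?_)
    simp only [sympl_swap (S v) ξ, hA, smul_eq_mul]
    rw [real_inner_comm]
    congr 2
    push_cast
    ring
  refine ⟨κ₁ / κ₂, by positivity, fun f hf hfi hffi α => ?_⟩
  obtain ⟨v, rfl⟩ := S.surjective α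
  have h3 : Integrable (FourierTransform.fourier fun v : E => f (S v)) := by
    rw [← hj2]
    simp only [hF]
    exact hffi.const_mul _
  have h4 := congrFun (Continuous.fourierInv_fourier_eq (hf.comp S.continuous) ((hj1 f).2 hfi) h3) v
  have h5 := hFi (FourierTransform.fourier fun v : E => f (S v)) v
  simp only [hF] at h5
  rw [symplFourier_const_mul] at h5
  have h6 : FourierTransformInv.fourierInv (FourierTransform.fourier fun v : E => f (S v)) v =
    f (S v) := h4
  rw [h6] at h5
  have hk : (κ₂ : ℂ) ≠ 0 := by exact_mod_cast h2.ne'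
  push_cast
  field_simp
  rw [mul_comm, h5]

end

/-! ### Passage between Wigner functions and `Q` functions -/

section

/-! ### Gaussian states and Gaussian `Q` functions -/

/-- The `Q` function is `c e^{-∑ᵢ T(α - μ)ᵢ²}`. -/
def HasGaussianQ {n : ℕ} (ρ : State n) (c : ℝ) (μ : Fin n → ℂ)
    (T : (Fin n → ℂ) ≃ₗ[ℝ] (Fin (Module.finrank ℝ (Fin n → ℂ)) → ℝ)) : Prop :=
  0 < c ∧ ∀ α, qFunction ρ α = c * Real.exp (-∑ i, T (α - μ) i ^ 2)

theorem wigner_eq {n : ℕ} (ρ : State n) (α : Fin n → ℂ) :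
    wigner ρ α = (1 / Real.pi ^ n : ℂ) * symplFourier (charFunction ρ) α := by
  rw [wigner, symplFourier]
  simp only [sympl]

theorem continuous_charFunction {n : ℕ} (ρ : State n) : Continuous (charFunction ρ) := by
  have h : charFunction ρ = fun ξ => (Real.exp (absSq ξ / 2) : ℂ) * ((1 / Real.pi ^ n : ℂ) *
      symplFourier (fun α => (qFunction ρ α : ℂ)) ξ) := funext (charFunction_eq ρ)
  rw [h]
  have h1 := @continuous_absSq n
  have hi : Integrable fun α => (qFunction ρ α : ℂ) := (integrable_qFunction ρ).ofReal
  have h2 := continuous_symplFourier hi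
  exact (Complex.continuous_ofReal.comp ((h1.div_const 2).rexp)).mul (continuous_const.mul h2)

/-- Real and imaginary parts of all coordinates. -/
def reImCoord (n : ℕ) : (Fin n → ℂ) →ₗ[ℝ] (Fin n ⊕ Fin n → ℝ) :=
  LinearMap.pi (Sum.elim (fun j => Complex.reLm ∘ₗ LinearMap.proj j)
    fun j => Complex.imLm ∘ₗ LinearMap.proj j)

theorem sumSq_reImCoord {n : ℕ} (α : Fin n → ℂ) : sumSq (reImCoord n) α = absSq α := by
  rw [sumSq_apply, Fintype.sum_sum_type, ← Finset.sum_add_distrib, absSq]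
  refine Finset.sum_congr rfl fun j _ => ?_
  rw [Complex.sq_norm, Complex.normSq_apply]
  simp [reImCoord, sq]

/-- Inverting the Wigner transform gives a Gaussian characteristic function. Multiplication by
e^{-|ξ|²/2} adds a nonnegative form to its exponent and yields the Fourier transform of Q, up to a
constant; a second inversion gives Q. -/
theorem IsGaussian.exists_hasGaussianQ {n : ℕ} {ρ : State n} (h : IsGaussian ρ) :
    ∃ c μ T, HasGaussianQ ρ c μ T := by
  obtain ⟨c, μ, q, hc, hq, hW⟩ := h
  obtain ⟨T, hT⟩ := exists_linearEquiv_of_posDef hq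
  obtain ⟨K, hK, hinv⟩ := exists_symplFourier_inversion n
  obtain ⟨C₁, hC₁, hF₁⟩ := exists_symplFourier_gaussian T
  have hpi : (Real.pi : ℂ) ^ n ≠ 0 := pow_ne_zero _ (by exact_mod_cast Real.pi_ne_zero)
  have hW' : symplFourier (charFunction ρ) = fun α =>
      ((Real.pi ^ n * c : ℝ) : ℂ) * (fun α => (Real.exp (-∑ i, T α i ^ 2) : ℂ)) (α - μ) := by
    funext α
    have h1 := hW α
    rw [wigner_eq, one_div, inv_mul_eq_iff_eq_mul₀ hpi, hT] at h1
    rw [h1]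
    push_cast
    ring
  -- Otherwise the integral defining the Wigner function would take the default value 0, whereas a
  -- Gaussian is positive at its centre μ.
  have hχi : Integrable (charFunction ρ) := by
    by_contra hcon
    have h1 := congrFun hW' μ
    rw [symplFourier, integral_undef (by rwa [integrable_exp_sympl_mul_iff])] at h1
    have h2 : (Real.pi ^ n * c : ℝ) ≠ 0 := (mul_pos (pow_pos Real.pi_pos n) hc).ne'
    have h3 : ((Real.pi ^ n * c : ℝ) : ℂ) ≠ 0 := by exact_mod_cast h2
    simp only [sub_self, map_zero, Pi.zero_apply] at h1
    refine h3 ?_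
    simpa using h1.symm
  have hWi : Integrable (symplFourier (charFunction ρ)) := by
    rw [hW']
    exact ((integrable_gaussian T).comp_sub_right μ).const_mul _
  have hχ : ∀ ξ, charFunction ρ ξ = ((K * (Real.pi ^ n * c * C₁) : ℝ) : ℂ) *
      (Complex.exp (sympl ξ μ) * (Real.exp (-∑ i, dualCoord T ξ i ^ 2) : ℂ)) := fun ξ => by
    rw [hinv _ (continuous_charFunction ρ) hχi hWi ξ, hW', symplFourier_const_mul,
      symplFourier_translate (fun α => (Real.exp (-∑ i, T α i ^ 2) : ℂ)), hF₁]
    push_cast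
    ring
  let q₂ : QuadraticForm ℝ (Fin n → ℂ) :=
    sumSq (dualCoord T).toLinearMap + (1 / 2 : ℝ) • sumSq (reImCoord n)
  have hq₂ : ∀ ξ, q₂ ξ = ∑ i, dualCoord T ξ i ^ 2 + absSq ξ / 2 := fun ξ => by
    simp only [q₂, add_apply, smul_apply, sumSq_reImCoord, smul_eq_mul]
    rw [sumSq_apply]
    simp only [LinearEquiv.coe_coe]
    ring
  have hq₂p : q₂.PosDef := fun ξ hξ => by
    rw [hq₂]
    have := sumSq_posDef (dualCoord T) ξ hξ
    rw [sumSq_apply] at this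
    exact add_pos_of_pos_of_nonneg this (by have := absSq_nonneg ξ; positivity)
  obtain ⟨T₂, hT₂⟩ := exists_linearEquiv_of_posDef hq₂p
  obtain ⟨C₂, hC₂, hF₂⟩ := exists_symplFourier_gaussian T₂
  set Qc : (Fin n → ℂ) → ℂ := fun α => (qFunction ρ α : ℂ) with hQc
  have hFQ : symplFourier Qc = fun ξ => ((Real.pi ^ n * (K * (Real.pi ^ n * c * C₁)) : ℝ) : ℂ) *
      (Complex.exp (sympl ξ μ) * (fun ξ => (Real.exp (-∑ i, T₂ ξ i ^ 2) : ℂ)) ξ) := by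
    funext ξ
    have h1 := charFunction_eq ρ ξ
    rw [hχ] at h1
    have h2 : symplFourier Qc ξ = (Real.pi : ℂ) ^ n * ((Real.exp (-(absSq ξ / 2)) : ℂ) *
        ((Real.exp (absSq ξ / 2) : ℂ) * ((1 / Real.pi ^ n : ℂ) * symplFourier Qc ξ))) := by
      rw [← mul_assoc (Real.exp (-(absSq ξ / 2)) : ℂ), ← Complex.ofReal_mul, ← Real.exp_add]
      simp only [neg_add_cancel, Real.exp_zero, Complex.ofReal_one, one_mul]
      rw [← mul_assoc, mul_one_div_cancel hpi, one_mul]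
    rw [h2, ← h1]
    simp only []
    rw [← hT₂, hq₂, neg_add, Real.exp_add]
    push_cast
    ring
  have hQi : Integrable Qc := (integrable_qFunction ρ).ofReal
  have hFQi : Integrable (symplFourier Qc) := by
    rw [hFQ]
    exact ((integrable_exp_sympl_mul_iff' _ μ).2 (integrable_gaussian T₂)).const_mul _
  refine ⟨K * (Real.pi ^ n * (K * (Real.pi ^ n * c * C₁)) * C₂), μ, dualCoord T₂, ?_, fun α => ?_⟩
  · have := Real.pi_pos
    positivity
  · have h1 := hinv Qc (Complex.continuous_ofReal.comp (continuous_qFunction ρ)) hQi hFQi α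
    rw [hFQ, symplFourier_const_mul, symplFourier_modulate, hF₂] at h1
    apply Complex.ofReal_injective
    simp only [hQc] at h1
    rw [h1]
    push_cast
    ring

/-- Here the factor e^{|ξ|²/2} subtracts |ξ|²/2 from the form of the transformed Gaussian, and `hT`
says exactly that the difference is positive definite. -/
theorem HasGaussianQ.isGaussian {n : ℕ} {ρ : State n} {c : ℝ} {μ : Fin n → ℂ}
    {T : (Fin n → ℂ) ≃ₗ[ℝ] (Fin (Module.finrank ℝ (Fin n → ℂ)) → ℝ)} (h : HasGaussianQ ρ c μ T)
    (hT : ∀ ξ, ξ ≠ 0 → absSq ξ / 2 < ∑ i, dualCoord T ξ i ^ 2) : IsGaussian ρ := by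
  obtain ⟨hc, hQ⟩ := h
  obtain ⟨C₁, hC₁, hF₁⟩ := exists_symplFourier_gaussian T
  have hpi : (Real.pi : ℂ) ^ n ≠ 0 := pow_ne_zero _ (by exact_mod_cast Real.pi_ne_zero)
  let q₂ : QuadraticForm ℝ (Fin n → ℂ) :=
    sumSq (dualCoord T).toLinearMap - (1 / 2 : ℝ) • sumSq (reImCoord n)
  have hq₂ : ∀ ξ, q₂ ξ = ∑ i, dualCoord T ξ i ^ 2 - absSq ξ / 2 := fun ξ => by
    simp only [q₂, sub_apply, smul_apply, sumSq_reImCoord, smul_eq_mul]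
    rw [sumSq_apply]
    simp only [LinearEquiv.coe_coe]
    ring
  have hq₂p : q₂.PosDef := fun ξ hξ => by
    rw [hq₂, sub_pos]
    exact hT ξ hξ
  obtain ⟨T₂, hT₂⟩ := exists_linearEquiv_of_posDef hq₂p
  obtain ⟨C₂, hC₂, hF₂⟩ := exists_symplFourier_gaussian T₂
  have hQc : (fun α => (qFunction ρ α : ℂ)) = fun α =>
      (c : ℂ) * (fun α => (Real.exp (-∑ i, T α i ^ 2) : ℂ)) (α - μ) := by
    funext α
    rw [hQ]
    push_cast
    ring
  have hχ : charFunction ρ = fun ξ => ((c * C₁ / Real.pi ^ n : ℝ) : ℂ) *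
      (Complex.exp (sympl ξ μ) * (fun ξ => (Real.exp (-∑ i, T₂ ξ i ^ 2) : ℂ)) ξ) := by
    funext ξ
    rw [charFunction_eq, hQc, symplFourier_const_mul,
      symplFourier_translate (fun α => (Real.exp (-∑ i, T α i ^ 2) : ℂ)), hF₁]
    simp only []
    rw [← hT₂, hq₂, neg_sub, sub_eq_add_neg, Real.exp_add]
    push_cast
    field_simp
  refine ⟨c * C₁ / Real.pi ^ n * C₂ / Real.pi ^ n, μ, sumSq (dualCoord T₂).toLinearMap,
    ?_, sumSq_posDef _, fun α => ?_⟩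
  · have := Real.pi_pos
    positivity
  · rw [wigner_eq, hχ, symplFourier_const_mul, symplFourier_modulate, hF₂, sumSq_apply]
    push_cast
    field_simp

end

/-! ### Construction of states from Gaussian functions -/

section

/-! ### Existence of states with Gaussian `Q` functions -/

open scoped ComplexOrder in
/-- A Hermitian form `|w|² - 2 ∑ᵢ |cᵢ·w|²` without negative values is a sum `∑ₖ |dₖ·w|²`. -/
theorem exists_sum_norm_sq_eq {n : ℕ} {ι : Type*} [Fintype ι] (c : ι → Fin n → ℂ)
    (hc : ∀ w : Fin n → ℂ, 2 * ∑ i, ‖∑ j, c i j * w j‖ ^ 2 ≤ absSq w) :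
    ∃ (m : ℕ) (d : Fin m → Fin n → ℂ), ∀ w : Fin n → ℂ,
      absSq w = 2 * ∑ i, ‖∑ j, c i j * w j‖ ^ 2 + ∑ k, ‖∑ j, d k j * w j‖ ^ 2 := by
  let A : Matrix ι (Fin n) ℂ := Matrix.of c
  -- This is the matrix of |w|² - 2∑|cᵢ·w|². Being positive semidefinite, it is a sum of rank-one
  -- terms, which are the squares |dₖ·w|².
  let M : Matrix (Fin n) (Fin n) ℂ := 1 - (2 : ℂ) • (A.conjTranspose * A)
  have hM : ∀ w : Fin n → ℂ, star w ⬝ᵥ (M.mulVec w) =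
      ((absSq w - 2 * ∑ i, ‖∑ j, c i j * w j‖ ^ 2 : ℝ) : ℂ) := fun w => by
    have h1 : star w ⬝ᵥ ((A.conjTranspose * A).mulVec w) =
        ((∑ i, ‖∑ j, c i j * w j‖ ^ 2 : ℝ) : ℂ) := by
      rw [← Matrix.mulVec_mulVec, Matrix.dotProduct_mulVec, ← Matrix.star_mulVec]
      simp only [dotProduct, Matrix.mulVec, Pi.star_apply, RCLike.star_def, Complex.conj_mul']
      push_cast
      rfl
    have h2 : star w ⬝ᵥ w = (absSq w : ℂ) := by
      rw [← sum_conj_mul_self]; rfl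
    simp only [M]
    rw [Matrix.sub_mulVec, Matrix.one_mulVec, Matrix.smul_mulVec, dotProduct_sub, dotProduct_smul,
      h1, h2, smul_eq_mul]
    push_cast
    rfl
  have hpos : M.PosSemidef := by
    refine Matrix.posSemidef_iff_dotProduct_mulVec.2 ⟨?_, fun w => ?_⟩
    · refine Matrix.isHermitian_one.sub ?_
      have := Matrix.isHermitian_conjTranspose_mul_self A
      rw [Matrix.IsHermitian, Matrix.conjTranspose_smul, this.eq]
      simp
    · rw [hM]
      exact_mod_cast sub_nonneg.2 (hc w)
  obtain ⟨m, v, hv⟩ := Matrix.posSemidef_iff_eq_sum_vecMulVec.1 hpos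
  refine ⟨m, fun k => star (v k), fun w => ?_⟩
  have h3 : star w ⬝ᵥ (M.mulVec w) = ((∑ k, ‖∑ j, star (v k) j * w j‖ ^ 2 : ℝ) : ℂ) := by
    rw [hv, Matrix.sum_mulVec, dotProduct_sum]
    push_cast
    refine Finset.sum_congr rfl fun k _ => ?_
    rw [Matrix.vecMulVec_mulVec, ← Complex.conj_mul']
    simp only [dotProduct, map_sum, map_mul, Pi.star_apply, RCLike.star_def, Complex.conj_conj,
      Pi.smul_apply, MulOpposite.smul_eq_mul_unop, MulOpposite.unop_op]
    rw [Finset.sum_mul]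
    refine Finset.sum_congr rfl fun j _ => ?_
    ring
  rw [hM] at h3
  have h4 := Complex.ofReal_injective h3
  linarith

theorem hasSum_norm_sq_monomialFun {n : ℕ} (z : Fin n → ℂ) :
    HasSum (fun m => ‖monomialFun m z‖ ^ 2) (Real.exp (absSq z)) := by
  have h := Complex.hasSum_re (hasSum_monomialFun_mul z (star z))
  have e : (∑ j, z j * star z j) = (absSq z : ℂ) := sum_mul_conj_self z
  rw [e, ← Complex.ofReal_exp, Complex.ofReal_re] at h
  refine hasSum_of_eq h fun m => ?_
  rw [monomialFun_star, Complex.mul_conj']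
  norm_cast

theorem norm_exp_sq (z : ℂ) : ‖Complex.exp z‖ ^ 2 = Real.exp (2 * z.re) := by
  rw [Complex.norm_exp, ← Real.exp_nat_mul]
  norm_num

/-- A centred Gaussian with coordinates `2 Re cᵢ·x` such that `2 ∑ᵢ |cᵢ·w|² ≤ |w|²` is, up to
normalisation and translation, the `Q` function of a state. -/
theorem exists_state_hasGaussianQ {n : ℕ} (μ : Fin n → ℂ)
    (T : (Fin n → ℂ) ≃ₗ[ℝ] (Fin (Module.finrank ℝ (Fin n → ℂ)) → ℝ))
    (c : Fin (Module.finrank ℝ (Fin n → ℂ)) → Fin n → ℂ)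
    (hT : ∀ x i, T x i = 2 * (∑ j, c i j * x j).re)
    (hc : ∀ w : Fin n → ℂ, 2 * ∑ i, ‖∑ j, c i j * w j‖ ^ 2 ≤ absSq w) :
    ∃ (σ : State n) (C : ℝ), HasGaussianQ σ C μ T := by
  -- With x = α - μ one has Tᵢ(x)² = 2|cᵢ·x|² + 2 Re (cᵢ·x)². Hence e^{-∑Tᵢ²} = e^{-|x|²}
  -- |e^{-∑(cᵢ·x)²}|² e^{∑|dₖ·x|²}, and the last factor is the sum of the squared moduli of all
  -- normalised monomials in the dₖ·x. Every term is then |e^{-|α|²/2} h(α*)|² with `h` entire, that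
  -- is, |⟨α|ψ⟩|² for a vector ψ.
  obtain ⟨m, d, hd⟩ := exists_sum_norm_sq_eq c hc
  set g : (Fin n → ℂ) → ℝ := fun α => Real.exp (-∑ i, T (α - μ) i ^ 2) with hg
  have hTc : Continuous T := T.toContinuousLinearEquiv.continuous
  have hgc : Continuous g := by
    have : ∀ i, Continuous fun α => T (α - μ) i := fun i =>
      (continuous_apply i).comp (hTc.comp (continuous_id.sub continuous_const))
    exact (continuous_finsetSum _ fun i _ => (this i).pow 2).neg.rexp
  have hgi : Integrable g := by
    have h1 := ((integrable_gaussian T).comp_sub_right μ).re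
    refine h1.congr (ae_of_all _ fun α => ?_)
    simp only [RCLike.re_to_complex, Complex.ofReal_re, hg]
  have hgpos : 0 < ∫ α, g α := by
    rw [integral_pos_iff_support_of_nonneg (fun α => (Real.exp_pos _).le) hgi]
    have : Function.support g = Set.univ := by
      ext α; simp [hg, (Real.exp_pos _).ne']
    rw [this]
    exact Measure.measure_univ_pos.2 (NeZero.ne _)
  -- This makes the integral of Q equal to πⁿ, which amounts to trace one.
  set C : ℝ := Real.pi ^ n / ∫ α, g α with hC
  have hCpos : 0 < C := div_pos (pow_pos Real.pi_pos n) hgpos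
  let lin : Fin m → (Fin n → ℂ) → ℂ := fun k z => ∑ j, conj (d k j) * (z + -star μ) j
  -- Coefficients and centre are conjugated because z stands for α*. The terms z·μ - |μ|²/2 account
  -- for the centre: e^{-|α-μ|²} = e^{-|α|²} |e^{α*·μ - |μ|²/2}|².
  let h : (Fin m → ℕ) → (Fin n → ℂ) → ℂ := fun κ z =>
    (Real.sqrt C : ℂ) * monomialFun κ (fun k => lin k z) *
      Complex.exp ((∑ i, (-1) * (∑ j, conj (c i j) * (z + -star μ) j) ^ 2) + ((∑ j, z j * μ j) +
        ((-absSq μ / 2 : ℝ) : ℂ)))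
  have hlin : ∀ k, LineEntire (lin k) := fun k =>
    (LineEntire.linear fun j => conj (d k j)).translate (-star μ)
  have hh : ∀ κ, LineEntire (h κ) := fun κ => by
    refine ((LineEntire.const _).mul (LineEntire.prod _ fun k => ?_)).mul (LineEntire.cexp ?_)
    · simp only [div_eq_mul_inv]
      exact ((hlin k).pow _).mul (LineEntire.const _)
    · refine (LineEntire.sum _ fun i => ?_).add ((LineEntire.linear' μ).add (LineEntire.const _))
      exact (LineEntire.const _).mul
        (((LineEntire.linear fun j => conj (c i j)).translate (-star μ)).pow 2)
  have hval : ∀ α, HasSum (fun κ => ‖(Real.exp (-absSq α / 2) : ℂ) * h κ (star α)‖ ^ 2)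
      (C * g α) := fun α => by
    have h1 := hasSum_norm_sq_monomialFun (fun k => lin k (star α))
    have h2 := h1.mul_left (C * Real.exp (-absSq (α - μ) +
      2 * ((∑ i, (-1) * (∑ j, c i j * (α - μ) j) ^ 2).re)))
    have hl : ∀ (a : Fin n → ℂ), (∑ j, conj (a j) * (star α + -star μ) j) =
        conj (∑ j, a j * (α - μ) j) := fun a => by
      rw [map_sum]
      refine Finset.sum_congr rfl fun j _ => ?_
      simp [sub_eq_add_neg]
    have hl2 : absSq (fun k => lin k (star α)) = ∑ k, ‖∑ j, d k j * (α - μ) j‖ ^ 2 := by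
      refine Finset.sum_congr rfl fun k _ => ?_
      simp only [lin, hl, Complex.norm_conj]
    have e : C * g α = C * Real.exp (-absSq (α - μ) +
        2 * ((∑ i, (-1) * (∑ j, c i j * (α - μ) j) ^ 2).re)) *
          Real.exp (absSq (fun k => lin k (star α))) := by
      rw [mul_assoc, ← Real.exp_add, hg, hl2, hd (α - μ)]
      congr 2
      simp only [hT, mul_pow]
      rw [show ∀ a b e : ℝ, -(a + b) + e + b = -a + e by intros; ring, Complex.re_sum,
        Finset.mul_sum, Finset.mul_sum, ← Finset.sum_neg_distrib, ← Finset.sum_neg_distrib,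
        ← Finset.sum_add_distrib]
      refine congrArg Real.exp (Finset.sum_congr rfl fun i _ => ?_)
      rw [Complex.sq_norm, Complex.normSq_apply]
      simp only [sq, Complex.mul_re, Complex.neg_re, Complex.one_re, Complex.neg_im, Complex.one_im]
      ring
    rw [e]
    refine hasSum_of_eq h2 fun κ => ?_
    simp only [h, norm_mul, mul_pow, Complex.norm_real, Real.norm_of_nonneg (Real.sqrt_nonneg _),
      Real.sq_sqrt hCpos.le, norm_exp_sq, Real.norm_of_nonneg (Real.exp_pos _).le]
    have e2 : Real.exp (-absSq α / 2) ^ 2 = Real.exp (-absSq α) := by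
      rw [← Real.exp_nat_mul]; congr 1; push_cast; ring
    have e3 : -absSq (α - μ) = -absSq α + 2 * (∑ j, star α j * μ j).re - absSq μ := by
      simp only [absSq, Complex.re_sum, Finset.mul_sum, ← Finset.sum_neg_distrib,
        ← Finset.sum_add_distrib, ← Finset.sum_sub_distrib]
      refine Finset.sum_congr rfl fun j _ => ?_
      simp only [Complex.sq_norm, Complex.normSq_apply, Pi.sub_apply, Pi.star_apply,
        RCLike.star_def, Complex.mul_re, Complex.conj_re, Complex.conj_im, Complex.sub_re,
        Complex.sub_im]
      ring
    have e4 : (∑ i, (-1) * (∑ j, conj (c i j) * (star α + -star μ) j) ^ 2).re =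
        (∑ i, (-1) * (∑ j, c i j * (α - μ) j) ^ 2).re := by
      simp only [hl, ← map_pow, Complex.re_sum, neg_one_mul, Complex.neg_re, Complex.conj_re]
    rw [e2, Complex.add_re, Complex.add_re, e4, Complex.ofReal_re, e3]
    rw [show ∀ a b x : ℝ, a * (C * b * x) = C * (a * x) * b by intros; ring, ← Real.exp_add]
    congr 3
    ring
  have hcont : ∀ κ, Continuous fun α => (Real.exp (-absSq α / 2) : ℂ) * h κ (star α) := fun κ =>
    (Complex.continuous_ofReal.comp ((continuous_absSq.neg.div_const 2).rexp)).mul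
      ((hh κ).continuous.comp continuous_star)
  have hle : ∀ κ α, ‖(Real.exp (-absSq α / 2) : ℂ) * h κ (star α)‖ ^ 2 ≤ C * g α := fun κ α =>
    le_hasSum (hval α) κ fun _ _ => by positivity
  have hmem : ∀ κ, MemLp (fun α => (Real.exp (-absSq α / 2) : ℂ) * h κ (star α)) 2 := fun κ => by
    rw [memLp_two_iff_integrable_sq_norm (hcont κ).aestronglyMeasurable]
    refine (hgi.const_mul C).mono' ((hcont κ).norm.pow 2).aestronglyMeasurable
      (ae_of_all _ fun α => ?_)
    rw [Real.norm_of_nonneg (by positivity)]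
    exact hle κ α
  choose ψ hψ using fun κ => (hh κ).exists_inner_coherentState (hmem κ)
  have hQ : ∀ α, HasSum (fun κ => ‖inner ℂ (coherentState α) (ψ κ)‖ ^ 2) (C * g α) := fun α => by
    simpa only [hψ] using hval α
  have hint : HasSum (fun κ => ∫ α, ‖inner ℂ (coherentState α) (ψ κ)‖ ^ 2) (∫ α, C * g α) := by
    refine hasSum_integral_of_dominated_convergence
      (fun κ α => ‖inner ℂ (coherentState α) (ψ κ)‖ ^ 2)
      (fun κ => (integrable_norm_sq_inner (ψ κ)).aestronglyMeasurable)
      (fun κ => ae_of_all _ fun α => ?_) (ae_of_all _ fun α => (hQ α).summable) ?_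
      (ae_of_all _ hQ)
    · rw [Real.norm_of_nonneg (by positivity)]
    · simp only [(hQ _).tsum_eq]
      exact hgi.const_mul C
  have hn : HasSum (fun κ => ‖ψ κ‖ ^ 2) 1 := by
    have hpi := (pow_pos Real.pi_pos n).ne'
    have h1 := hint.mul_left ((Real.pi ^ n)⁻¹)
    simp only [integral_norm_sq_inner] at h1
    rw [integral_const_mul, hC, div_mul_cancel₀ _ hgpos.ne', inv_mul_cancel₀ hpi] at h1
    refine hasSum_of_eq h1 fun κ => ?_
    rw [inv_mul_cancel_left₀ hpi]
  obtain ⟨σ, hσ⟩ := exists_state_decomposes hn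
  exact ⟨σ, C, hCpos, fun α => (hσ.hasSum_qFunction α).unique (hQ α)⟩

end

/-! ### Moments in affine coordinates -/

section

variable {n : ℕ}

/-! ### Equality of averages -/

/-- The average of `f` exists and is the same in both states. -/
structure SameAverage (ρ σ : State n) (f : (Fin n → ℂ) → ℂ) : Prop where
  left : Integrable fun α => f α * (qFunction ρ α : ℂ)
  right : Integrable fun α => f α * (qFunction σ α : ℂ)
  eq : ∫ α, f α * (qFunction ρ α : ℂ) = ∫ α, f α * (qFunction σ α : ℂ)

theorem sameAverage_iff {ρ σ : State n} {f : (Fin n → ℂ) → ℂ} : SameAverage ρ σ f ↔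
    (Integrable fun α => f α * (qFunction ρ α : ℂ)) ∧
    (Integrable fun α => f α * (qFunction σ α : ℂ)) ∧
      ∫ α, f α * (qFunction ρ α : ℂ) = ∫ α, f α * (qFunction σ α : ℂ) :=
  ⟨fun h => ⟨h.left, h.right, h.eq⟩, fun h => ⟨h.1, h.2.1, h.2.2⟩⟩

namespace SameAverage

variable {ρ σ : State n} {f g : (Fin n → ℂ) → ℂ}

theorem congr (hf : SameAverage ρ σ f) (h : ∀ α, g α = f α) : SameAverage ρ σ g :=
  (funext h : g = f) ▸ hf

theorem const_mul (c : ℂ) (hf : SameAverage ρ σ f) : SameAverage ρ σ fun α => c * f α := by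
  simp only [sameAverage_iff, mul_assoc, integral_const_mul]
  exact ⟨hf.left.const_mul c, hf.right.const_mul c, by rw [hf.eq]⟩

theorem one (ρ σ : State n) : SameAverage ρ σ fun _ => 1 := by
  simp only [sameAverage_iff, one_mul, integral_complex_ofReal, integral_qFunction, and_true]
  exact ⟨(integrable_qFunction ρ).ofReal, (integrable_qFunction σ).ofReal⟩

theorem const (ρ σ : State n) (c : ℂ) : SameAverage ρ σ fun _ => c :=
  ((one ρ σ).const_mul c).congr fun _ => (mul_one c).symm

theorem add (hf : SameAverage ρ σ f) (hg : SameAverage ρ σ g) :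
    SameAverage ρ σ fun α => f α + g α := by
  simp only [sameAverage_iff, add_mul]
  refine ⟨hf.left.add hg.left, hf.right.add hg.right, ?_⟩
  rw [integral_add hf.left hg.left, integral_add hf.right hg.right, hf.eq, hg.eq]

theorem sum {ι : Type*} (s : Finset ι) {F : ι → (Fin n → ℂ) → ℂ}
    (hF : ∀ i, SameAverage ρ σ (F i)) : SameAverage ρ σ fun α => ∑ i ∈ s, F i α := by
  classical
  induction s using Finset.induction_on with
  | empty => simpa using const ρ σ 0
  | insert i s hi ih => simpa only [Finset.sum_insert hi] using (hF i).add ih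

theorem conjugate (hf : SameAverage ρ σ f) : SameAverage ρ σ fun α => conj (f α) := by
  have e : ∀ (τ : State n) α, conj (f α) * (qFunction τ α : ℂ) =
      conj (f α * (qFunction τ α : ℂ)) := fun τ α => by rw [map_mul, Complex.conj_ofReal]
  simp only [sameAverage_iff, e, integral_conj]
  have h1 := Complex.conjCLE.toContinuousLinearMap.integrable_comp hf.left
  have h2 := Complex.conjCLE.toContinuousLinearMap.integrable_comp hf.right
  exact ⟨h1, h2, by rw [hf.eq]⟩

theorem affine_mul_affine {ι : Type*} [Fintype ι] {y : ι → (Fin n → ℂ) → ℂ}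
    (h1 : ∀ i, SameAverage ρ σ (y i)) (h2 : ∀ i k, SameAverage ρ σ fun α => y i α * y k α)
    (p q : ι → ℂ) (s t : ℂ) :
    SameAverage ρ σ fun α => (∑ i, p i * y i α + s) * (∑ i, q i * y i α + t) := by
  have h := (((SameAverage.sum Finset.univ fun i => SameAverage.sum Finset.univ fun k =>
    (h2 i k).const_mul (p i * q k)).add
      (SameAverage.sum Finset.univ fun i => (h1 i).const_mul (p i * t))).add
      (SameAverage.sum Finset.univ fun i => (h1 i).const_mul (s * q i))).add (const ρ σ (s * t))
  refine h.congr fun α => ?_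
  rw [add_mul, mul_add, mul_add, Finset.sum_mul_sum, Finset.sum_mul, Finset.mul_sum, ← add_assoc]
  congr 2
  · congr 1
    · exact Finset.sum_congr rfl fun i _ => Finset.sum_congr rfl fun k _ => by ring
    · exact Finset.sum_congr rfl fun i _ => by ring
  · exact Finset.sum_congr rfl fun i _ => by ring

theorem affine {ι : Type*} [Fintype ι] {y : ι → (Fin n → ℂ) → ℂ}
    (h1 : ∀ i, SameAverage ρ σ (y i)) (p : ι → ℂ) (s : ℂ) :
    SameAverage ρ σ fun α => ∑ i, p i * y i α + s :=
  (SameAverage.sum Finset.univ fun i => (h1 i).const_mul (p i)).add (const ρ σ s)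

end SameAverage

/-- A real linear functional on phase space is the real part of a complex linear one. -/
theorem exists_eq_two_mul_re (L : (Fin n → ℂ) →ₗ[ℝ] ℝ) :
    ∃ a : Fin n → ℂ, ∀ x, L x = 2 * (∑ j, a j * x j).re := by
  refine ⟨fun j => ⟨L (Pi.single j 1) / 2, -L (Pi.single j Complex.I) / 2⟩, fun x => ?_⟩
  have h : x = ∑ j, ((x j).re • (Pi.single j 1 : Fin n → ℂ) +
      (x j).im • (Pi.single j Complex.I : Fin n → ℂ)) := by
    funext k
    rw [Finset.sum_apply, Finset.sum_eq_single k]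
    · simp
    · intro j _ hj
      simp [Pi.single_eq_of_ne' hj]
    · simp
  conv_lhs => rw [h]
  rw [map_sum, Complex.re_sum, Finset.mul_sum]
  refine Finset.sum_congr rfl fun j _ => ?_
  rw [map_add, map_smul, map_smul, Complex.mul_re, smul_eq_mul, smul_eq_mul]
  ring

theorem integrable_mul_qFunction {ρ : State n} (hρ : HasFiniteSecondMoments ρ)
    {f : (Fin n → ℂ) → ℂ} (hf : Continuous f) {K : ℝ} {μ : Fin n → ℂ}
    (hb : ∀ α, ‖f α‖ ≤ K * (1 + absSq (α - μ))) :
    Integrable fun α => f α * (qFunction ρ α : ℂ) := by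
  have h1 : Integrable fun α : Fin n → ℂ => ∑ j, ‖α j - μ j‖ ^ 2 * qFunction ρ α := by
    refine integrable_finsetSum _ fun j _ => ?_
    have := integrable_norm_sq_affine_mul hρ (Pi.single j 1) 0 (-μ j)
    simpa [Pi.single_apply, ← sub_eq_add_neg] using this
  refine (((integrable_qFunction ρ).add h1).const_mul K).mono'
    (hf.mul (Complex.continuous_ofReal.comp (continuous_qFunction ρ))).aestronglyMeasurable
    (ae_of_all _ fun α => ?_)
  rw [norm_mul, Complex.norm_real, Real.norm_of_nonneg (qFunction_nonneg ρ α)]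
  have h2 := mul_le_mul_of_nonneg_right (hb α) (qFunction_nonneg ρ α)
  refine h2.trans (le_of_eq ?_)
  simp only [Pi.add_apply, absSq, Pi.sub_apply]
  rw [← Finset.sum_mul]
  ring

theorem norm_sq_le_absSq (α : Fin n → ℂ) (j : Fin n) : ‖α j‖ ^ 2 ≤ absSq α :=
  Finset.single_le_sum (f := fun j => ‖α j‖ ^ 2) (fun _ _ => by positivity) (Finset.mem_univ j)

theorem norm_mul_le_absSq (α : Fin n → ℂ) (j k : Fin n) : ‖α j‖ * ‖α k‖ ≤ absSq α := by
  have h1 := norm_sq_le_absSq α j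
  have h2 := norm_sq_le_absSq α k
  nlinarith [sq_nonneg (‖α j‖ - ‖α k‖)]

theorem norm_le_one_add_absSq (α : Fin n → ℂ) (j : Fin n) : ‖α j‖ ≤ 1 + absSq α := by
  have h1 := norm_sq_le_absSq α j
  nlinarith [sq_nonneg (‖α j‖ - 1)]

/-- The coordinates and their conjugates. -/
def coordConj : Fin n ⊕ Fin n → (Fin n → ℂ) → ℂ
  | Sum.inl j, α => α j
  | Sum.inr j, α => conj (α j)

theorem SameMoments.sameAverage {ρ σ : State n} (h : SameMoments ρ σ) :
    (∀ i, SameAverage ρ σ (coordConj i)) ∧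
      ∀ i k, SameAverage ρ σ fun α => coordConj i α * coordConj k α := by
  have hpi : (1 / Real.pi ^ n : ℂ) ≠ 0 :=
    one_div_ne_zero (pow_ne_zero _ (by exact_mod_cast Real.pi_ne_zero))
  have key : ∀ f : (Fin n → ℂ) → ℂ, Continuous f → (∀ α, ‖f α‖ ≤ 1 + absSq α) →
      qAverage ρ f = qAverage σ f → SameAverage ρ σ f := fun f hf hb he => by
    have hb' : ∀ α, ‖f α‖ ≤ 1 * (1 + absSq (α - 0)) := fun α => by
      rw [sub_zero, one_mul]; exact hb α
    exact ⟨integrable_mul_qFunction h.finite_left hf hb',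
      integrable_mul_qFunction h.finite_right hf hb', mul_left_cancel₀ hpi he⟩
  have h1 : ∀ j, SameAverage ρ σ fun α => α j := fun j =>
    key _ (by fun_prop) (fun α => norm_le_one_add_absSq α j) (h.first j)
  have h2 : ∀ j k, SameAverage ρ σ fun α => α j * α k := fun j k =>
    key _ (by fun_prop) (fun α => by
      rw [norm_mul]; linarith [norm_mul_le_absSq α j k]) (h.second j k)
  have h3 : ∀ j k, SameAverage ρ σ fun α => α j * conj (α k) := fun j k =>
    key _ (by fun_prop) (fun α => by
      rw [norm_mul, Complex.norm_conj]; linarith [norm_mul_le_absSq α j k]) (h.second_conj j k)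
  refine ⟨?_, ?_⟩
  · rintro (j | j)
    · exact h1 j
    · exact (h1 j).conjugate
  · rintro (j | j) (k | k)
    · exact h2 j k
    · exact h3 j k
    · exact (h3 k j).congr fun α => mul_comm _ _
    · exact (h2 j k).conjugate.congr fun α => (map_mul _ _ _).symm

/-- Real linear functionals are complex linear combinations of the αⱼ and αⱼ*, so centring at μ
gives affine combinations. The products of two of them have equal averages by assumption or by
conjugation. -/
theorem SameMoments.sameAverage_mul {ρ σ : State n} (h : SameMoments ρ σ) (μ : Fin n → ℂ)
    (L M : (Fin n → ℂ) →ₗ[ℝ] ℝ) :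
    SameAverage ρ σ fun α => (L (α - μ) : ℂ) * (M (α - μ) : ℂ) := by
  obtain ⟨a, ha⟩ := exists_eq_two_mul_re L
  obtain ⟨b, hb⟩ := exists_eq_two_mul_re M
  have e : ∀ (c : Fin n → ℂ) (α : Fin n → ℂ), ((2 * (∑ j, c j * (α - μ) j).re : ℝ) : ℂ) =
      ∑ i, Sum.elim c (star c) i * coordConj i α +
        ((-(2 * (∑ j, c j * μ j).re) : ℝ) : ℂ) := fun c α => by
    rw [Fintype.sum_sum_type]
    simp only [Sum.elim_inl, Sum.elim_inr, coordConj, Pi.star_apply, RCLike.star_def]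
    have e1 : ∑ j, conj (c j) * conj (α j) = conj (∑ j, c j * α j) := by simp
    rw [e1, Complex.add_conj, ← Complex.ofReal_add]
    congr 1
    simp only [Pi.sub_apply, mul_sub, Finset.sum_sub_distrib, Complex.sub_re]
    ring
  simp only [ha, hb, e]
  exact SameAverage.affine_mul_affine h.sameAverage.1 h.sameAverage.2 _ _ _ _

/-- Equality of the moments can be checked in real affine coordinates. -/
theorem sameMoments_of_sameAverage {ρ σ : State n} {ι : Type*} [Fintype ι] [DecidableEq ι]
    (hρ : HasFiniteSecondMoments ρ) (T : (Fin n → ℂ) ≃ₗ[ℝ] (ι → ℝ)) (μ : Fin n → ℂ)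
    (h1 : ∀ i, SameAverage ρ σ fun α => (T (α - μ) i : ℂ))
    (h2 : ∀ i k, SameAverage ρ σ fun α => (T (α - μ) i : ℂ) * (T (α - μ) k : ℂ)) :
    SameMoments ρ σ := by
  have e : ∀ (α : Fin n → ℂ) j, α j =
      ∑ i, T.symm (Pi.single i 1) j * (T (α - μ) i : ℂ) + μ j := fun α j => by
    have := congrFun (eq_sum_coord T (α - μ)) j
    rw [Finset.sum_apply, Pi.sub_apply, sub_eq_iff_eq_add] at this
    rw [this]
    congr 1
    refine Finset.sum_congr rfl fun i _ => ?_
    rw [Pi.smul_apply, Complex.real_smul, mul_comm]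
  have e' : ∀ (α : Fin n → ℂ) j, conj (α j) =
      ∑ i, conj (T.symm (Pi.single i 1) j) * (T (α - μ) i : ℂ) + conj (μ j) := fun α j => by
    conv_lhs => rw [e α j]
    simp
  have h3 : ∀ j k, SameAverage ρ σ fun α => α j * conj (α k) := fun j k =>
    (SameAverage.affine_mul_affine h1 h2 (fun i => T.symm (Pi.single i 1) j)
      (fun i => conj (T.symm (Pi.single i 1) k)) (μ j) (conj (μ k))).congr
        fun α => by rw [← e, ← e']
  refine ⟨hρ, fun j => ?_, fun j => ?_, fun j k => ?_, fun j k => ?_⟩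
  · refine (h3 j j).right.re.congr (ae_of_all _ fun α => ?_)
    simp only []
    rw [Complex.mul_conj']
    norm_cast
  · have h := SameAverage.affine h1 (fun i => T.symm (Pi.single i 1) j) (μ j)
    simp only [← e] at h
    rw [qAverage, qAverage, h.eq]
  · have h := SameAverage.affine_mul_affine h1 h2 (fun i => T.symm (Pi.single i 1) j)
      (fun i => T.symm (Pi.single i 1) k) (μ j) (μ k)
    simp only [← e] at h
    rw [qAverage, qAverage, h.eq]
  · rw [qAverage, qAverage, (h3 j k).eq]

/-! ### Gaussian moments -/

theorem integrable_pow_mul_exp_neg_sq (k : ℕ) :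
    Integrable fun t : ℝ => t ^ k * Real.exp (-t ^ 2) := by
  have := integrable_rpow_mul_exp_neg_mul_sq (b := 1) one_pos (s := k)
    (by have : (0 : ℝ) ≤ k := Nat.cast_nonneg k
        linarith)
  simpa using this

theorem integral_mul_exp_neg_sq : ∫ t : ℝ, t ^ 1 * Real.exp (-t ^ 2) = 0 := by
  have h := integral_neg_eq_self (fun t : ℝ => t ^ 1 * Real.exp (-t ^ 2)) volume
  simp only [pow_one, neg_mul, neg_sq, integral_neg] at h ⊢
  linarith

/-- The derivative of t e^{-t²} integrates to zero. -/
theorem integral_sq_mul_exp_neg_sq :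
    ∫ t : ℝ, t ^ 2 * Real.exp (-t ^ 2) = 1 / 2 * ∫ t : ℝ, t ^ 0 * Real.exp (-t ^ 2) := by
  have hd : ∀ t : ℝ, HasDerivAt (fun t : ℝ => t ^ 1 * Real.exp (-t ^ 2))
      (t ^ 0 * Real.exp (-t ^ 2) - 2 * (t ^ 2 * Real.exp (-t ^ 2))) t := fun t => by
    have h0 : HasDerivAt (fun t : ℝ => -t ^ 2) (-(2 * t)) t := by
      exact (hasDerivAt_pow 2 t).fun_neg.congr_deriv (by norm_num)
    refine ((hasDerivAt_pow 1 t).mul h0.exp).congr_deriv ?_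
    simp only [Nat.cast_one, Nat.sub_self, pow_zero, pow_one]
    ring
  have h := integral_eq_zero_of_hasDerivAt_of_integrable hd
    ((integrable_pow_mul_exp_neg_sq 0).sub ((integrable_pow_mul_exp_neg_sq 2).const_mul 2))
    (integrable_pow_mul_exp_neg_sq 1)
  rw [integral_sub (integrable_pow_mul_exp_neg_sq 0)
    ((integrable_pow_mul_exp_neg_sq 2).const_mul 2), integral_const_mul] at h
  linarith

theorem prod_pow_mul_exp {ι : Type*} [Fintype ι] (k : ι → ℕ) (y : ι → ℝ) :
    ∏ i, (y i ^ k i * Real.exp (-y i ^ 2)) = (∏ i, y i ^ k i) * Real.exp (-∑ i, y i ^ 2) := by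
  rw [Finset.prod_mul_distrib, ← Finset.sum_neg_distrib, Real.exp_sum]

theorem integrable_prod_pow_mul_exp {ι : Type*} [Fintype ι] (k : ι → ℕ) :
    Integrable fun y : ι → ℝ => (∏ i, y i ^ k i) * Real.exp (-∑ i, y i ^ 2) := by
  simp only [← prod_pow_mul_exp]
  exact Integrable.fintype_prod fun i => integrable_pow_mul_exp_neg_sq (k i)

theorem integral_prod_pow_mul_exp {ι : Type*} [Fintype ι] (k : ι → ℕ) :
    ∫ y : ι → ℝ, (∏ i, y i ^ k i) * Real.exp (-∑ i, y i ^ 2) =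
      ∏ i, ∫ t : ℝ, t ^ k i * Real.exp (-t ^ 2) := by
  simp only [← prod_pow_mul_exp]
  exact integral_fintype_prod_volume_eq_prod (fun i t => t ^ k i * Real.exp (-t ^ 2))

theorem prod_pow_single {ι : Type*} [Fintype ι] [DecidableEq ι] (y : ι → ℝ) (i : ι) (a : ℕ) :
    ∏ l, y l ^ (Pi.single i a : ι → ℕ) l = y i ^ a := by
  rw [Finset.prod_eq_single i]
  · simp
  · intro l _ hl; simp [Pi.single_eq_of_ne hl]
  · simp

theorem integral_coord_mul_exp {ι : Type*} [Fintype ι] [DecidableEq ι] (i : ι) :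
    Integrable (fun y : ι → ℝ => y i * Real.exp (-∑ l, y l ^ 2)) ∧
      ∫ y : ι → ℝ, y i * Real.exp (-∑ l, y l ^ 2) = 0 := by
  have h1 := integrable_prod_pow_mul_exp (Pi.single i 1 : ι → ℕ)
  have h2 := integral_prod_pow_mul_exp (Pi.single i 1 : ι → ℕ)
  simp only [prod_pow_single] at h1 h2
  rw [Finset.prod_eq_zero (Finset.mem_univ i)
    (by rw [Pi.single_eq_same]; exact integral_mul_exp_neg_sq)] at h2
  simp only [pow_one] at h1 h2
  exact ⟨h1, h2⟩

theorem integral_coord_mul_coord_mul_exp {ι : Type*} [Fintype ι] [DecidableEq ι] (i k : ι) :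
    Integrable (fun y : ι → ℝ => y i * y k * Real.exp (-∑ l, y l ^ 2)) ∧
      ∫ y : ι → ℝ, y i * y k * Real.exp (-∑ l, y l ^ 2) =
        if i = k then 1 / 2 * ∫ y : ι → ℝ, Real.exp (-∑ l, y l ^ 2) else 0 := by
  have e : ∀ y : ι → ℝ, ∏ l, y l ^ (Pi.single i 1 + Pi.single k 1 : ι → ℕ) l = y i * y k :=
      fun y => by
    simp only [Pi.add_apply, pow_add, Finset.prod_mul_distrib, prod_pow_single, pow_one]
  have h1 := integrable_prod_pow_mul_exp (Pi.single i 1 + Pi.single k 1 : ι → ℕ)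
  have h2 := integral_prod_pow_mul_exp (Pi.single i 1 + Pi.single k 1 : ι → ℕ)
  simp only [e] at h1 h2
  refine ⟨h1, h2.trans ?_⟩
  split_ifs with h
  · subst h
    have h3 := integral_prod_pow_mul_exp (0 : ι → ℕ)
    simp only [Pi.zero_apply, pow_zero, Finset.prod_const_one, one_mul] at h3
    rw [h3, ← Finset.mul_prod_erase _ _ (Finset.mem_univ i),
      ← Finset.mul_prod_erase _ (fun _ => ∫ t : ℝ, Real.exp (-t ^ 2)) (Finset.mem_univ i),
      ← mul_assoc]
    congr 1
    · simpa using integral_sq_mul_exp_neg_sq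
    · refine Finset.prod_congr rfl fun l hl => ?_
      simp [Pi.single_eq_of_ne (Finset.ne_of_mem_erase hl)]
  · refine Finset.prod_eq_zero (Finset.mem_univ i) ?_
    rw [Pi.add_apply, Pi.single_eq_same, Pi.single_eq_of_ne h]
    exact integral_mul_exp_neg_sq

/-- Moments of a Gaussian `Q` function. -/
theorem HasGaussianQ.moments {σ : State n} {C : ℝ} {μ : Fin n → ℂ}
    {T : (Fin n → ℂ) ≃ₗ[ℝ] (Fin (Module.finrank ℝ (Fin n → ℂ)) → ℝ)}
    (h : HasGaussianQ σ C μ T) :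
    (∀ i, Integrable (fun α => T (α - μ) i * qFunction σ α) ∧
      ∫ α, T (α - μ) i * qFunction σ α = 0) ∧
    ∀ i k, Integrable (fun α => T (α - μ) i * T (α - μ) k * qFunction σ α) ∧
      ∫ α, T (α - μ) i * T (α - μ) k * qFunction σ α =
        if i = k then 1 / 2 * Real.pi ^ n else 0 := by
  obtain ⟨κ, hκ, hI, hi⟩ := exists_integral_comp_linearEquiv T
  have tr : ∀ f : (Fin (Module.finrank ℝ (Fin n → ℂ)) → ℝ) → ℝ,
      Integrable (fun y => f y * Real.exp (-∑ l, y l ^ 2)) →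
      Integrable (fun α => f (T (α - μ)) * qFunction σ α) ∧
      ∫ α, f (T (α - μ)) * qFunction σ α =
        C * κ * ∫ y, f y * Real.exp (-∑ l, y l ^ 2) := fun f hf => by
    have e : ∀ α, f (T (α - μ)) * qFunction σ α =
        C * (fun x => (fun y => f y * Real.exp (-∑ l, y l ^ 2)) (T x)) (α - μ) := fun α => by
      rw [h.2]; ring
    simp only [e]
    refine ⟨(((hi _).2 hf).comp_sub_right μ).const_mul C, ?_⟩
    rw [integral_const_mul, integral_sub_right_eq_self (μ := (volume : Measure (Fin n → ℂ)))
      (fun x => (fun y => f y * Real.exp (-∑ l, y l ^ 2)) (T x)) μ,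
      hI (fun y => f y * Real.exp (-∑ l, y l ^ 2)), smul_eq_mul, mul_assoc]
  -- The normalisation of Q eliminates the unknown product of C and the Jacobian κ.
  have hn : C * κ * ∫ y : Fin (Module.finrank ℝ (Fin n → ℂ)) → ℝ,
      Real.exp (-∑ l, y l ^ 2) = Real.pi ^ n := by
    have h0 := integrable_prod_pow_mul_exp (0 : Fin (Module.finrank ℝ (Fin n → ℂ)) → ℕ)
    simp only [Pi.zero_apply, pow_zero, Finset.prod_const_one] at h0
    have h1 := (tr (fun _ => 1) h0).2
    simp only [one_mul, integral_qFunction] at h1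
    exact h1.symm
  refine ⟨fun i => ?_, fun i k => ?_⟩
  · obtain ⟨h1, h2⟩ := tr (fun y => y i) (integral_coord_mul_exp i).1
    exact ⟨h1, by rw [h2, (integral_coord_mul_exp i).2, mul_zero]⟩
  · obtain ⟨h1, h2⟩ := tr (fun y => y i * y k) (integral_coord_mul_coord_mul_exp i k).1
    refine ⟨h1, ?_⟩
    rw [h2, (integral_coord_mul_coord_mul_exp i k).2]
    split_ifs
    · rw [← hn]; ring
    · rw [mul_zero]

end

/-! ### Uncertainty relations for the covariance -/

section

variable {n : ℕ} {ρ : State n}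

/-! ### Covariance and existence of the Gaussian partner -/

theorem SameMoments.refl (hρ : HasFiniteSecondMoments ρ) : SameMoments ρ ρ :=
  ⟨hρ, hρ, fun _ => rfl, fun _ _ => rfl, fun _ _ => rfl⟩

theorem integrable_linear_mul_linear (hρ : HasFiniteSecondMoments ρ) (μ : Fin n → ℂ)
    (L M : (Fin n → ℂ) →ₗ[ℝ] ℝ) :
    Integrable fun α => L (α - μ) * M (α - μ) * qFunction ρ α := by
  have h := ((SameMoments.refl hρ).sameAverage_mul μ L M).left.re
  refine h.congr (ae_of_all _ fun α => ?_)
  simp only []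
  norm_cast

theorem integrable_norm_sq_centred (hρ : HasFiniteSecondMoments ρ) (u v μ : Fin n → ℂ) :
    Integrable fun α : Fin n → ℂ => ‖∑ j, u j * (α - μ) j + ∑ j, v j * conj ((α - μ) j)‖ ^ 2 *
      qFunction ρ α := by
  refine (integrable_norm_sq_affine_mul hρ u v
    (-∑ j, u j * μ j - ∑ j, v j * conj (μ j))).congr (ae_of_all _ fun α => ?_)
  simp only [Pi.sub_apply, map_sub, mul_sub, Finset.sum_sub_distrib]
  congr 3
  ring

theorem uncertainty_centred (hρ : HasFiniteSecondMoments ρ) (u v μ : Fin n → ℂ) :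
    absSq u * Real.pi ^ n ≤ ∫ α : Fin n → ℂ,
      ‖∑ j, u j * (α - μ) j + ∑ j, v j * conj ((α - μ) j)‖ ^ 2 * qFunction ρ α := by
  refine (uncertainty hρ u v (-∑ j, u j * μ j - ∑ j, v j * conj (μ j))).trans (le_of_eq ?_)
  refine integral_congr_ae (ae_of_all _ fun α => ?_)
  simp only [Pi.sub_apply, map_sub, mul_sub, Finset.sum_sub_distrib]
  congr 3
  ring

/-- The strict uncertainty relation for real linear functionals. -/
theorem uncertainty_strict (hρ : HasFiniteSecondMoments ρ) (μ : Fin n → ℂ) {u : Fin n → ℂ}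
    (hu : 0 < absSq u) :
    absSq u * Real.pi ^ n <
      ∫ α : Fin n → ℂ, (2 * (∑ j, u j * (α - μ) j).re) ^ 2 * qFunction ρ α := by
  have hpi := pow_pos Real.pi_pos n
  have hX : Integrable fun α : Fin n → ℂ =>
      (2 * (∑ j, u j * (α - μ) j).re) ^ 2 * qFunction ρ α := by
    refine (integrable_norm_sq_centred hρ u (star u) μ).congr (ae_of_all _ fun α => ?_)
    have e1 : ∑ j, star u j * conj ((α - μ) j) = conj (∑ j, u j * (α - μ) j) := by simp
    simp only [e1]
    rw [Complex.add_conj, Complex.norm_real, Real.norm_eq_abs, sq_abs]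
  have hZ : Integrable fun α : Fin n → ℂ => ‖∑ j, u j * (α - μ) j‖ ^ 2 * qFunction ρ α := by
    simpa using integrable_norm_sq_centred hρ u 0 μ
  -- Take v = (1 - t)u* in the uncertainty inequality. For z = u·(α - μ), |z + (1-t)z*|² = (1-t)(2
  -- Re z)² + t²|z|²; at t = 0 only the nonstrict bound would result.
  have key : ∀ t : ℝ, absSq u * Real.pi ^ n ≤
      (1 - t) * (∫ α : Fin n → ℂ, (2 * (∑ j, u j * (α - μ) j).re) ^ 2 * qFunction ρ α) +
        t ^ 2 * ∫ α : Fin n → ℂ, ‖∑ j, u j * (α - μ) j‖ ^ 2 * qFunction ρ α := fun t => by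
    refine (uncertainty_centred hρ u (((1 - t : ℝ) : ℂ) • star u) μ).trans (le_of_eq ?_)
    rw [← integral_const_mul, ← integral_const_mul,
      ← integral_add (hX.const_mul _) (hZ.const_mul _)]
    refine integral_congr_ae (ae_of_all _ fun α => ?_)
    have e1 : ∑ j, (((1 - t : ℝ) : ℂ) • star u) j * conj ((α - μ) j) =
        ((1 - t : ℝ) : ℂ) * conj (∑ j, u j * (α - μ) j) := by
      simp only [map_sum, map_mul, Finset.mul_sum, Pi.smul_apply, smul_eq_mul, Pi.star_apply,
        RCLike.star_def]
      exact Finset.sum_congr rfl fun j _ => by ring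
    simp only [e1]
    generalize ∑ j, u j * (α - μ) j = z
    rw [Complex.sq_norm, Complex.sq_norm, Complex.normSq_apply, Complex.normSq_apply]
    simp only [Complex.add_re, Complex.add_im, Complex.re_ofReal_mul, Complex.im_ofReal_mul,
      Complex.conj_re, Complex.conj_im]
    ring
  set V := ∫ α : Fin n → ℂ, (2 * (∑ j, u j * (α - μ) j).re) ^ 2 * qFunction ρ α
  set A := ∫ α : Fin n → ℂ, ‖∑ j, u j * (α - μ) j‖ ^ 2 * qFunction ρ α
  by_contra! hV
  set a := absSq u * Real.pi ^ n
  have ha : 0 < a := mul_pos hu hpi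
  have hA : 0 ≤ A := integral_nonneg fun α =>
    mul_nonneg (by positivity) (qFunction_nonneg ρ α)
  -- If V ≤ a, the inequality `key` forces a ≤ tA for every t in (0, 1]. This choice has tA < a, a
  -- contradiction.
  set t := a / (a + 2 * A)
  have hd : 0 < a + 2 * A := by linarith
  have ht0 : 0 < t := div_pos ha hd
  have ht1 : t ≤ 1 := (div_le_one hd).2 (by linarith)
  have htd : t * (a + 2 * A) = a := div_mul_cancel₀ _ hd.ne'
  have h1 := key t
  have h2 : (1 - t) * V ≤ (1 - t) * a := mul_le_mul_of_nonneg_left hV (by linarith)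
  have h3 : t * a ≤ t * (t * A) := by nlinarith
  have h4 : a ≤ t * A := le_of_mul_le_mul_left h3 ht0
  nlinarith

theorem symplForm_eq_two_mul_re (ξ x : Fin n → ℂ) :
    symplForm n ξ x = 2 * (∑ j, (Complex.I * conj (ξ j)) * x j).re := by
  have h : symplForm n ξ x = (∑ j, (ξ j * conj (x j) - conj (ξ j) * x j)).im := rfl
  rw [h, Complex.im_sum, Complex.re_sum, Finset.mul_sum]
  refine Finset.sum_congr rfl fun j _ => ?_
  simp
  ring

theorem absSq_pos {ξ : Fin n → ℂ} (h : ξ ≠ 0) : 0 < absSq ξ := by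
  obtain ⟨j, hj⟩ := Function.ne_iff.1 h
  exact Finset.sum_pos' (fun _ _ => by positivity)
    ⟨j, Finset.mem_univ j, pow_pos (norm_pos_iff.2 hj) 2⟩

theorem lt_integral_symplForm_sq (hρ : HasFiniteSecondMoments ρ) (μ : Fin n → ℂ) {ξ : Fin n → ℂ}
    (hξ : ξ ≠ 0) :
    absSq ξ * Real.pi ^ n < ∫ α, symplForm n ξ (α - μ) ^ 2 * qFunction ρ α := by
  have e : absSq (fun j => Complex.I * conj (ξ j)) = absSq ξ := by simp [absSq]
  have h := uncertainty_strict hρ μ (u := fun j => Complex.I * conj (ξ j))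
    (by rw [e]; exact absSq_pos hξ)
  simpa only [e, ← symplForm_eq_two_mul_re] using h

/-- The coordinates `T(α - μ)` are uncorrelated with variance `1/2`. -/
def Whitens (ρ : State n) (μ : Fin n → ℂ)
    (T : (Fin n → ℂ) ≃ₗ[ℝ] (Fin (Module.finrank ℝ (Fin n → ℂ)) → ℝ)) : Prop :=
  ∀ i k, ∫ α, T (α - μ) i * T (α - μ) k * qFunction ρ α = if i = k then 1 / 2 * Real.pi ^ n else 0

theorem exists_whitens (hρ : HasFiniteSecondMoments ρ) (μ : Fin n → ℂ) :
    ∃ T, Whitens ρ μ T := by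
  have hpi := pow_pos Real.pi_pos n
  have hi : ∀ ξ ζ, Integrable fun α =>
      symplForm n ξ (α - μ) * symplForm n ζ (α - μ) * qFunction ρ α := fun ξ ζ =>
    integrable_linear_mul_linear hρ μ _ _
  -- Half the covariance of the functionals ω(ξ, ·); positive definite by the strict uncertainty
  -- relation.
  let B : LinearMap.BilinForm ℝ (Fin n → ℂ) := LinearMap.mk₂ ℝ
    (fun ξ ζ => (2 * Real.pi ^ n)⁻¹ *
      ∫ α, symplForm n ξ (α - μ) * symplForm n ζ (α - μ) * qFunction ρ α)
    (fun ξ ξ' ζ => by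
      rw [← mul_add, ← integral_add (hi _ _) (hi _ _)]
      simp only [map_add, LinearMap.add_apply, add_mul])
    (fun c ξ ζ => by
      rw [smul_eq_mul, mul_left_comm]
      simp only [map_smul, LinearMap.smul_apply, smul_eq_mul, mul_assoc, integral_const_mul])
    (fun ξ ζ ζ' => by
      rw [← mul_add, ← integral_add (hi _ _) (hi _ _)]
      simp only [map_add, LinearMap.add_apply, add_mul, mul_add])
    (fun c ξ ζ => by
      have e : ∀ x y z : ℝ, x * (c * y) * z = c * (x * y * z) := fun x y z => by ring
      rw [smul_eq_mul, mul_left_comm]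
      simp only [map_smul, LinearMap.smul_apply, smul_eq_mul, e, integral_const_mul])
  have hB : ∀ ξ ζ, B ξ ζ = (2 * Real.pi ^ n)⁻¹ *
      ∫ α, symplForm n ξ (α - μ) * symplForm n ζ (α - μ) * qFunction ρ α := fun _ _ => rfl
  have hBs : ∀ ξ ζ, B ζ ξ = B ξ ζ := fun ξ ζ => by
    rw [hB, hB]
    simp only [mul_comm (symplForm n ζ _)]
  have hpos : B.toQuadraticMap.PosDef := fun ξ hξ => by
    rw [LinearMap.BilinMap.toQuadraticMap_apply, hB]
    have h1 := lt_integral_symplForm_sq hρ μ hξ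
    have h2 : 0 < absSq ξ * Real.pi ^ n := mul_pos (absSq_pos hξ) hpi
    simp only [← sq]
    have := h2.trans h1
    positivity
  obtain ⟨S, hS⟩ := exists_linearEquiv_of_posDef hpos
  have hS' : ∀ ξ, B ξ ξ = ∑ i, S ξ i ^ 2 := hS
  have hSB : ∀ ξ ζ, B ξ ζ = ∑ i, S ξ i * S ζ i := fun ξ ζ => by
    have h1 := hS' (ξ + ζ)
    simp only [map_add, LinearMap.add_apply, hBs ξ ζ, hS', Pi.add_apply, add_sq,
      Finset.sum_add_distrib] at h1
    have h2 : ∑ i, 2 * S ξ i * S ζ i = 2 * ∑ i, S ξ i * S ζ i := by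
      rw [Finset.mul_sum]; exact Finset.sum_congr rfl fun i _ => by ring
    linarith
  -- The functionals ω(sᵢ, ·), for the basis sᵢ with coordinates S, have covariance 2 δᵢₖ; the
  -- factor 1/2 in `dualCoord` brings it to δᵢₖ/2.
  refine ⟨dualCoord S, fun i k => ?_⟩
  have h1 := hSB (S.symm (Pi.single i 1)) (S.symm (Pi.single k 1))
  simp only [LinearEquiv.apply_symm_apply] at h1
  have h2 : ∑ l, (Pi.single i (1 : ℝ) : _ → ℝ) l * (Pi.single k (1 : ℝ) : _ → ℝ) l =
      if i = k then 1 else 0 := by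
    simp [Pi.single_apply, eq_comm]
  have e : ∀ α, dualCoord S (α - μ) i * dualCoord S (α - μ) k * qFunction ρ α =
      1 / 4 * (symplForm n (S.symm (Pi.single i 1)) (α - μ) *
        symplForm n (S.symm (Pi.single k 1)) (α - μ) * qFunction ρ α) := fun α => by
    rw [dualCoord_apply, dualCoord_apply, symplForm_swap (α - μ), symplForm_swap (α - μ)]
    ring
  simp only [e]
  rw [h2, hB, inv_mul_eq_iff_eq_mul₀ (by positivity)] at h1
  rw [integral_const_mul, h1]
  split_ifs <;> ring

theorem Whitens.integral_sum (hρ : HasFiniteSecondMoments ρ) {μ : Fin n → ℂ}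
    {T : (Fin n → ℂ) ≃ₗ[ℝ] (Fin (Module.finrank ℝ (Fin n → ℂ)) → ℝ)} (h : Whitens ρ μ T)
    (a : Fin (Module.finrank ℝ (Fin n → ℂ)) → ℝ) :
    Integrable (fun α => (∑ i, a i * T (α - μ) i) ^ 2 * qFunction ρ α) ∧
      ∫ α, (∑ i, a i * T (α - μ) i) ^ 2 * qFunction ρ α =
        1 / 2 * Real.pi ^ n * ∑ i, a i ^ 2 := by
  have hi : ∀ i k, Integrable fun α => T (α - μ) i * T (α - μ) k * qFunction ρ α := fun i k =>
    integrable_linear_mul_linear hρ μ (LinearMap.proj i ∘ₗ T.toLinearMap)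
      (LinearMap.proj k ∘ₗ T.toLinearMap)
  have e : ∀ α, (∑ i, a i * T (α - μ) i) ^ 2 * qFunction ρ α =
      ∑ i, ∑ k, a i * a k * (T (α - μ) i * T (α - μ) k * qFunction ρ α) := fun α => by
    rw [sq, Finset.sum_mul_sum, Finset.sum_mul]
    refine Finset.sum_congr rfl fun i _ => ?_
    rw [Finset.sum_mul]
    exact Finset.sum_congr rfl fun k _ => by ring
  simp only [e]
  refine ⟨integrable_finsetSum _ fun i _ => integrable_finsetSum _ fun k _ =>
    (hi i k).const_mul _, ?_⟩
  rw [integral_finsetSum _ fun i _ => integrable_finsetSum _ fun k _ => (hi i k).const_mul _,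
    Finset.mul_sum]
  refine Finset.sum_congr rfl fun i _ => ?_
  rw [integral_finsetSum _ fun k _ => (hi i k).const_mul _]
  simp only [integral_const_mul, h i, mul_ite, mul_zero, Finset.sum_ite_eq, Finset.mem_univ,
    if_true]
  ring

/-- In whitening coordinates ω(ξ, ·) has coefficients 2 `dualCoord T ξ`, hence second moment
2∑(dualCoordᵢ)² about μ, and the strict uncertainty relation applies. This is the hypothesis of
`HasGaussianQ.isGaussian`. -/
theorem Whitens.lt_sum_dualCoord_sq (hρ : HasFiniteSecondMoments ρ) {μ : Fin n → ℂ}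
    {T : (Fin n → ℂ) ≃ₗ[ℝ] (Fin (Module.finrank ℝ (Fin n → ℂ)) → ℝ)} (h : Whitens ρ μ T)
    {ξ : Fin n → ℂ} (hξ : ξ ≠ 0) : absSq ξ / 2 < ∑ i, dualCoord T ξ i ^ 2 := by
  have h1 := lt_integral_symplForm_sq hρ μ hξ
  simp only [symplForm_eq_sum_dualCoord T] at h1
  rw [(h.integral_sum hρ _).2] at h1
  simp only [mul_pow, ← Finset.mul_sum] at h1
  have hpi := pow_pos Real.pi_pos n
  have h2 : absSq ξ * Real.pi ^ n < (2 * ∑ i, dualCoord T ξ i ^ 2) * Real.pi ^ n := by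
    linarith
  have := lt_of_mul_lt_mul_right h2 hpi.le
  linarith

theorem norm_sum_mul_sq_le (u w : Fin n → ℂ) : ‖∑ j, u j * w j‖ ^ 2 ≤ absSq u * absSq w := by
  have h1 : ‖∑ j, u j * w j‖ ≤ ∑ j, ‖u j‖ * ‖w j‖ :=
    (norm_sum_le _ _).trans (le_of_eq (Finset.sum_congr rfl fun j _ => norm_mul _ _))
  exact (pow_le_pow_left₀ (norm_nonneg _) h1 2).trans
    (Finset.sum_mul_sq_le_sq_mul_sq Finset.univ (fun j => ‖u j‖) fun j => ‖w j‖)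

/-- Let H be the left-hand side. The functional ∑λᵢTᵢ with λᵢ = 2(cᵢ·w)* has second moment H, and
its part linear in α has a coefficient vector u with u·w = H. The uncertainty inequality gives |u|²
≤ H, and Cauchy–Schwarz gives H² ≤ |u|²|w|² ≤ H|w|². -/
theorem Whitens.two_mul_sum_norm_sq_le (hρ : HasFiniteSecondMoments ρ) {μ : Fin n → ℂ}
    {T : (Fin n → ℂ) ≃ₗ[ℝ] (Fin (Module.finrank ℝ (Fin n → ℂ)) → ℝ)} (h : Whitens ρ μ T)
    {c : Fin (Module.finrank ℝ (Fin n → ℂ)) → Fin n → ℂ}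
    (hT : ∀ x i, T x i = 2 * (∑ j, c i j * x j).re) (w : Fin n → ℂ) :
    2 * ∑ i, ‖∑ j, c i j * w j‖ ^ 2 ≤ absSq w := by
  set lam : Fin (Module.finrank ℝ (Fin n → ℂ)) → ℂ := fun i => 2 * conj (∑ j, c i j * w j)
  set H := 2 * ∑ i, ‖∑ j, c i j * w j‖ ^ 2 with hH
  have hH0 : 0 ≤ H := by positivity
  let u : Fin n → ℂ := fun j => ∑ i, lam i * c i j
  let v : Fin n → ℂ := fun j => ∑ i, lam i * conj (c i j)
  have huw : ∑ j, u j * w j = (H : ℂ) := by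
    simp only [u, Finset.sum_mul]
    rw [Finset.sum_comm, hH]
    push_cast
    rw [Finset.mul_sum]
    refine Finset.sum_congr rfl fun i _ => ?_
    simp only [mul_assoc, ← Finset.mul_sum, lam, Complex.conj_mul']
  have hL : ∀ x : Fin n → ℂ, ∑ j, u j * x j + ∑ j, v j * conj (x j) = ∑ i, lam i * (T x i : ℂ) :=
      fun x => by
    simp only [u, v, Finset.sum_mul]
    rw [Finset.sum_comm, Finset.sum_comm (f := fun j i => lam i * conj (c i j) * conj (x j)),
      ← Finset.sum_add_distrib]
    refine Finset.sum_congr rfl fun i _ => ?_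
    rw [hT, ← Complex.add_conj, map_sum, mul_add, Finset.mul_sum, Finset.mul_sum]
    simp only [map_mul, mul_assoc]
  have hN : ∀ x : Fin n → ℂ, ‖∑ i, lam i * (T x i : ℂ)‖ ^ 2 =
      (∑ i, (lam i).re * T x i) ^ 2 + (∑ i, (lam i).im * T x i) ^ 2 := fun x => by
    rw [Complex.sq_norm, Complex.normSq_apply, Complex.re_sum, Complex.im_sum]
    simp only [Complex.re_mul_ofReal, Complex.im_mul_ofReal, sq]
  have h1 := uncertainty_centred hρ u v μ
  simp only [hL, hN, add_mul] at h1
  obtain ⟨hi1, he1⟩ := h.integral_sum hρ fun i => (lam i).re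
  obtain ⟨hi2, he2⟩ := h.integral_sum hρ fun i => (lam i).im
  rw [integral_add hi1 hi2, he1, he2, ← mul_add, ← Finset.sum_add_distrib] at h1
  have e3 : ∑ i, ((lam i).re ^ 2 + (lam i).im ^ 2) = 2 * H := by
    rw [hH, ← mul_assoc, Finset.mul_sum]
    refine Finset.sum_congr rfl fun i _ => ?_
    have : (lam i).re ^ 2 + (lam i).im ^ 2 = ‖lam i‖ ^ 2 := by
      rw [Complex.sq_norm, Complex.normSq_apply]; ring
    rw [this]
    simp only [lam, norm_mul, Complex.norm_conj, mul_pow]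
    norm_num
  rw [e3] at h1
  have h2 : absSq u ≤ H := by
    have hpi := pow_pos Real.pi_pos n
    exact le_of_mul_le_mul_right (by linarith) hpi
  have h3 := norm_sum_mul_sq_le u w
  rw [huw, Complex.norm_real, Real.norm_eq_abs, sq_abs] at h3
  have h4 : H ^ 2 ≤ H * absSq w := h3.trans (mul_le_mul_of_nonneg_right h2 (absSq_nonneg w))
  rcases hH0.eq_or_lt with h0 | h0
  · rw [← h0]; exact absSq_nonneg w
  · rw [sq] at h4
    exact le_of_mul_le_mul_left h4 h0

theorem exists_mean (hρ : HasFiniteSecondMoments ρ) : ∃ μ : Fin n → ℂ,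
    ∀ L : (Fin n → ℂ) →ₗ[ℝ] ℝ, Integrable (fun α => L (α - μ) * qFunction ρ α) ∧
      ∫ α, L (α - μ) * qFunction ρ α = 0 := by
  have hpi : (Real.pi : ℂ) ^ n ≠ 0 := pow_ne_zero _ (by exact_mod_cast Real.pi_ne_zero)
  have hi : ∀ j, Integrable fun α : Fin n → ℂ => α j * (qFunction ρ α : ℂ) := fun j =>
    ((SameMoments.refl hρ).sameAverage.1 (Sum.inl j)).left
  have hq : Integrable fun α => (qFunction ρ α : ℂ) := (integrable_qFunction ρ).ofReal
  refine ⟨fun j => (Real.pi ^ n : ℂ)⁻¹ * ∫ α : Fin n → ℂ, α j * (qFunction ρ α : ℂ), fun L => ?_⟩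
  set μ : Fin n → ℂ := fun j => (Real.pi ^ n : ℂ)⁻¹ * ∫ α : Fin n → ℂ, α j * (qFunction ρ α : ℂ)
  have hj : ∀ j, Integrable (fun α : Fin n → ℂ => (α - μ) j * (qFunction ρ α : ℂ)) ∧
      ∫ α : Fin n → ℂ, (α - μ) j * (qFunction ρ α : ℂ) = 0 := fun j => by
    simp only [Pi.sub_apply, sub_mul]
    refine ⟨(hi j).sub (hq.const_mul _), ?_⟩
    rw [integral_sub (hi j) (hq.const_mul _), integral_const_mul, integral_complex_ofReal,
      integral_qFunction]
    simp only [μ]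
    push_cast
    field_simp
    ring
  obtain ⟨a, ha⟩ := exists_eq_two_mul_re L
  have hs : Integrable fun α : Fin n → ℂ =>
      ∑ j, 2 * a j * ((α - μ) j * (qFunction ρ α : ℂ)) :=
    integrable_finsetSum _ fun j _ => (hj j).1.const_mul _
  have e : ∀ α, L (α - μ) * qFunction ρ α =
      RCLike.re (∑ j, 2 * a j * ((α - μ) j * (qFunction ρ α : ℂ))) := fun α => by
    have e1 : ∑ j, 2 * a j * ((α - μ) j * (qFunction ρ α : ℂ)) =
        ((2 * qFunction ρ α : ℝ) : ℂ) * ∑ j, a j * (α - μ) j := by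
      rw [Finset.mul_sum]
      refine Finset.sum_congr rfl fun j _ => ?_
      push_cast
      ring
    rw [e1, ha, RCLike.re_to_complex, Complex.re_ofReal_mul]
    ring
  simp only [e]
  refine ⟨hs.re, ?_⟩
  rw [integral_re hs, integral_finsetSum _ fun j _ => (hj j).1.const_mul _]
  simp only [integral_const_mul, (hj _).2, mul_zero, Finset.sum_const_zero, map_zero]

/-- The Gaussian e^{-∑Tᵢ(α-μ)²} in whitening coordinates centred at the mean has mean μ and variance
1/2 in every coordinate, just as ρ does. The uncertainty relations for ρ make it the Q function of a
state and make that state Gaussian. -/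
theorem exists_isGaussianPartner (hρ : HasFiniteSecondMoments ρ) :
    ∃ σ, IsGaussianPartner ρ σ := by
  obtain ⟨μ, hμ⟩ := exists_mean hρ
  obtain ⟨T, hT⟩ := exists_whitens hρ μ
  choose c hc using fun i => exists_eq_two_mul_re (LinearMap.proj i ∘ₗ T.toLinearMap)
  have hc' : ∀ x i, T x i = 2 * (∑ j, c i j * x j).re := fun x i => hc i x
  obtain ⟨σ, C, hσ⟩ := exists_state_hasGaussianQ μ T c hc' (hT.two_mul_sum_norm_sq_le hρ hc')
  obtain ⟨m1, m2⟩ := hσ.moments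
  refine ⟨σ, hσ.isGaussian fun ξ hξ => hT.lt_sum_dualCoord_sq hρ hξ,
    sameMoments_of_sameAverage hρ T μ (fun i => ?_) fun i k => ?_⟩
  · obtain ⟨h1, h2⟩ := hμ (LinearMap.proj i ∘ₗ T.toLinearMap)
    have h1' : Integrable fun α => T (α - μ) i * qFunction ρ α := h1
    have h2' : ∫ α, T (α - μ) i * qFunction ρ α = 0 := h2
    rw [sameAverage_iff]
    simp only [← Complex.ofReal_mul, integral_complex_ofReal, h2', (m1 i).2, and_true]
    exact ⟨h1'.ofReal, (m1 i).1.ofReal⟩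
  · have h1' : Integrable fun α => T (α - μ) i * T (α - μ) k * qFunction ρ α :=
      integrable_linear_mul_linear hρ μ (LinearMap.proj i ∘ₗ T.toLinearMap)
        (LinearMap.proj k ∘ₗ T.toLinearMap)
    rw [sameAverage_iff]
    simp only [← Complex.ofReal_mul, integral_complex_ofReal, hT i k, (m2 i k).2, and_true]
    exact ⟨h1'.ofReal, (m2 i k).1.ofReal⟩

end

/-! ### Relative entropy of `Q` functions -/

section

variable {n : ℕ} {ρ σ : State n}

/-! ### Gaussian states maximise the Wehrl entropy -/

theorem mul_klFun_div {x y : ℝ} (hx : 0 ≤ x) (hy : 0 < y) :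
    y * InformationTheory.klFun (x / y) = x * Real.log x - x * Real.log y + y - x := by
  rw [InformationTheory.klFun]
  rcases hx.eq_or_lt with rfl | hx
  · simp
  · rw [Real.log_div hx.ne' hy.ne']
    field_simp

theorem HasGaussianQ.qFunction_pos {C : ℝ} {μ : Fin n → ℂ}
    {T : (Fin n → ℂ) ≃ₗ[ℝ] (Fin (Module.finrank ℝ (Fin n → ℂ)) → ℝ)}
    (h : HasGaussianQ σ C μ T) (α : Fin n → ℂ) : 0 < qFunction σ α := by
  rw [h.2]
  exact mul_pos h.1 (Real.exp_pos _)

/-- The logarithm of the Gaussian is a constant minus a sum of squares of centred linear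
functionals, so its average is fixed by the second moments about μ. -/
theorem SameMoments.integral_mul_log {C : ℝ} {μ : Fin n → ℂ}
    {T : (Fin n → ℂ) ≃ₗ[ℝ] (Fin (Module.finrank ℝ (Fin n → ℂ)) → ℝ)}
    (hm : SameMoments ρ σ) (h : HasGaussianQ σ C μ T) :
    Integrable (fun α => qFunction ρ α * Real.log (qFunction σ α)) ∧
    Integrable (fun α => qFunction σ α * Real.log (qFunction σ α)) ∧
      ∫ α, qFunction ρ α * Real.log (qFunction σ α) =
        ∫ α, qFunction σ α * Real.log (qFunction σ α) := by
  have hs : SameAverage ρ σ fun α => (Real.log (qFunction σ α) : ℂ) := by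
    have h1 := (SameAverage.const ρ σ (Real.log C : ℂ)).add ((SameAverage.sum Finset.univ fun i =>
      hm.sameAverage_mul μ (LinearMap.proj i ∘ₗ T.toLinearMap)
        (LinearMap.proj i ∘ₗ T.toLinearMap)).const_mul (-1))
    refine h1.congr fun α => ?_
    rw [h.2, Real.log_mul h.1.ne' (Real.exp_pos _).ne', Real.log_exp]
    push_cast
    rw [neg_one_mul]
    congr 2
    exact Finset.sum_congr rfl fun i _ => sq _
  obtain ⟨h1, h2, h3⟩ := hs
  simp only [← Complex.ofReal_mul, mul_comm (Real.log _)] at h1 h2 h3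
  rw [integral_complex_ofReal, integral_complex_ofReal] at h3
  refine ⟨?_, ?_, Complex.ofReal_injective h3⟩
  · simpa using h1.re
  · simpa using h2.re

theorem continuous_mul_log_qFunction (ρ : State n) :
    Continuous fun α => qFunction ρ α * Real.log (qFunction ρ α) :=
  Real.continuous_mul_log.comp (continuous_qFunction ρ)

/-- As the averages of log Q_σ agree, the entropy difference is π⁻ⁿ ∫ Q_σ klFun(Q_ρ/Q_σ), the
integral of a nonnegative function that vanishes only where Q_ρ = Q_σ. -/
theorem SameMoments.gibbs {C : ℝ} {μ : Fin n → ℂ}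
    {T : (Fin n → ℂ) ≃ₗ[ℝ] (Fin (Module.finrank ℝ (Fin n → ℂ)) → ℝ)}
    (hm : SameMoments ρ σ) (h : HasGaussianQ σ C μ T) :
    HasFiniteWehrlEntropy ρ ∧ HasFiniteWehrlEntropy σ ∧ wehrlEntropy ρ ≤ wehrlEntropy σ ∧
      (wehrlEntropy ρ = wehrlEntropy σ → ρ = σ) := by
  obtain ⟨h1, h2, h3⟩ := hm.integral_mul_log h
  have hρ := integrable_qFunction ρ
  have hσ := integrable_qFunction σ
  have hkl : ∀ α, qFunction σ α * InformationTheory.klFun (qFunction ρ α / qFunction σ α) =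
      qFunction ρ α * Real.log (qFunction ρ α) - qFunction ρ α * Real.log (qFunction σ α) +
        qFunction σ α - qFunction ρ α := fun α =>
    mul_klFun_div (qFunction_nonneg ρ α) (h.qFunction_pos α)
  have hkl0 : ∀ α, 0 ≤ qFunction σ α * InformationTheory.klFun (qFunction ρ α / qFunction σ α) :=
    fun α => mul_nonneg (qFunction_nonneg σ α) (InformationTheory.klFun_nonneg
      (div_nonneg (qFunction_nonneg ρ α) (qFunction_nonneg σ α)))
  have h4 : HasFiniteWehrlEntropy ρ := by
    -- As Q_ρ ≤ 1, the function Q_ρ log Q_ρ is nonpositive; nonnegativity of the relative entropy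
    -- integrand bounds it below by an integrable function.
    refine ((hσ.sub hρ).sub h1).mono' (continuous_mul_log_qFunction ρ).aestronglyMeasurable
      (ae_of_all _ fun α => ?_)
    have h5 := hkl0 α
    rw [hkl] at h5
    have h6 := Real.mul_log_nonpos (qFunction_nonneg ρ α) (qFunction_le_one ρ α)
    rw [Real.norm_of_nonpos h6]
    simp only [Pi.sub_apply]
    linarith
  have h4' : Integrable fun α => qFunction ρ α * Real.log (qFunction ρ α) := h4
  set D : (Fin n → ℂ) → ℝ := fun α =>
    qFunction σ α * InformationTheory.klFun (qFunction ρ α / qFunction σ α) with hD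
  have hDi : Integrable D := by
    simp only [hD, hkl]
    exact ((h4'.sub h1).add hσ).sub hρ
  have hDint : ∫ α, D α = (∫ α, qFunction ρ α * Real.log (qFunction ρ α)) -
      ∫ α, qFunction σ α * Real.log (qFunction σ α) := by
    simp only [hD, hkl]
    have e1 := integral_sub ((h4'.sub h1).add hσ) hρ
    have e2 := integral_add (h4'.sub h1) hσ
    have e3 := integral_sub h4' h1
    simp only [Pi.add_apply, Pi.sub_apply, integral_qFunction] at e1 e2 e3
    rw [e1, e2, e3, h3]
    ring
  have hDint0 : 0 ≤ ∫ α, D α := integral_nonneg hkl0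
  have hpi : 0 < 1 / Real.pi ^ n := one_div_pos.2 (pow_pos Real.pi_pos n)
  have hW : wehrlEntropy σ - wehrlEntropy ρ = 1 / Real.pi ^ n * ∫ α, D α := by
    rw [wehrlEntropy, wehrlEntropy, hDint]
    ring
  refine ⟨h4, h2, ?_, fun he => ?_⟩
  · have := mul_nonneg hpi.le hDint0
    linarith
  · rw [he, sub_self, eq_comm, mul_eq_zero, or_iff_right hpi.ne',
      integral_eq_zero_iff_of_nonneg hkl0 hDi] at hW
    have hDc : Continuous D := by
      have hpos := fun α => (h.qFunction_pos α).ne'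
      exact (continuous_qFunction σ).mul (InformationTheory.continuous_klFun.comp
        ((continuous_qFunction ρ).div (continuous_qFunction σ) hpos))
    -- Continuity turns vanishing almost everywhere into vanishing everywhere.
    have hD0 : D = 0 := (Continuous.ae_eq_iff_eq volume hDc continuous_zero).1 hW
    refine State.eq_of_qFunction_eq fun α => ?_
    have h7 := (mul_eq_zero.1 (congrFun hD0 α)).resolve_left (h.qFunction_pos α).ne'
    rw [InformationTheory.klFun_eq_zero_iff
      (div_nonneg (qFunction_nonneg ρ α) (qFunction_nonneg σ α)),
      div_eq_one_iff_eq (h.qFunction_pos α).ne'] at h7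
    exact h7

theorem SameMoments.symm (h : SameMoments ρ σ) : SameMoments σ ρ :=
  ⟨h.finite_right, h.finite_left, fun j => (h.first j).symm, fun j k => (h.second j k).symm,
    fun j k => (h.second_conj j k).symm⟩

theorem SameMoments.trans {τ : State n} (h : SameMoments ρ σ) (h' : SameMoments σ τ) :
    SameMoments ρ τ :=
  ⟨h.finite_left, h'.finite_right, fun j => (h.first j).trans (h'.first j),
    fun j k => (h.second j k).trans (h'.second j k),
    fun j k => (h.second_conj j k).trans (h'.second_conj j k)⟩

/-- Two Gaussian partners have the same moments, so each has at least the entropy of the other; the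
equality case of Gibbs' inequality identifies them. -/
theorem IsGaussianPartner.unique {τ : State n} (h : IsGaussianPartner ρ σ)
    (h' : IsGaussianPartner ρ τ) : σ = τ := by
  obtain ⟨C, μ, T, hσ⟩ := h.1.exists_hasGaussianQ
  obtain ⟨C', μ', T', hτ⟩ := h'.1.exists_hasGaussianQ
  have hm := h.2.symm.trans h'.2
  obtain ⟨-, -, h1, h2⟩ := hm.gibbs hτ
  obtain ⟨-, -, h3, -⟩ := hm.symm.gibbs hσ
  exact h2 (h1.antisymm h3)

theorem gaussianPartner_eq (h : IsGaussianPartner ρ σ) : gaussianPartner ρ = σ := by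
  have he : ∃ σ, IsGaussianPartner ρ σ := ⟨σ, h⟩
  rw [gaussianPartner, dif_pos he]
  exact he.choose_spec.unique h

end

end Bosonic

end

theorem mainTheorem3 (n : ℕ) (ρ : Bosonic.State n) (hρ : Bosonic.HasFiniteSecondMoments ρ) :
    (∃! σ : Bosonic.State n, Bosonic.IsGaussianPartner ρ σ) ∧
    Bosonic.HasFiniteWehrlEntropy ρ ∧
    Bosonic.HasFiniteWehrlEntropy (Bosonic.gaussianPartner ρ) ∧
    0 ≤ Bosonic.nonGaussianity ρ ∧
    (Bosonic.nonGaussianity ρ = 0 ↔ Bosonic.IsGaussian ρ) := by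
  obtain ⟨σ, hσ⟩ := Bosonic.exists_isGaussianPartner hρ
  obtain ⟨C, μ, T, hQ⟩ := hσ.1.exists_hasGaussianQ
  obtain ⟨h1, h2, h3, h4⟩ := hσ.2.gibbs hQ
  rw [Bosonic.nonGaussianity, Bosonic.gaussianPartner_eq hσ]
  refine ⟨⟨σ, hσ, fun τ hτ => hτ.unique hσ⟩, h1, h2, sub_nonneg.2 h3, fun h => ?_, fun h => ?_⟩
  · rw [h4 (sub_eq_zero.1 h).symm]
    exact hσ.1
  -- A Gaussian state with finite second moments is its own partner.
  · rw [Bosonic.IsGaussianPartner.unique hσ ⟨h, Bosonic.SameMoments.refl hρ⟩, sub_self]
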